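/- Let $G$ be a fixed finite nonempty simple graph without isolated vertices. For $\alpha\in[0,1]^{V(G)}$, $\beta\in[0,2]^{E(G)}$ and a subgraph $H\subseteq G$ put $\Delta(H)=\sum_{u\in V(H)}\alpha(u)-\sum_{e\in E(H)}\beta(e)$. The pair $\Delta=(\alpha,\beta)$ is a threshold weighting, $\Delta\in\theta(G)$, if $\Delta(H)\ge 0$ for all $H\subseteq G$ and $\Delta(G)=0$. A union sequence is a sequence $(H_1,\dots,H_k)$ of distinct subgraphs of $G$ with $H_k=G$ in which every $H_i$ is a single edge (with its endpoints) or the union of two previous terms. Let $\kappa_\Delta(G)=\min_S\max_{H\in S}\Delta(H)$, the minimum being over all union sequences $S$, and $\kappa(G)=\max_{\Delta\in\theta(G)}\kappa_\Delta(G)$. The threshold random graph $\mathbf X_{\Delta,n}$ has vertices $u_i$ for $u\in V(G)$ and $1\le i\le n^{\alpha(u)}$ (where $n^{\alpha(u)}$ may be rounded up or down arbitrarily), the vertex $u_i$ has color $u$, and for each $uv\in E(G)$ each pair $u_iv_j$ is an edge, independently, with probability $n^{-\beta(uv)}$. Given a graph $X$ with a coloring $\chi:V(X)\to V(G)$, the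 problem $\mathrm{SUB}_{\mathrm{col}}(G)$ asks whether $X$ has a subgraph $G'$ such that $\chi$ restricted to $V(G')$ is an isomorphism from $G'$ to $G$. The input is given as the list of the sizes of the color classes followed by the list of the edges of $X$ (in any order), with numbers in binary. Theorem. There is a constant $c$, depending only on $G$, such that for every $\Delta\in\theta(G)$ we have $\kappa_\Delta(G)\le\kappa(G)$, and there is a deterministic multitape Turing machine that correctly solves $\mathrm{SUB}_{\mathrm{col}}(G)$ on every input and that, with probability tending to $1$ as $n\to\infty$, halts on $\mathbf X_{\Delta,n}$ (for every order of the input list) after at most $c\,n^{\kappa_\Delta(G)}(\log n)^c$ steps, hence also after at most $c\,n^{\kappa(G)}(\log n)^c$ steps. -/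

import Mathlib

open MeasureTheory ProbabilityTheory Filter Topology

noncomputable section

namespace ColoredSubgraph

/-! ### Threshold weightings, union sequences, and the parameter `κ` -/

open Classical in
/-- `α(H) - β(H)`: the sum of `α` over the vertices of `H` minus the sum of `β` over its edges. -/
def excess {V : Type} [Fintype V] (G : SimpleGraph V) (α : V → ℝ) (β : Sym2 V → ℝ)
    (H : G.Subgraph) : ℝ :=
  ∑ u with u ∈ H.verts, α u - ∑ e with e ∈ H.edgeSet, β e

/-- The set `θ(G)` of threshold weightings `Δ = (α, β)` on `G`. The edge weights are given the
value `0` outside `E(G)`. -/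
structure ThresholdWeighting {V : Type} [Fintype V] (G : SimpleGraph V) where
  α : V → ℝ
  β : Sym2 V → ℝ
  α_nonneg : ∀ u, 0 ≤ α u
  α_le_one : ∀ u, α u ≤ 1
  β_nonneg : ∀ e, 0 ≤ β e
  β_le_two : ∀ e, β e ≤ 2
  β_eq_zero : ∀ e, e ∉ G.edgeSet → β e = 0
  excess_nonneg : ∀ H : G.Subgraph, 0 ≤ excess G α β H
  excess_top : excess G α β ⊤ = 0

/-- `Δ(H) = α(H) - β(H)` for a subgraph `H` of `G`. -/
def ThresholdWeighting.weight {V : Type} [Fintype V] {G : SimpleGraph V}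
    (Δ : ThresholdWeighting G) (H : G.Subgraph) : ℝ :=
  excess G Δ.α Δ.β H

/-- `S ∈ Seq(G)`: a sequence of distinct subgraphs of `G`, ending with `G`, in which every term is
an edge (with its two endpoints) or the union of two previous terms. -/
def IsUnionSequence {V : Type} (G : SimpleGraph V) (S : List G.Subgraph) : Prop :=
  S.Nodup ∧ S.getLast? = some ⊤ ∧
    ∀ (i : ℕ) (hi : i < S.length),
      (∃ (u v : V) (h : G.Adj u v), S[i] = G.subgraphOfAdj h) ∨
      (∃ (j k : ℕ) (hj : j < i) (hk : k < i), S[i] = S[j] ⊔ S[k])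

/-- `κ_Δ(G)`: the minimum, over the (finitely many) union sequences `S`, of `max_{H ∈ S} Δ(H)`. -/
def kappaOf {V : Type} [Fintype V] (G : SimpleGraph V) (Δ : ThresholdWeighting G) : ℝ :=
  sInf {x : ℝ | ∃ S : List G.Subgraph, IsUnionSequence G S ∧
    IsGreatest {y : ℝ | ∃ H ∈ S, y = Δ.weight H} x}

/-- `κ(G)`: the maximum of `κ_Δ(G)` over all threshold weightings `Δ` (the supremum is a maximum,
since `θ(G)` is compact and `κ_Δ(G)` is continuous in `Δ`). -/
def kappa {V : Type} [Fintype V] (G : SimpleGraph V) : ℝ :=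
  sSup (Set.range fun Δ : ThresholdWeighting G => kappaOf G Δ)

/-! ### Colored subgraph isomorphism -/

/-- The colored subgraph isomorphism problem: `X`, with coloring `χ : V(X) → V(G)`, has a subgraph
`G'` such that `χ` restricted to `V(G')` is an isomorphism from `G'` to `G`. -/
def SubCol {V W : Type} (G : SimpleGraph V) (X : SimpleGraph W) (χ : W → V) : Prop :=
  ∃ (G' : X.Subgraph) (f : G'.coe ≃g G), ∀ x : G'.verts, f x = χ x

/-- The vertices `u_i`, where `u ∈ V` and `i < m u`. The vertex `u_i` has color `u`. -/
abbrev Vtx {V : Type} (m : V → ℕ) : Type := Σ u : V, Fin (m u)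

/-! ### The threshold random graph -/

/-- The graph of all possible edges: `u_i` and `v_j` are adjacent iff `uv` is an edge of `G`. -/
def blowup {V : Type} (G : SimpleGraph V) (m : V → ℕ) : SimpleGraph (Vtx m) :=
  G.comap Sigma.fst

/-- The sample space: which of the possible edges are present. -/
abbrev Sample {V : Type} (G : SimpleGraph V) (m : V → ℕ) : Type := (blowup G m).edgeSet → Bool

/-- The graph given by a point of the sample space. -/
def sampleGraph {V : Type} (G : SimpleGraph V) (m : V → ℕ) (ω : Sample G m) :
    SimpleGraph (Vtx m) :=
  SimpleGraph.fromEdgeSet {e | ∃ h : e ∈ (blowup G m).edgeSet, ω ⟨e, h⟩ = true}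

theorem edgeProb_mem (n : ℕ) {b : ℝ} (hb : 0 ≤ b) :
    (n : ℝ) ^ (-b) ∈ Set.Icc (0 : ℝ) 1 := by
  refine ⟨Real.rpow_nonneg (Nat.cast_nonneg n) _, ?_⟩
  rcases Nat.eq_zero_or_pos n with rfl | hn
  · rcases hb.eq_or_lt with rfl | hb
    · simp
    · rw [Nat.cast_zero, Real.zero_rpow (by linarith)]
      exact zero_le_one
  · exact Real.rpow_le_one_of_one_le_of_nonpos (by exact_mod_cast hn) (by linarith)

/-- The probability `n ^ (-β(uv))` with which an edge `u_i v_j` is present. -/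
def edgeProb {V : Type} [Fintype V] {G : SimpleGraph V} (Δ : ThresholdWeighting G) (n : ℕ)
    {m : V → ℕ} (e : Sym2 (Vtx m)) : unitInterval :=
  ⟨(n : ℝ) ^ (-Δ.β (e.map Sigma.fst)), edgeProb_mem n (Δ.β_nonneg _)⟩

open Classical in
/-- The law of the threshold random graph `X_{Δ,n}` with color classes of sizes `m u`: the possible
edges are present independently, each `u_i v_j` with probability `n ^ (-β(uv))`. -/
def law {V : Type} [Fintype V] {G : SimpleGraph V} (Δ : ThresholdWeighting G) (n : ℕ)
    (m : V → ℕ) : Measure (Sample G m) :=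
  Measure.pi fun e => bernoulliMeasure true false (edgeProb Δ n (e : Sym2 (Vtx m)))

/-- For each `n` and `u`, `size n u` is `n ^ α(u)` rounded up or down to an integer. -/
def IsRounding {V : Type} [Fintype V] {G : SimpleGraph V} (Δ : ThresholdWeighting G)
    (size : ℕ → V → ℕ) : Prop :=
  ∀ n u, size n u = ⌊(n : ℝ) ^ Δ.α u⌋₊ ∨ size n u = ⌈(n : ℝ) ^ Δ.α u⌉₊

/-! ### Inputs of the machine

A colored graph is written as a word: first the sizes of the color classes, in binary, then a
separator, then the list of the edges of the graph, where a vertex `u_i` is written as the symbol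
`u` followed by the binary digits of `i`. The color classes and the edges may come in any order. -/

/-- The input alphabet: the colors `some (inl u)`, the bits `some (inr b)`, and a separator
`none`. -/
abbrev Symbol (V : Type) : Type := Option (V ⊕ Bool)

/-- The color `u` followed by the binary digits of `i`. -/
def token {V : Type} (u : V) (i : ℕ) : List (Symbol V) :=
  some (Sum.inl u) :: (Nat.bits i).map fun b => some (Sum.inr b)

/-- The two endpoints of an edge. -/
def edgeToken {V : Type} {m : V → ℕ} (p : Vtx m × Vtx m) : List (Symbol V) :=
  token p.1.1 (p.1.2 : ℕ) ++ token p.2.1 (p.2.2 : ℕ)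

/-- The word `w` is an encoding of the colored graph `X`: `cs` lists all colors and `es` lists all
edges of `X`, without repetition. -/
def Encodes {V : Type} {m : V → ℕ} (w : List (Symbol V)) (X : SimpleGraph (Vtx m)) : Prop :=
  ∃ (cs : List V) (es : List (Vtx m × Vtx m)),
    cs.Nodup ∧ (∀ u, u ∈ cs) ∧
    (es.map fun p => s(p.1, p.2)).Nodup ∧
    (∀ e : Sym2 (Vtx m), e ∈ (es.map fun p => s(p.1, p.2)) ↔ e ∈ X.edgeSet) ∧
    w = cs.flatMap (fun u => token u (m u)) ++ none :: es.flatMap edgeToken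

/-! ### Turing machines

The machines are Mathlib's multitape machines `Turing.FinTM2` (each tape is a stack; the number
of stacks, the states and the program are finite), with their step count. -/

open Classical in
/-- On input `w`, the machine `M` halts after at most `t` steps, with the correct answer (a single
bit) to the question whether `SubCol` holds for `X`. -/
def AnswersWithin {V : Type} (G : SimpleGraph V) (M : Turing.TM2ComputableAux (Symbol V) Bool)
    {m : V → ℕ} (X : SimpleGraph (Vtx m)) (w : List (Symbol V)) (t : ℕ) : Prop :=
  Nonempty (Turing.TM2OutputsInTime M.tm (w.map M.inputAlphabet.symm)
    (some ([decide (SubCol G X Sigma.fst)].map M.outputAlphabet.symm)) t)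

/-- The machine answers correctly on every encoding of every graph colored by `V(G)`. -/
def Decides {V : Type} (G : SimpleGraph V) (M : Turing.TM2ComputableAux (Symbol V) Bool) : Prop :=
  ∀ (m : V → ℕ) (X : SimpleGraph (Vtx m)) (w : List (Symbol V)), Encodes w X →
    ∃ t : ℕ, AnswersWithin G M X w t

/-- Asymptotically almost surely, `M` answers correctly on every encoding of the threshold random
graph `X_{Δ,n}` after at most `T n` steps. -/
def AnswersAASWithin {V : Type} [Fintype V] {G : SimpleGraph V} (Δ : ThresholdWeighting G)
    (size : ℕ → V → ℕ) (M : Turing.TM2ComputableAux (Symbol V) Bool) (T : ℕ → ℝ) : Prop :=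
  Tendsto (fun n : ℕ => law Δ n (size n)
      {ω | ∀ w : List (Symbol V), Encodes w (sampleGraph G (size n) ω) →
        ∃ t : ℕ, (t : ℝ) ≤ T n ∧ AnswersWithin G M (sampleGraph G (size n) ω) w t})
    atTop (𝓝 1)

end ColoredSubgraph

end

/-! Fix $\Delta$ and a union sequence $S$ whose largest weight $\Delta(H)$ is $\kappa_\Delta(G)$;
one exists because only finitely many values compete (`exists_isUnionSequence_weight_le`). The
algorithm goes through $S$ and lists, for each term $H$, all colored copies of $H$ in $X$. For an
edge the list is read off from the input. For $H=H_1\cup H_2$, a copy of $H$ is the same thing as a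
pair of copies of $H_1$ and $H_2$ that agree on the common vertices (`perm_join`), so the new list
is a join of two earlier ones. The list of $G$ is nonempty exactly if the answer is yes, on every
input (`decider_decides`).

A join with result $L$ takes time $|L_1|+|L_2|+|L|+1$ up to a polylogarithmic factor (`join_runs`):
a radix sort gathers into groups the records that have equal numbers at the common vertices, then
each group outputs its pairs. Hence the time is governed by the number of edges of $X$ and the
length of the longest list.

On $\mathbf X_{\Delta,n}$ the expected number of copies of $H$ is a product of class sizes and edge
probabilities, at most $2^{|V|}n^{\Delta(H)}$ (`lintegral_card_copies_le`). Markov's inequality with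
slack $\log n$ and a union bound over $S$ show that with probability tending to $1$ no term has more
than $n^{\kappa_\Delta(G)}\log n$ copies (`tendsto_law_card_copies_le`). Every edge of $G$ is itself
a term of $S$ (`IsUnionSequence.exists_adj`), so the same event bounds the number of edges of $X$
(`ncard_edgeSet_le`). The terms of $S$ are distinct, which makes all constants depend on $G$ only
(`deciderConst_le`).

The machine is written in a small structured language, whose compilation to stack machines preserves
the number of steps (`Exec.steps`). On the tapes, `field` ends a field of a record, `mark` ends a
record and tells from which of the two lists of a join it comes, and `group` ends a group of
records. -/

noncomputable section

open Function (update)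
/-! ### A structured language for stack machines -/

namespace StackProg

/-- Structured programs over tapes indexed by `K` with symbols in `Γ`. -/
inductive Prog (K Γ : Type) : Type
  | skip : Prog K Γ
  | push (k : K) (a : Γ) : Prog K Γ
  | pop (k : K) : Prog K Γ
  | seq (p q : Prog K Γ) : Prog K Γ
  | case (k : K) (f : Option Γ → Prog K Γ) : Prog K Γ
  | loop (k : K) (P : Option Γ → Bool) (p : Prog K Γ) : Prog K Γ

variable {K Γ : Type} [DecidableEq K]

/-- Big-step semantics, with the number of machine steps. -/
inductive Exec : Prog K Γ → (K → List Γ) → (K → List Γ) → ℕ → Prop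
  | skip (s) : Exec .skip s s 1
  | push (k a s) : Exec (.push k a) s (update s k (a :: s k)) 1
  | pop (k s) : Exec (.pop k) s (update s k (s k).tail) 1
  | seq {p q s s₁ s₂ t₁ t₂} : Exec p s s₁ t₁ → Exec q s₁ s₂ t₂ → Exec (.seq p q) s s₂ (t₁ + t₂)
  | case {k f s s' t} : Exec (f (s k).head?) s s' t → Exec (.case k f) s s' (t + 1)
  | loop_done {k P p s} : P (s k).head? = false → Exec (.loop k P p) s s 1
  | loop_step {k P p s s₁ s₂ t₁ t₂} : P (s k).head? = true → Exec p s s₁ t₁ →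
      Exec (.loop k P p) s₁ s₂ t₂ → Exec (.loop k P p) s s₂ (t₁ + t₂ + 1)

/-- The program labels. -/
def Lab : Prog K Γ → Type
  | .skip => Unit
  | .push _ _ => Unit
  | .pop _ => Unit
  | .seq p q => Lab p ⊕ Lab q
  | .case _ f => Option (Σ a, Lab (f a))
  | .loop _ _ p => Option (Lab p)

instance Lab.finite [Finite Γ] : (p : Prog K Γ) → Finite (Lab p)
  | .skip => inferInstanceAs (Finite Unit)
  | .push _ _ => inferInstanceAs (Finite Unit)
  | .pop _ => inferInstanceAs (Finite Unit)
  | .seq p q => by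
      have := Lab.finite p
      have := Lab.finite q
      exact inferInstanceAs (Finite (Lab p ⊕ Lab q))
  | .case _ f => by
      have := fun a => Lab.finite (f a)
      exact inferInstanceAs (Finite (Option (Σ a, Lab (f a))))
  | .loop _ _ p => by
      have := Lab.finite p
      exact inferInstanceAs (Finite (Option (Lab p)))

/-- The first label of a program. -/
def entry : (p : Prog K Γ) → Lab p
  | .skip => ()
  | .push _ _ => ()
  | .pop _ => ()
  | .seq p _ => .inl (entry p)
  | .case _ _ => none
  | .loop _ _ _ => none

/-- The alphabets of the tapes of the compiled machine: the stack `inr false` holds the input and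
`inr true` the output. -/
abbrev Alph (K Γ I O : Type) : K ⊕ Bool → Type
  | .inl _ => Γ
  | .inr false => I
  | .inr true => O

variable {I O : Type}

open Turing

/-- The code of a program, for an embedding of its labels into those of a machine and a label `ret`
at which to continue. -/
def code {Λ : Type} : (p : Prog K Γ) → (Lab p → Λ) → Λ → Lab p →
    TM2.Stmt (Alph K Γ I O) Λ (Option Γ)
  | .skip, _, ret, _ => .goto fun _ => ret
  | .push k a, _, ret, _ => .push (.inl k) (fun _ => a) (.goto fun _ => ret)
  | .pop k, _, ret, _ => .pop (.inl k) (fun v _ => v) (.goto fun _ => ret)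
  | .seq p q, emb, _, .inl l => code p (fun l => emb (.inl l)) (emb (.inr (entry q))) l
  | .seq _ q, emb, ret, .inr l => code q (fun l => emb (.inr l)) ret l
  | .case k f, emb, _, none =>
      .peek (.inl k) (fun _ x => x) (.goto fun x => emb (some ⟨x, entry (f x)⟩))
  | .case _ f, emb, ret, some ⟨a, l⟩ => code (f a) (fun l => emb (some ⟨a, l⟩)) ret l
  | .loop k P p, emb, ret, none =>
      .peek (.inl k) (fun _ x => x) (.goto fun x => bif P x then emb (some (entry p)) else ret)
  | .loop _ _ p, emb, _, some l => code p (fun l => emb (some l)) (emb none) l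

/-- The tapes of the compiled machine. -/
def tapes (s : K → List Γ) (i : List I) (o : List O) : ∀ k, List (Alph K Γ I O k)
  | .inl k => s k
  | .inr false => i
  | .inr true => o

theorem update_tapes (s : K → List Γ) (i : List I) (o : List O) (k : K) (l : List Γ) :
    update (tapes s i o) (.inl k) l = tapes (update s k l) i o := by
  funext k'
  rcases k' with k' | _ | _
  · by_cases h : k' = k
    · subst h; simp [tapes]
    · rw [Function.update_of_ne (by simpa using h)]
      simp [tapes, h]
  · rw [Function.update_of_ne (by simp)]; rfl
  · rw [Function.update_of_ne (by simp)]; rfl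

theorem update_tapes_in (s : K → List Γ) (i : List I) (o : List O) (l : List I) :
    update (tapes s i o) (.inr false) l = tapes s l o := by
  funext k'
  rcases k' with k' | _ | _
  · rw [Function.update_of_ne (by simp)]; rfl
  · simp [tapes]
  · rw [Function.update_of_ne (by simp)]; rfl

theorem update_tapes_out (s : K → List Γ) (i : List I) (o : List O) (l : List O) :
    update (tapes s i o) (.inr true) l = tapes s i l := by
  funext k'
  rcases k' with k' | _ | _
  · rw [Function.update_of_ne (by simp)]; rfl
  · rw [Function.update_of_ne (by simp)]; rfl
  · simp [tapes]

/-- Running `t` steps of a machine. -/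
abbrev Steps {Λ σ : Type} (m : Λ → TM2.Stmt (Alph K Γ I O) Λ σ) (t : ℕ)
    (c c' : TM2.Cfg (Alph K Γ I O) Λ σ) : Prop :=
  (flip Bind.bind (TM2.step m))^[t] (some c) = some c'

theorem Steps.trans {Λ σ : Type} {m : Λ → TM2.Stmt (Alph K Γ I O) Λ σ} {t₁ t₂ : ℕ}
    {c₁ c₂ c₃ : TM2.Cfg (Alph K Γ I O) Λ σ} (h₁ : Steps m t₁ c₁ c₂) (h₂ : Steps m t₂ c₂ c₃) :
    Steps m (t₁ + t₂) c₁ c₃ := by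
  unfold Steps at *
  rw [add_comm, Function.iterate_add_apply, h₁, h₂]

theorem Steps.one {Λ σ : Type} {m : Λ → TM2.Stmt (Alph K Γ I O) Λ σ} {l : Λ} {v : σ}
    {S : ∀ k, List (Alph K Γ I O k)} : Steps m 1 ⟨some l, v, S⟩ (TM2.stepAux (m l) v S) := rfl

/-- Induction on the execution. The embedding of the labels and the return label are arbitrary, so
that the hypothesis applies to subprograms: the first half of a sequence returns to the entry of the
second, the body of a loop to the test of the loop. -/
theorem Exec.steps {Λ : Type} {m : Λ → TM2.Stmt (Alph K Γ I O) Λ (Option Γ)} {p : Prog K Γ}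
    {s s' : K → List Γ} {t : ℕ} (h : Exec p s s' t) :
    ∀ (emb : Lab p → Λ) (ret : Λ), (∀ l, m (emb l) = code p emb ret l) →
    ∀ (v : Option Γ) (i : List I) (o : List O), ∃ v',
      Steps m t ⟨some (emb (entry p)), v, tapes s i o⟩ ⟨some ret, v', tapes s' i o⟩ := by
  induction h with
  | skip s =>
    intro emb ret hm v i o
    exact ⟨v, by
      have := Steps.one (m := m) (l := emb (entry .skip)) (v := v) (S := tapes s i o)
      rwa [hm] at this⟩
  | push k a s =>
    intro emb ret hm v i o
    refine ⟨v, ?_⟩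
    have := Steps.one (m := m) (l := emb (entry (.push k a))) (v := v) (S := tapes s i o)
    rw [hm] at this
    simp only [code, TM2.stepAux] at this
    rw [update_tapes] at this
    exact this
  | pop k s =>
    intro emb ret hm v i o
    refine ⟨v, ?_⟩
    have := Steps.one (m := m) (l := emb (entry (.pop k))) (v := v) (S := tapes s i o)
    rw [hm] at this
    simp only [code, TM2.stepAux] at this
    rw [update_tapes] at this
    exact this
  | seq _ _ ih₁ ih₂ =>
    intro emb ret hm v i o
    obtain ⟨v₁, h₁⟩ := ih₁ (fun l => emb (.inl l)) (emb (.inr (entry _)))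
      (fun l => hm (.inl l)) v i o
    obtain ⟨v₂, h₂⟩ := ih₂ (fun l => emb (.inr l)) ret (fun l => hm (.inr l)) v₁ i o
    exact ⟨v₂, h₁.trans h₂⟩
  | @case k f s s' t _ ih =>
    intro emb ret hm v i o
    obtain ⟨v₁, h₁⟩ := ih (fun l => emb (some ⟨_, l⟩)) ret (fun l => hm (some ⟨_, l⟩))
      (s k).head? i o
    refine ⟨v₁, ?_⟩
    rw [add_comm]
    refine Steps.trans ?_ h₁
    have := Steps.one (m := m) (l := emb (entry (.case k f))) (v := v) (S := tapes s i o)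
    rw [hm] at this
    exact this
  | @loop_done k P p s hP =>
    intro emb ret hm v i o
    refine ⟨(s k).head?, ?_⟩
    have := Steps.one (m := m) (l := emb (entry (.loop k P p))) (v := v) (S := tapes s i o)
    rw [hm] at this
    simp only [code, entry, TM2.stepAux] at this
    change Steps m 1 _ ⟨some (bif P (s k).head? then _ else _), _, _⟩ at this
    rw [hP] at this
    exact this
  | @loop_step k P p s s₁ s₂ t₁ t₂ hP _ _ ih₁ ih₂ =>
    intro emb ret hm v i o
    obtain ⟨v₁, h₁⟩ := ih₁ (fun l => emb (some l)) (emb none) (fun l => hm (some l))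
      (s k).head? i o
    obtain ⟨v₂, h₂⟩ := ih₂ emb ret hm v₁ i o
    refine ⟨v₂, ?_⟩
    rw [show t₁ + t₂ + 1 = 1 + (t₁ + t₂) by ring]
    refine Steps.trans ?_ (h₁.trans h₂)
    have := Steps.one (m := m) (l := emb (entry (.loop k P p))) (v := v) (S := tapes s i o)
    rw [hm] at this
    simp only [code, entry, TM2.stepAux] at this
    change Steps m 1 _ ⟨some (bif P (s k).head? then _ else _), _, _⟩ at this
    rw [hP] at this
    exact this

/-- The labels of a complete machine: reading the input, the program, and the output. -/
inductive MLab (p : Prog K Γ) : Type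
  | load : MLab p
  | body (l : Lab p) : MLab p
  | fin : MLab p

instance [Finite Γ] (p : Prog K Γ) : Finite (MLab p) :=
  Finite.of_injective (β := Option (Option (Lab p)))
    (fun | .load => none | .fin => some none | .body l => some (some l)) (by
      rintro (_ | _ | _) (_ | _ | _) h <;> simp_all)

/-- The program of a complete machine: move the input, translated by `emb`, to the stack `kin`, run
the program, and output whether the stack `kans` is nonempty. -/
def machineCode (p : Prog K Γ) (emb : I → Γ) (kin kans : K) (a₀ : Γ) :
    MLab p → TM2.Stmt (Alph K Γ I Bool) (MLab p) (Option Γ)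
  | .load => .pop (.inr false) (fun _ x => x.map emb) <| .branch Option.isSome
      (.push (.inl kin) (fun v => v.getD a₀) <| .load (fun _ => none) <| .goto fun _ => .load)
      (.goto fun _ => .body (entry p))
  | .body l => code p .body .fin l
  -- The expected final configuration has its internal state reset and all stacks but the output
  -- empty, so the answer is popped and the state is set back to `none`.
  | .fin => .pop (.inl kans) (fun _ x => x) <| .branch Option.isSome
      (.push (.inr true) (fun _ => true) <| .load (fun _ => none) .halt)
      (.push (.inr true) (fun _ => false) <| .load (fun _ => none) .halt)

/-- The Turing machine that runs a program. -/
def machine [Fintype K] [Fintype Γ] [Fintype I] (p : Prog K Γ) (emb : I → Γ) (kin kans : K)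
    (a₀ : Γ) : Turing.TM2ComputableAux I Bool where
  tm :=
    { K := K ⊕ Bool
      k₀ := .inr false
      k₁ := .inr true
      Γ := Alph K Γ I Bool
      Λ := MLab p
      main := .load
      ΛFin := Fintype.ofFinite _
      σ := Option Γ
      initialState := none
      Γk₀Fin := inferInstanceAs (Fintype I)
      m := machineCode p emb kin kans a₀ }
  inputAlphabet := Equiv.refl I
  outputAlphabet := Equiv.refl Bool

/-- Moving the input from one stack to another reverses it. The additional step is the one that
finds the input stack empty. -/
theorem load_steps (p : Prog K Γ) (emb : I → Γ) (kin kans : K) (a₀ : Γ) (w : List I)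
    (s : K → List Γ) :
    Steps (machineCode p emb kin kans a₀) (w.length + 1) ⟨some .load, none, tapes s w []⟩
      ⟨some (.body (entry p)), none,
        tapes (update s kin ((w.map emb).reverse ++ s kin)) [] []⟩ := by
  induction w generalizing s with
  | nil =>
    have := Steps.one (m := machineCode p emb kin kans a₀) (l := .load) (v := none)
      (S := tapes s [] [])
    simp only [machineCode, TM2.stepAux] at this
    rw [update_tapes_in] at this
    simpa [tapes] using this
  | cons x w ih =>
    have := Steps.one (m := machineCode p emb kin kans a₀) (l := .load) (v := none)
      (S := tapes s (x :: w) [])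
    simp only [machineCode, TM2.stepAux] at this
    rw [update_tapes_in] at this
    simp only [tapes, List.head?_cons, Option.map_some, Option.isSome_some, cond_true,
      List.tail_cons, Option.getD_some] at this
    rw [update_tapes] at this
    have h := this.trans (ih _)
    rw [List.length_cons, add_comm]
    convert h using 3
    simp

/-- A program that computes a truth value gives a machine that outputs it. -/
theorem machine_outputs [Fintype K] [Fintype Γ] [Fintype I] (p : Prog K Γ) (emb : I → Γ)
    (kin kans : K) (a₀ : Γ) (w : List I) (s' : K → List Γ) (t T : ℕ) (b : Bool)
    (h : Exec p (update (fun _ => []) kin (w.map emb).reverse) s' t)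
    (hs' : s' = update (fun _ => []) kans (bif b then [a₀] else []))
    (hT : w.length + t + 2 ≤ T) :
    Nonempty (Turing.TM2OutputsInTime (machine p emb kin kans a₀).tm
      (w.map (machine p emb kin kans a₀).inputAlphabet.symm)
      (some ([b].map (machine p emb kin kans a₀).outputAlphabet.symm)) T) := by
  have h₁ := load_steps p emb kin kans a₀ w (fun _ => [])
  rw [List.append_nil] at h₁
  obtain ⟨v, h₂⟩ := h.steps (m := machineCode p emb kin kans a₀) (I := I) (O := Bool) .body .fin
    (fun l => rfl) none [] []
  have h₃ := Steps.one (m := machineCode p emb kin kans a₀) (l := .fin) (v := v)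
    (S := tapes s' [] [])
  have h₄ : TM2.stepAux (machineCode p emb kin kans a₀ .fin) v (tapes s' [] []) =
      ⟨none, none, tapes (fun _ => []) [] [b]⟩ := by
    simp only [machineCode, TM2.stepAux]
    rw [update_tapes]
    subst hs'
    cases b <;> simp [tapes, update_tapes_out]
  rw [h₄] at h₃
  have h₅ := (h₁.trans h₂).trans h₃
  refine ⟨⟨⟨_, ?_⟩, (?_ : w.length + 1 + t + 1 ≤ T)⟩⟩
  · refine Eq.trans (congrArg _ (congrArg some ?_)) (Eq.trans h₅ (congrArg some ?_))
    · rw [Turing.initList]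
      congr 1
      funext k
      rcases k with k | _ | _
      · rfl
      · exact (List.map_id w)
      · rfl
    · rw [Turing.haltList]
      congr 1
      funext k
      rcases k with k | _ | _ <;> rfl
  · omega

end StackProg

end

/-! ### Time bounds for programs, and basic programs that move, copy and delete -/

noncomputable section

open Function (update)
open scoped Classical

namespace StackProg

variable {K Γ : Type} [DecidableEq K]

/-- `p` leads from `s` to `s'` in at most `t` steps. -/
def Runs (p : Prog K Γ) (s s' : K → List Γ) (t : ℕ) : Prop := ∃ t' ≤ t, Exec p s s' t'

theorem Runs.congr {p : Prog K Γ} {s s₁ s₂ : K → List Γ} {t₁ t₂ : ℕ} (h : Runs p s s₁ t₁)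
    (hs : s₁ = s₂) (ht : t₁ ≤ t₂) : Runs p s s₂ t₂ := by
  obtain ⟨t', h', h⟩ := h
  exact ⟨t', h'.trans ht, hs ▸ h⟩

theorem Runs.skip (s : K → List Γ) : Runs .skip s s 1 := ⟨1, le_rfl, .skip s⟩

theorem Runs.push (k : K) (a : Γ) (s : K → List Γ) :
    Runs (.push k a) s (update s k (a :: s k)) 1 := ⟨1, le_rfl, .push k a s⟩

theorem Runs.pop (k : K) (s : K → List Γ) :
    Runs (.pop k) s (update s k (s k).tail) 1 := ⟨1, le_rfl, .pop k s⟩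

theorem Runs.seq {p q : Prog K Γ} {s s₁ s₂ : K → List Γ} {t₁ t₂ : ℕ} (h₁ : Runs p s s₁ t₁)
    (h₂ : Runs q s₁ s₂ t₂) : Runs (.seq p q) s s₂ (t₁ + t₂) := by
  obtain ⟨u₁, l₁, h₁⟩ := h₁
  obtain ⟨u₂, l₂, h₂⟩ := h₂
  exact ⟨u₁ + u₂, by omega, h₁.seq h₂⟩

theorem Runs.case {k : K} {f : Option Γ → Prog K Γ} {s s' : K → List Γ} {t : ℕ} {x : Option Γ}
    (hx : (s k).head? = x) (h : Runs (f x) s s' t) : Runs (.case k f) s s' (t + 1) := by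
  subst hx
  obtain ⟨u, l, h⟩ := h
  exact ⟨u + 1, by omega, h.case⟩

theorem Runs.loop_done {k : K} {P : Option Γ → Bool} {p : Prog K Γ} {s : K → List Γ}
    (h : P (s k).head? = false) : Runs (.loop k P p) s s 1 := ⟨1, le_rfl, .loop_done h⟩

theorem Runs.loop_step {k : K} {P : Option Γ → Bool} {p : Prog K Γ} {s s₁ s₂ : K → List Γ}
    {t₁ t₂ : ℕ} (h : P (s k).head? = true) (h₁ : Runs p s s₁ t₁)
    (h₂ : Runs (.loop k P p) s₁ s₂ t₂) : Runs (.loop k P p) s s₂ (t₁ + t₂ + 1) := by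
  obtain ⟨u₁, l₁, h₁⟩ := h₁
  obtain ⟨u₂, l₂, h₂⟩ := h₂
  exact ⟨u₁ + u₂ + 1, by omega, .loop_step h h₁ h₂⟩

/-- Move the top symbol of `k` to `k'`. -/
def moveOne (k k' : K) : Prog K Γ :=
  .case k fun x => match x with
    | none => .skip
    | some a => .seq (.pop k) (.push k' a)

theorem moveOne_runs {k k' : K} (hk : k ≠ k') {s : K → List Γ} {a : Γ} {r : List Γ}
    (h : s k = a :: r) :
    Runs (moveOne k k') s (update (update s k r) k' (a :: s k')) 3 := by
  refine (Runs.case (x := some a) (by simp [h]) ((Runs.pop k s).seq (Runs.push k' a _))).congr ?_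
    le_rfl
  rw [Function.update_of_ne hk.symm, h, List.tail_cons]

/-- Move symbols from `k` to `k'` as long as they satisfy `P`. -/
def moveWhile (P : Γ → Bool) (k k' : K) : Prog K Γ := .loop k (fun x => x.any P) (moveOne k k')

/-- The condition on `r` makes the loop stop right behind `l`. Each symbol costs three steps for the
move and one for the test. -/
theorem moveWhile_runs {P : Γ → Bool} {k k' : K} (hk : k ≠ k') {l r : List Γ}
    {s : K → List Γ} (h : s k = l ++ r) (hl : ∀ a ∈ l, P a = true) (hr : r.head?.any P = false) :
    Runs (moveWhile P k k') s (update (update s k r) k' (l.reverse ++ s k'))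
      (4 * l.length + 1) := by
  induction l generalizing s with
  | nil =>
    refine (Runs.loop_done ?_).congr ?_ (by simp)
    · simpa [h] using hr
    · rw [List.reverse_nil, List.nil_append, ← Function.update_of_ne hk.symm r s,
        Function.update_eq_self, ← List.nil_append r, ← h, Function.update_eq_self]
  | cons a l ih =>
    refine (Runs.loop_step (by simp [h, hl a]) (moveOne_runs hk h)
      (ih (s := update (update s k (l ++ r)) k' (a :: s k')) ?_ ?_)).congr ?_ ?_
    · simp [hk]
    · exact fun b hb => hl b (by simp [hb])
    · funext j
      by_cases h₁ : j = k' <;> by_cases h₂ : j = k <;> simp [h₁, h₂, hk]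
    · simp only [List.length_cons]; omega

/-- Move all symbols from `k` to `k'`. -/
abbrev moveAll (k k' : K) : Prog K Γ := moveWhile (fun _ => true) k k'

theorem moveAll_runs {k k' : K} (hk : k ≠ k') (s : K → List Γ) :
    Runs (moveAll k k') s (update (update s k []) k' ((s k).reverse ++ s k'))
      (4 * (s k).length + 1) :=
  moveWhile_runs hk (by simp) (by simp) (by simp)

/-- Move symbols from `k` to `k₁` and to `k₂`, where they are translated by `f`, as long as they
satisfy `P`. -/
def copyWhile (P : Γ → Bool) (f : Γ → Γ) (k k₁ k₂ : K) : Prog K Γ :=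
  .loop k (fun x => x.any P) <| .case k fun x => match x with
    | none => .skip
    | some a => .seq (.pop k) (.seq (.push k₁ a) (.push k₂ (f a)))

theorem copyWhile_runs {P : Γ → Bool} {f : Γ → Γ} {k k₁ k₂ : K} (h₁ : k ≠ k₁) (h₂ : k ≠ k₂)
    (h₁₂ : k₁ ≠ k₂) {l r : List Γ} {s : K → List Γ} (h : s k = l ++ r)
    (hl : ∀ a ∈ l, P a = true) (hr : r.head?.any P = false) :
    Runs (copyWhile P f k k₁ k₂) s
      (update (update (update s k r) k₁ (l.reverse ++ s k₁)) k₂ ((l.map f).reverse ++ s k₂))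
      (5 * l.length + 1) := by
  induction l generalizing s with
  | nil =>
    refine (Runs.loop_done ?_).congr ?_ (by simp)
    · simpa [h] using hr
    · funext j
      rw [List.nil_append] at h
      by_cases e : j = k <;> by_cases e₁ : j = k₁ <;> by_cases e₂ : j = k₂ <;>
        simp [e, e₁, e₂, Function.update_apply, h]
      all_goals simp_all
  | cons a l ih =>
    refine (Runs.loop_step (by simp [h, hl a])
      (Runs.case (x := some a) (by simp [h]) ((Runs.pop k s).seq ((Runs.push k₁ a _).seq
        (Runs.push k₂ (f a) _)))) (ih ?_ ?_)).congr ?_ ?_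
    · simp [h₁, h₂, h]
    · exact fun b hb => hl b (by simp [hb])
    · funext j
      by_cases e : j = k <;> by_cases e₁ : j = k₁ <;> by_cases e₂ : j = k₂ <;>
        simp [e, e₁, e₂, h₁, h₂, h₁₂, h₁.symm, h₂.symm, h₁₂.symm, h]
    · simp only [List.length_cons]; omega

/-- Empty the stack `k`. -/
def dropAll (k : K) : Prog K Γ := .loop k Option.isSome (.pop k)

theorem dropAll_runs (k : K) (s : K → List Γ) :
    Runs (dropAll k) s (update s k []) (2 * (s k).length + 1) := by
  generalize h : s k = l
  induction l generalizing s with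
  | nil =>
    refine (Runs.loop_done (by simp [h])).congr ?_ (by simp)
    rw [← h, Function.update_eq_self]
  | cons a l ih =>
    refine (Runs.loop_step (by simp [h]) (Runs.pop k s) (ih _ (by simp [h]))).congr (by simp) ?_
    simp only [List.length_cons]; omega

/-- Run the programs of a list one after the other. -/
def seqList : List (Prog K Γ) → Prog K Γ
  | [] => .skip
  | p :: ps => .seq p (seqList ps)

end StackProg

end

noncomputable section

open Function (update)
open scoped Classical

namespace ColoredSubgraph

open StackProg

/-- The symbols on the work tapes. -/
inductive Sym (V : Type) : Type
  | inp (x : Symbol V)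
  | field
  | mark (b : Bool)
  | group

instance {V : Type} [Finite V] : Finite (Sym V) :=
  Finite.of_injective (β := Symbol V ⊕ Option (Option Bool))
    (fun | .inp x => .inl x | .field => .inr none | .group => .inr (some none)
         | .mark b => .inr (some (some b))) (by
      rintro (_ | _ | _ | _) (_ | _ | _ | _) h <;> simp_all)

instance {V : Type} [Fintype V] : Fintype (Sym V) := Fintype.ofFinite _

/-- The work tapes. The tape `lst i` stores the list number `i`. -/
inductive Reg (V ι : Type) : Type
  | inp | trail | wid | wid' | src | dst | tmp | ga | gb | gb' | ca | ca' | out | f1 | f2 | ans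
  | bk (a : Sym V)
  | lst (i : ι)
  deriving Fintype

variable {V ι : Type}

/-- The symbols of which words consist. -/
def Sym.isBody : Sym V → Bool
  | .mark _ => false
  | .group => false
  | _ => true

def Sym.isGroup : Sym V → Bool
  | .group => true
  | _ => false

/-- The state of the work tapes. -/
abbrev St (V ι : Type) := Reg V ι → List (Sym V)

/-! ### Groups of items -/

section Groups

variable {I : Type} (tag : I → Bool) (e : I → List (Sym V))

/-- The code of a list of items, where `e` is the word of an item. -/
def encW (g : List I) : List (Sym V) := g.flatMap fun x => e x ++ [.mark (tag x)]

/-- The code of a list of groups. -/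
def encGs (gs : List (List I)) : List (Sym V) := gs.flatMap fun g => encW tag e g ++ [.group]

@[simp] theorem encW_nil : encW tag e [] = [] := rfl
@[simp] theorem encW_cons (x : I) (g : List I) :
    encW tag e (x :: g) = e x ++ .mark (tag x) :: encW tag e g := by simp [encW]
@[simp] theorem encW_append (g g' : List I) :
    encW tag e (g ++ g') = encW tag e g ++ encW tag e g' := by simp [encW]
@[simp] theorem encGs_nil : encGs tag e [] = [] := rfl
@[simp] theorem encGs_cons (g : List I) (gs : List (List I)) :
    encGs tag e (g :: gs) = encW tag e g ++ .group :: encGs tag e gs := by simp [encGs]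
@[simp] theorem encGs_append (gs gs' : List (List I)) :
    encGs tag e (gs ++ gs') = encGs tag e gs ++ encGs tag e gs' := by simp [encGs]

theorem encW_eq_nil {g : List I} : encW tag e g = [] ↔ g = [] := by
  cases g <;> simp

/-- The groups with the keys `bs` of the items of `g`. -/
def splitGroup {B : Type} (bs : List B) (G : B → List I) : List (List I) :=
  bs.foldl (fun acc b => if G b = [] then acc else G b :: acc) []

/-- Split all groups according to a key. -/
def refine {B : Type} (bs : List B) (key : I → B) (gs : List (List I)) : List (List I) :=
  gs.foldl (fun acc g => splitGroup bs (fun b => g.filter fun x => key x = b) ++ acc) []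

/-- The left fold pushes groups onto a stack, as the machine does, so the group of the first key
ends up last. This recursion is the form used in inductions. -/
theorem splitGroup_cons {B : Type} (b : B) (bs : List B) (G : B → List I) :
    splitGroup (b :: bs) G = splitGroup bs G ++ if G b = [] then [] else [G b] := by
  have key : ∀ (bs : List B) (acc : List (List I)),
      bs.foldl (fun acc b => if G b = [] then acc else G b :: acc) acc = splitGroup bs G ++ acc := by
    intro bs
    induction bs with
    | nil => intro acc; rfl
    | cons c bs ih =>
      intro acc
      unfold splitGroup
      rw [List.foldl_cons, ih, List.foldl_cons, ih]
      split <;> simp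
  conv_lhs => rw [splitGroup, List.foldl_cons, key]

theorem refine_cons {B : Type} (bs : List B) (key : I → B) (g : List I) (gs : List (List I)) :
    refine bs key (g :: gs) =
      refine bs key gs ++ splitGroup bs (fun b => g.filter fun x => key x = b) := by
  have aux : ∀ (gs acc : List (List I)),
      gs.foldl (fun acc g => splitGroup bs (fun b => g.filter fun x => key x = b) ++ acc) acc =
        refine bs key gs ++ acc := by
    intro gs
    induction gs with
    | nil => intro acc; rfl
    | cons g gs ih =>
      intro acc
      unfold refine
      rw [List.foldl_cons, ih, List.foldl_cons, ih]
      simp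
  conv_lhs => rw [refine, List.foldl_cons, aux]
  rw [List.append_nil]

end Groups

/-! ### Sorting words into buckets by their first symbol -/

/-- Rotate a word by one symbol, unless `rot` forbids it. -/
def rotWord (rot : Sym V → Bool) : List (Sym V) → List (Sym V)
  | [] => []
  | a :: l => bif rot a then l ++ [a] else a :: l

/-- The word reaches its bucket in reverse. A first symbol that is to be rotated is held back and
pushed after the rest of the word, just before the mark; the bucket `c a` depends on this symbol
only. -/
def passWord (rot : Sym V → Bool) (c : Sym V → Sym V) : Prog (Reg V ι) (Sym V) :=
  .case .src fun x => match x with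
    | none => .skip
    | some a => .seq (.pop .src) <| .seq (bif rot a then .skip else .push (.bk (c a)) a) <|
      .seq (moveWhile Sym.isBody .src (.bk (c a))) <|
      .seq (bif rot a then .push (.bk (c a)) a else .skip) (moveOne .src (.bk (c a)))

theorem passWord_runs (rot : Sym V → Bool) (c : Sym V → Sym V) {s : St V ι} {a : Sym V}
    {l r : List (Sym V)} {t : Bool} (h : s .src = (a :: l) ++ .mark t :: r)
    (hl : ∀ x ∈ a :: l, x.isBody = true) :
    Runs (passWord rot c) s (update (update s .src r) (.bk (c a))
      ((rotWord rot (a :: l) ++ [Sym.mark t]).reverse ++ s (.bk (c a)))) (4 * l.length + 8) := by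
  have hl' : ∀ x ∈ l, x.isBody = true := fun x hx => hl x (by simp [hx])
  cases hr : rot a with
  | true =>
    refine (Runs.case (x := some a) (by simp [h]) ((Runs.pop _ s).seq
      (.seq (t₁ := 1) (s₁ := update s .src (s .src).tail) (by rw [hr]; exact Runs.skip _)
      ((moveWhile_runs (l := l) (r := .mark t :: r) (by simp) (by simp [h]) hl' rfl).seq
      (.seq (t₁ := 1) (by rw [hr]; exact Runs.push _ _ _)
      (moveOne_runs (a := .mark t) (r := r) (by simp) (by simp))))))).congr ?_ (by omega)
    funext k
    cases k <;> simp [Function.update_apply, rotWord, hr]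
    split <;> simp
  | false =>
    refine (Runs.case (x := some a) (by simp [h]) ((Runs.pop _ s).seq
      (.seq (t₁ := 1) (by rw [hr]; exact Runs.push _ _ _)
      ((moveWhile_runs (l := l) (r := .mark t :: r) (by simp) (by simp [h]) hl' rfl).seq
      (.seq (t₁ := 1) (by rw [hr]; exact Runs.skip _)
      (moveOne_runs (a := .mark t) (r := r) (by simp) (by simp))))))).congr ?_ (by omega)
    funext k
    cases k <;> simp [Function.update_apply, rotWord, hr]
    split <;> simp

def passWords (rot : Sym V → Bool) (c : Sym V → Sym V) : Prog (Reg V ι) (Sym V) :=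
  .loop .src (fun x => x.any fun a => !a.isGroup) (passWord rot c)

variable {I : Type} {tag : I → Bool} {e : I → List (Sym V)}

/-- The bucket of an item. -/
def keyOf (c : Sym V → Sym V) (e : I → List (Sym V)) (x : I) : Sym V := c ((e x).headD .field)

theorem passWords_runs (rot : Sym V → Bool) (c : Sym V → Sym V) {g : List I}
    (he : ∀ x ∈ g, e x ≠ []) (hb : ∀ x ∈ g, ∀ a ∈ e x, a.isBody = true)
    {s : St V ι} {r : List (Sym V)} (h : s .src = encW tag e g ++ .group :: r) :
    Runs (passWords rot c) s
      (fun k => match k with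
        | .src => .group :: r
        | .bk b => (encW tag (fun x => rotWord rot (e x))
            (g.filter fun x => keyOf c e x = b)).reverse ++ s (.bk b)
        | k => s k) (9 * (encW tag e g).length + 1) := by
  induction g generalizing s with
  | nil =>
    refine (Runs.loop_done (by simp [h, Sym.isGroup])).congr ?_ (by simp)
    funext k
    cases k <;> simp [h]
  | cons x g ih =>
    obtain ⟨a, l, hx⟩ := List.exists_cons_of_ne_nil (he x (by simp))
    have hb' := hb x (by simp)
    rw [hx] at hb'
    refine (Runs.loop_step ?_ (passWord_runs rot c (a := a) (l := l) (t := tag x)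
      (r := encW tag e g ++ .group :: r) (by simp [h, hx]) hb') (ih ?_ ?_ ?_)).congr ?_ ?_
    · have := hb' a (by simp)
      cases a <;> simp_all [Sym.isGroup, Sym.isBody]
    · exact fun y hy => he y (by simp [hy])
    · exact fun y hy => hb y (by simp [hy])
    · simp
    · funext k
      cases k <;> simp [Function.update_apply, List.filter_cons]
      rename_i b
      have hk : keyOf c e x = c a := by simp [keyOf, hx]
      rw [hk]
      by_cases hc : b = c a
      · subst hc; simp [hx]
      · rw [if_neg hc, if_neg (Ne.symm hc)]
    · simp only [encW_cons, hx, List.length_append, List.length_cons]; omega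

/-- Move the contents of the buckets `bs` to `dst`. -/
def collect : List (Sym V) → Prog (Reg V ι) (Sym V)
  | [] => .skip
  | b :: bs => .seq (.case (.bk b) fun x => match x with
      | none => .skip
      -- The bottom of the stack is read last, so pushing `.group` first lets it close the group.
      -- Moving the bucket undoes the reversal of its words. Empty buckets produce no group.
      | some _ => .seq (.push .dst .group) (moveAll (.bk b) .dst)) (collect bs)

theorem collect_runs {bs : List (Sym V)} (hbs : bs.Nodup) (G : Sym V → List I) {s : St V ι}
    (h : ∀ b ∈ bs, s (.bk b) = (encW tag e (G b)).reverse) :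
    Runs (collect bs) s
      (fun k => match k with
        | .dst => encGs tag e (splitGroup bs G) ++ s .dst
        | .bk b => if b ∈ bs then [] else s (.bk b)
        | k => s k)
      (4 * bs.length + 4 * (bs.map fun b => (encW tag e (G b)).length).sum + 1) := by
  induction bs generalizing s with
  | nil =>
    refine (Runs.skip s).congr ?_ (by simp)
    funext k
    cases k <;> simp [splitGroup]
  | cons b bs ih =>
    rw [List.nodup_cons] at hbs
    by_cases hG : G b = []
    · have hb := h b (by simp)
      rw [hG, encW_nil, List.reverse_nil] at hb
      refine (Runs.seq (Runs.case (x := none) (by simp [hb]) (Runs.skip s))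
        (ih hbs.2 (s := s) fun c hc => h c (by simp [hc]))).congr ?_ ?_
      · funext k
        cases k <;> simp [splitGroup_cons, hG]
        rename_i c
        by_cases hc : c = b
        · subst hc; simp [hb]
        · simp [hc]
      · simp only [List.length_cons, List.map_cons, List.sum_cons]; omega
    · have hb := h b (by simp)
      obtain ⟨a, l, hal⟩ : ∃ a l, s (.bk b) = a :: l := by
        refine List.exists_cons_of_ne_nil ?_
        rw [hb, Ne, List.reverse_eq_nil_iff, encW_eq_nil]
        exact hG
      refine (Runs.seq (Runs.case (x := some a) (by simp [hal])
        ((Runs.push .dst .group s).seq (moveAll_runs (by simp) _)))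
        (ih hbs.2 fun c hc => ?_)).congr ?_ ?_
      · have : c ≠ b := fun hcb => hbs.1 (hcb ▸ hc)
        simp [this, h c (by simp [hc])]
      · funext k
        cases k <;> simp [splitGroup_cons, hG, hb]
        rename_i c
        by_cases hc : c = b
        · subst hc; simp
        · simp [hc]
      · simp [hb]; omega

/-- An item has one key, which occurs at most once in `bs`, so it is counted at most once. -/
theorem sum_length_filter_encW {B : Type} {bs : List B} (hbs : bs.Nodup) (key : I → B)
    (g : List I) :
    (bs.map fun b => (encW tag e (g.filter fun x => key x = b)).length).sum ≤
      (encW tag e g).length := by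
  induction g with
  | nil => simp
  | cons x g ih =>
    have : ∀ b, (encW tag e ((x :: g).filter fun x => key x = b)).length =
        (if key x = b then (e x).length + 1 else 0) +
          (encW tag e (g.filter fun x => key x = b)).length := by
      intro b
      by_cases hb : key x = b <;> simp [hb]; omega
    simp only [this, List.sum_map_add]
    have h2 : (bs.map fun b => if key x = b then (e x).length + 1 else 0).sum ≤
        (e x).length + 1 := by
      clear ih this
      induction bs with
      | nil => simp
      | cons b bs ih =>
        rw [List.nodup_cons] at hbs
        rw [List.map_cons, List.sum_cons]
        by_cases hb : key x = b
        · have : (bs.map fun b => if key x = b then (e x).length + 1 else 0).sum = 0 := by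
            rw [List.sum_eq_zero]
            intro n hn
            rw [List.mem_map] at hn
            obtain ⟨c, hc, rfl⟩ := hn
            rw [if_neg]
            rintro rfl
            exact hbs.1 (hb ▸ hc)
          rw [if_pos hb, this]
        · simpa [hb] using ih hbs.2
    simp only [encW_cons, List.length_append, List.length_cons]
    omega

theorem length_rotWord (rot : Sym V → Bool) (w : List (Sym V)) :
    (rotWord rot w).length = w.length := by
  cases w with
  | nil => rfl
  | cons a l => cases h : rot a <;> simp [rotWord, h]

theorem length_encW_congr {e' : I → List (Sym V)} (h : ∀ x, (e' x).length = (e x).length)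
    (g : List I) : (encW tag e' g).length = (encW tag e g).length := by
  induction g with
  | nil => rfl
  | cons x g ih => simp [h, ih]

theorem length_encGs_congr {e' : I → List (Sym V)} (h : ∀ x, (e' x).length = (e x).length)
    (gs : List (List I)) : (encGs tag e' gs).length = (encGs tag e gs).length := by
  induction gs with
  | nil => rfl
  | cons g gs ih => simp [length_encW_congr h, ih]

/-- Splitting adds one `.group` symbol per new group; as these groups are nonempty, this at most
doubles the length. -/
theorem length_splitGroup {B : Type} {bs : List B} (hbs : bs.Nodup) (key : I → B)
    (g : List I) :
    (encGs tag e (splitGroup bs fun b => g.filter fun x => key x = b)).length ≤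
      2 * (encW tag e g).length := by
  refine le_trans ?_ (Nat.mul_le_mul_left 2 (sum_length_filter_encW hbs key g))
  clear hbs
  induction bs with
  | nil => simp [splitGroup]
  | cons b bs ih =>
    rw [splitGroup_cons, List.map_cons, List.sum_cons, encGs_append, List.length_append]
    split
    · next h => simp [h]; exact ih
    · next h =>
      have : 1 ≤ (encW tag e (g.filter fun x => key x = b)).length := by
        rw [Nat.one_le_iff_ne_zero, Ne, List.length_eq_zero_iff, encW_eq_nil]
        exact h
      simp only [encGs_cons, encGs_nil, List.length_append, List.length_cons, List.length_nil]
      omega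

theorem length_refine {B : Type} {bs : List B} (hbs : bs.Nodup) (key : I → B)
    (gs : List (List I)) :
    (encGs tag e (refine bs key gs)).length ≤ 2 * (encGs tag e gs).length := by
  induction gs with
  | nil => simp [refine]
  | cons g gs ih =>
    have := length_splitGroup (tag := tag) (e := e) hbs key g
    simp only [refine_cons, encGs_cons, encGs_append, List.length_append, List.length_cons]
    omega

variable [Fintype V]

/-- All symbols. -/
def allSyms (V : Type) [Fintype V] : List (Sym V) := (Finset.univ : Finset (Sym V)).toList

theorem nodup_allSyms : (allSyms V).Nodup := Finset.nodup_toList _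

theorem mem_allSyms (a : Sym V) : a ∈ allSyms V := by simp [allSyms]

def passGroup (rot : Sym V → Bool) (c : Sym V → Sym V) : Prog (Reg V ι) (Sym V) :=
  .seq (passWords rot c) (.seq (.pop .src) (collect (allSyms V)))

theorem passGroup_runs (rot : Sym V → Bool) (c : Sym V → Sym V) {g : List I}
    (he : ∀ x ∈ g, e x ≠ []) (hb : ∀ x ∈ g, ∀ a ∈ e x, a.isBody = true)
    {s : St V ι} {r : List (Sym V)} (h : s .src = encW tag e g ++ .group :: r)
    (hbk : ∀ b, s (.bk b) = []) :
    Runs (passGroup rot c) s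
      (update (update s .src r) .dst (encGs tag (fun x => rotWord rot (e x))
        (splitGroup (allSyms V) fun b => g.filter fun x => keyOf c e x = b) ++ s .dst))
      (13 * (encW tag e g).length + 4 * (allSyms V).length + 3) := by
  refine ((passWords_runs rot c he hb h).seq ((Runs.pop _ _).seq
    (collect_runs (tag := tag) (e := fun x => rotWord rot (e x)) nodup_allSyms
      (fun b => g.filter fun x => keyOf c e x = b) ?_))).congr ?_ ?_
  · simp [hbk]
  · funext k
    cases k <;> simp [mem_allSyms, hbk]
  · have := sum_length_filter_encW (tag := tag) (e := e) (nodup_allSyms (V := V)) (keyOf c e) g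
    simp only [length_encW_congr (e := e) (fun x => length_rotWord rot (e x))]
    omega

/-- One round of a radix sort by the leading symbol. Groups are only split, never merged, and their
order is irrelevant. Two moves, via `tmp`, bring the words back to `src` in their right direction.
-/
def pass (rot : Sym V → Bool) (c : Sym V → Sym V) : Prog (Reg V ι) (Sym V) :=
  .seq (.loop .src Option.isSome (passGroup rot c)) (.seq (moveAll .dst .tmp) (moveAll .tmp .src))

theorem passGroups_runs (rot : Sym V → Bool) (c : Sym V → Sym V) {gs : List (List I)}
    (he : ∀ x, e x ≠ []) (hb : ∀ x, ∀ a ∈ e x, a.isBody = true)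
    {s : St V ι} (h : s .src = encGs tag e gs) (hbk : ∀ b, s (.bk b) = []) :
    Runs (.loop .src Option.isSome (passGroup rot c)) s
      (update (update s .src []) .dst (encGs tag (fun x => rotWord rot (e x))
        (refine (allSyms V) (keyOf c e) gs) ++ s .dst))
      ((13 + 4 * (allSyms V).length) * (encGs tag e gs).length + 1) := by
  induction gs generalizing s with
  | nil =>
    refine (Runs.loop_done (by simp [h])).congr ?_ (by simp)
    funext k
    cases k <;> simp [h, refine]
  | cons g gs ih =>
    refine (Runs.loop_step ?_ (passGroup_runs rot c (tag := tag) (g := g)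
      (r := encGs tag e gs) (fun x _ => he x) (fun x _ => hb x) (by simp [h]) hbk)
      (ih ?_ ?_)).congr ?_ ?_
    · rw [h, encGs_cons]
      cases encW tag e g <;> rfl
    · simp
    · simp [hbk]
    · funext k
      cases k <;> simp [refine_cons]
    · simp only [encGs_cons, List.length_append, List.length_cons]
      nlinarith [Nat.zero_le ((allSyms V).length * (encW tag e g).length)]

theorem pass_runs (rot : Sym V → Bool) (c : Sym V → Sym V) {gs : List (List I)}
    (he : ∀ x, e x ≠ []) (hb : ∀ x, ∀ a ∈ e x, a.isBody = true)
    {s : St V ι} (h : s .src = encGs tag e gs) (hbk : ∀ b, s (.bk b) = []) (hdst : s .dst = [])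
    (htmp : s .tmp = []) :
    Runs (pass rot c) s
      (update s .src (encGs tag (fun x => rotWord rot (e x)) (refine (allSyms V) (keyOf c e) gs)))
      ((29 + 4 * (allSyms V).length) * (encGs tag e gs).length + 3) := by
  refine ((passGroups_runs rot c he hb h hbk).seq ((moveAll_runs (by simp) _).seq
    (moveAll_runs (by simp) _))).congr ?_ ?_
  · funext k
    cases k <;> simp [hdst, htmp]
  · have h₁ := length_refine (tag := tag) (e := e) (nodup_allSyms (V := V)) (keyOf c e) gs
    have h₂ := length_encGs_congr (tag := tag) (e := e) (fun x => length_rotWord rot (e x))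
      (refine (allSyms V) (keyOf c e) gs)
    simp [hdst, htmp]
    rw [h₂]
    nlinarith

end ColoredSubgraph

end

noncomputable section

open Function (update)
open scoped Classical

namespace ColoredSubgraph

open StackProg

variable {V ι : Type}

/-! ### Pairs of items in the same group -/

section Pairs

variable {I : Type} (tag : I → Bool)

/-- The pairs of an item with tag `false` and an item with tag `true` of the same list. -/
def groupPairs (g : List I) : List (I × I) :=
  (g.filter fun x => tag x = false) ×ˢ (g.filter fun x => tag x = true)

/-- The pairs of an item with tag `false` and an item with tag `true` of the same group. -/
def pairs (gs : List (List I)) : List (I × I) := gs.flatMap (groupPairs tag)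

/-- The groups `gs'` arise by separating the items of `gs` that are not related by `R`. -/
structure Refined (R : I → I → Prop) (gs gs' : List (List I)) : Prop where
  flatten : gs'.flatten.Perm gs.flatten
  pairs : (pairs tag gs').Perm ((pairs tag gs).filter fun p => R p.1 p.2)
  -- Groups made by a split are nonempty, so the items bound their number; the maximum covers a list
  -- that was not split. This controls the number of `.group` symbols in the time bounds.
  length : gs'.length ≤ max gs.length gs.flatten.length

variable {tag}

theorem Refined.refl {R : I → I → Prop} (hR : ∀ x y, R x y) (gs : List (List I)) :
    Refined tag R gs gs where
  flatten := .rfl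
  pairs := by simp [hR]
  length := le_max_left _ _

theorem Refined.trans {R₁ R₂ R : I → I → Prop} {gs₁ gs₂ gs₃ : List (List I)}
    (h₁ : Refined tag R₁ gs₁ gs₂) (h₂ : Refined tag R₂ gs₂ gs₃)
    (hR : ∀ x y, R x y ↔ R₁ x y ∧ R₂ x y) : Refined tag R gs₁ gs₃ where
  flatten := h₂.flatten.trans h₁.flatten
  pairs := by
    refine h₂.pairs.trans ((h₁.pairs.filter _).trans ?_)
    rw [List.filter_filter]
    simp only [hR, Bool.decide_and]
    refine List.Perm.of_eq ?_
    congr 1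
    funext p
    rw [Bool.and_comm]
  length := by
    have := h₁.length
    have h₃ := h₂.length
    rw [h₁.flatten.length_eq] at h₃
    omega

/-- Pairs consist of items of `gs₁`, so only these matter. This is needed because comparing leading
symbols amounts to equality of fields only for fields not longer than the number of rounds. -/
theorem Refined.congr {R₁ R : I → I → Prop} {gs₁ gs₂ : List (List I)}
    (h : Refined tag R₁ gs₁ gs₂) (hR : ∀ x ∈ gs₁.flatten, ∀ y ∈ gs₁.flatten, R x y ↔ R₁ x y) :
    Refined tag R gs₁ gs₂ where
  flatten := h.flatten
  pairs := by
    refine h.pairs.trans (List.Perm.of_eq (List.filter_congr ?_))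
    rintro ⟨x, y⟩ hxy
    simp only [ColoredSubgraph.pairs, groupPairs, List.mem_flatMap, List.mem_product,
      List.mem_filter] at hxy
    obtain ⟨g, hg, ⟨hx, _⟩, hy, _⟩ := hxy
    simp [hR x (List.mem_flatten.2 ⟨g, hg, hx⟩) y (List.mem_flatten.2 ⟨g, hg, hy⟩)]
  length := h.length

/-- Multiplicities agree: an element is found only under its own key, and that key is listed once.
-/
theorem perm_flatMap_filter {B : Type} {bs : List B} (hbs : bs.Nodup) (hm : ∀ b, b ∈ bs)
    {J : Type} (key : J → B) (g : List J) :
    (bs.flatMap fun b => g.filter fun x => key x = b).Perm g := by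
  rw [List.perm_iff_count]
  intro a
  rw [List.count_flatMap]
  have : (List.count a ∘ fun b => g.filter fun x => key x = b) =
      fun b => if b = key a then g.count a else 0 := by
    funext b
    simp only [Function.comp]
    split
    · next h => rw [List.count_filter]; simp [h]
    · next h =>
      rw [List.count_eq_zero]
      simp only [List.mem_filter, decide_eq_true_eq, not_and]
      exact fun _ h' => h h'.symm
  rw [this, List.sum_map_eq_nsmul_single (key a) _ (fun b hb _ => if_neg hb),
    List.count_eq_one_of_mem hbs (hm _)]
  simp

theorem flatten_splitGroup {B : Type} (bs : List B) (G : B → List I) :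
    (splitGroup bs G).flatten.Perm (bs.flatMap G) := by
  induction bs with
  | nil => simp [splitGroup]
  | cons b bs ih =>
    rw [splitGroup_cons, List.flatten_append, List.flatMap_cons]
    refine List.perm_append_comm.trans (List.Perm.append ?_ ih)
    split <;> simp_all

theorem flatten_refine {B : Type} {bs : List B} (hbs : bs.Nodup) (hm : ∀ b, b ∈ bs)
    (key : I → B) (gs : List (List I)) : (refine bs key gs).flatten.Perm gs.flatten := by
  induction gs with
  | nil => simp [refine]
  | cons g gs ih =>
    rw [refine_cons, List.flatten_append, List.flatten_cons]
    exact List.perm_append_comm.trans (((flatten_splitGroup _ _).trans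
      (perm_flatMap_filter hbs hm key g)).append ih)

theorem pairs_splitGroup {B : Type} (bs : List B) (G : B → List I) :
    (pairs tag (splitGroup bs G)).Perm (bs.flatMap fun b => groupPairs tag (G b)) := by
  induction bs with
  | nil => simp [splitGroup, pairs]
  | cons b bs ih =>
    rw [splitGroup_cons, pairs, List.flatMap_append, List.flatMap_cons]
    refine List.perm_append_comm.trans (List.Perm.append ?_ ih)
    split
    · next h => simp [groupPairs, h]
    · simp

theorem filter_product {J : Type} (P Q : J → Bool) (l₁ l₂ : List J) :
    (l₁ ×ˢ l₂).filter (fun p => P p.1 && Q p.2) = l₁.filter P ×ˢ l₂.filter Q := by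
  induction l₁ with
  | nil => rfl
  | cons a l ih =>
    rw [List.product_cons, List.filter_append, ih, List.filter_map]
    cases h : P a <;> simp [h, Function.comp_def, List.product_cons]

theorem groupPairs_filter {B : Type} (key : I → B) (g : List I) (b : B) :
    ((groupPairs tag g).filter fun p => key p.1 = key p.2).filter (fun p => key p.1 = b) =
      groupPairs tag (g.filter fun x => key x = b) := by
  rw [groupPairs, groupPairs, List.filter_filter, List.filter_comm _ (fun x => decide (key x = b)),
    List.filter_comm _ (fun x => decide (key x = b)),
    ← filter_product (fun x => decide (key x = b)) fun x => decide (key x = b)]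
  congr 1
  funext p
  by_cases h₁ : key p.1 = b
  · subst h₁; simp [eq_comm]
  · simp [h₁]

/-- Sort the pairs with equal keys by this common key `b`: by `groupPairs_filter` they are the pairs
within the bucket of `b`. -/
theorem pairs_refine {B : Type} {bs : List B} (hbs : bs.Nodup) (hm : ∀ b, b ∈ bs)
    (key : I → B) (gs : List (List I)) :
    (pairs tag (refine bs key gs)).Perm ((pairs tag gs).filter fun p => key p.1 = key p.2) := by
  induction gs with
  | nil => simp [refine, pairs]
  | cons g gs ih =>
    rw [refine_cons, pairs, List.flatMap_append]
    rw [pairs, List.flatMap_cons, List.filter_append]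
    refine List.perm_append_comm.trans (List.Perm.append ?_ ih)
    refine (pairs_splitGroup _ _).trans ?_
    refine List.Perm.trans (List.Perm.of_eq ?_) (perm_flatMap_filter hbs hm (fun p => key p.1) _)
    simp only [groupPairs_filter]

theorem length_splitGroup_le {B : Type} (bs : List B) (G : B → List I) :
    (splitGroup bs G).length ≤ (splitGroup bs G).flatten.length := by
  induction bs with
  | nil => simp [splitGroup]
  | cons b bs ih =>
    rw [splitGroup_cons, List.flatten_append, List.length_append, List.length_append]
    refine Nat.add_le_add ih ?_
    split
    · simp
    · next h => simpa [Nat.succ_le_iff] using List.length_pos_iff.2 h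

theorem length_refine_le {B : Type} (bs : List B) (key : I → B) (gs : List (List I)) :
    (refine bs key gs).length ≤ (refine bs key gs).flatten.length := by
  induction gs with
  | nil => simp [refine]
  | cons g gs ih =>
    rw [refine_cons, List.flatten_append, List.length_append, List.length_append]
    exact Nat.add_le_add ih (length_splitGroup_le _ _)

theorem refined_refine {B : Type} {bs : List B} (hbs : bs.Nodup) (hm : ∀ b, b ∈ bs)
    (key : I → B) (gs : List (List I)) :
    Refined tag (fun x y => key x = key y) gs (refine bs key gs) where
  flatten := flatten_refine hbs hm key gs
  pairs := pairs_refine hbs hm key gs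
  length := le_max_of_le_right
    ((length_refine_le bs key gs).trans (flatten_refine hbs hm key gs).length_eq.le)

theorem length_encW_le {e : I → List (Sym V)} {R : ℕ} {g : List I}
    (h : ∀ x ∈ g, (e x).length ≤ R) : (encW tag e g).length ≤ g.length * (R + 1) := by
  induction g with
  | nil => simp
  | cons x g ih =>
    have h₁ := h x (by simp)
    have h₂ := ih fun y hy => h y (by simp [hy])
    simp only [encW_cons, List.length_append, List.length_cons]
    linarith

theorem length_encGs_le {e : I → List (Sym V)} {R : ℕ} {gs : List (List I)}
    (h : ∀ x ∈ gs.flatten, (e x).length ≤ R) :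
    (encGs tag e gs).length ≤ gs.flatten.length * (R + 1) + gs.length := by
  induction gs with
  | nil => simp
  | cons g gs ih =>
    have h₁ := length_encW_le (tag := tag) (g := g) fun x hx => h x (by simp [hx])
    have h₂ := ih fun y hy => h y (by rw [List.flatten_cons]; exact List.mem_append_right _ hy)
    simp only [encGs_cons, List.length_append, List.length_cons, List.flatten_cons]
    linarith

end Pairs

/-! ### Sorting by a field -/

/-- Do not rotate field separators. -/
def rotBits : Sym V → Bool
  | .field => false
  | _ => true

/-- The bucket of a symbol. -/
def bucket (split : Bool) (a : Sym V) : Sym V := bif split then a else .field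

theorem rotWord_ne_nil {rot : Sym V → Bool} {w : List (Sym V)} (h : w ≠ []) :
    rotWord rot w ≠ [] := by
  rw [← List.length_pos_iff, length_rotWord, List.length_pos_iff]
  exact h

theorem mem_rotWord {rot : Sym V → Bool} {w : List (Sym V)} {a : Sym V} :
    a ∈ rotWord rot w ↔ a ∈ w := by
  cases w with
  | nil => rfl
  | cons b l => cases h : rot b <;> simp [rotWord, h, or_comm]

/-- A separator is not rotated, so the word stays fixed once the bits of its first field are used
up. Thus fields of different lengths can undergo the same number `W` of rounds. -/
theorem iterate_rotWord {b : List (Sym V)} (hb : ∀ a ∈ b, rotBits a = true) (W : ℕ)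
    (rest : List (Sym V)) :
    (rotWord rotBits)^[W] (b ++ .field :: rest) = b.drop W ++ .field :: (rest ++ b.take W) := by
  induction W generalizing b rest with
  | zero => simp
  | succ W ih =>
    rw [Function.iterate_succ_apply]
    cases b with
    | nil =>
      have := ih (b := []) (by simp) rest
      simpa [rotWord, rotBits] using this
    | cons a b =>
      have := ih (b := b) (fun x hx => hb x (by simp [hx])) (rest ++ [a])
      simpa [rotWord, hb a] using this

/-- The default `.field` is not a bit, so it acts as an end marker: if one list is exhausted before
the other, the heads differ in that round. -/
theorem eq_of_heads {b b' : List (Sym V)} (hb : ∀ a ∈ b, rotBits a = true)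
    (hb' : ∀ a ∈ b', rotBits a = true) {W : ℕ} (hl : b.length ≤ W) (hl' : b'.length ≤ W)
    (h : ∀ j < W, (b.drop j).headD .field = (b'.drop j).headD .field) : b = b' := by
  induction W generalizing b b' with
  | zero => simp_all
  | succ W ih =>
    have h0 := h 0 (by omega)
    have hs : b.tail = b'.tail := by
      refine ih (fun a ha => hb a (List.mem_of_mem_tail ha))
        (fun a ha => hb' a (List.mem_of_mem_tail ha)) (by simp; omega) (by simp; omega) ?_
      intro j hj
      simpa using h (j + 1) (by omega)
    cases b <;> cases b'
    · rfl
    · simp only [List.drop_zero, List.headD_cons, List.headD_nil] at h0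
      simp [← h0, rotBits] at hb'
    · simp only [List.drop_zero, List.headD_cons, List.headD_nil] at h0
      simp [h0, rotBits] at hb
    · simp_all

theorem headD_append_cons {α : Type} (l r : List α) (a d : α) (h : a = d) :
    (l ++ a :: r).headD d = l.headD d := by
  cases l <;> simp [h]

variable [Fintype V] {I : Type} {tag : I → Bool}

/-- The tape `wid` is a unary counter for the rounds: its length bounds that of every field. Its
contents are kept on `wid'` for the next field. Without `split` all words share one bucket and are
only rotated. -/
def fieldLoop (split : Bool) : Prog (Reg V ι) (Sym V) :=
  .loop .wid Option.isSome (.seq (moveOne .wid .wid') (pass rotBits (bucket split)))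

/-- The time of a pass over a list of at most `n` words of length at most `R`. -/
def passTime (V : Type) [Fintype V] (n R : ℕ) : ℕ :=
  (29 + 4 * (allSyms V).length) * ((n + 1) * (R + 2)) + 3

theorem pass_runs' (rot : Sym V → Bool) (c : Sym V → Sym V) {n R : ℕ} {gs : List (List I)}
    {e : I → List (Sym V)}
    (he : ∀ x, e x ≠ []) (hb : ∀ x, ∀ a ∈ e x, a.isBody = true)
    (hR : ∀ x ∈ gs.flatten, (e x).length ≤ R) (hn : gs.flatten.length ≤ n) (hn' : gs.length ≤ n + 1)
    {s : St V ι} (h : s .src = encGs tag e gs) (hbk : ∀ b, s (.bk b) = []) (hdst : s .dst = [])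
    (htmp : s .tmp = []) :
    Runs (pass rot c) s
      (update s .src (encGs tag (fun x => rotWord rot (e x)) (refine (allSyms V) (keyOf c e) gs)))
      (passTime V n R) := by
  refine (pass_runs rot c he hb h hbk hdst htmp).congr rfl ?_
  refine Nat.add_le_add_right (Nat.mul_le_mul_left _ ?_) _
  have := length_encGs_le (tag := tag) hR
  nlinarith [Nat.mul_le_mul_right (R + 1) hn]

theorem fieldLoop_runs (split : Bool) {n R : ℕ} {w : List (Sym V)} {gs : List (List I)}
    {e : I → List (Sym V)} (he : ∀ x, e x ≠ []) (hb : ∀ x, ∀ a ∈ e x, a.isBody = true)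
    (hR : ∀ x ∈ gs.flatten, (e x).length ≤ R) (hn : gs.flatten.length ≤ n) (hn' : gs.length ≤ n + 1)
    {s : St V ι} (hw : s .wid = w) (h : s .src = encGs tag e gs) (hbk : ∀ b, s (.bk b) = [])
    (hdst : s .dst = []) (htmp : s .tmp = []) :
    ∃ gs', Refined tag (fun x y => split = true → ∀ j < w.length,
        ((rotWord rotBits)^[j] (e x)).headD .field = ((rotWord rotBits)^[j] (e y)).headD .field)
        gs gs' ∧
      Runs (fieldLoop split) s (update (update (update s .wid []) .wid' (w.reverse ++ s .wid'))
        .src (encGs tag (fun x => (rotWord rotBits)^[w.length] (e x)) gs'))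
        (w.length * (passTime V n R + 4) + 1) := by
  induction w generalizing s gs e with
  | nil =>
    refine ⟨gs, Refined.refl (by simp) gs, (Runs.loop_done (by simp [hw])).congr ?_ (by simp)⟩
    funext k
    cases k <;> simp [hw, h]
  | cons a w ih =>
    have h₁ := moveOne_runs (k := Reg.wid) (k' := .wid') (by simp) hw
    have h₂ := pass_runs' (tag := tag) (s := update (update s .wid w) .wid' (a :: s .wid')) rotBits
      (bucket split) he hb hR hn hn' (by simp [h]) (by simp [hbk]) (by simp [hdst]) (by simp [htmp])
    have hr := refined_refine (tag := tag) (nodup_allSyms (V := V)) mem_allSyms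
      (keyOf (bucket split) e) gs
    have hn₂ := hr.length
    obtain ⟨gs', hgs', h₃⟩ := ih (e := fun x => rotWord rotBits (e x))
      (gs := refine (allSyms V) (keyOf (bucket split) e) gs)
      (s := update (update (update s .wid w) .wid' (a :: s .wid')) .src
        (encGs tag (fun x => rotWord rotBits (e x))
          (refine (allSyms V) (keyOf (bucket split) e) gs)))
      (fun x => rotWord_ne_nil (he x)) (fun x b hb' => hb x b (mem_rotWord.1 hb'))
      (fun x hx => (length_rotWord _ _).trans_le (hR x (hr.flatten.mem_iff.1 hx)))
      (hr.flatten.length_eq.trans_le hn) (by omega)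
      (by simp) (by simp) (by simp [hbk]) (by simp [hdst]) (by simp [htmp])
    refine ⟨gs', hr.trans hgs' ?_, (Runs.loop_step (by simp [hw]) (h₁.seq h₂) h₃).congr ?_ ?_⟩
    · intro x y
      cases split with
      | false => simp [keyOf, bucket]
      | true =>
        simp only [keyOf, bucket, cond_true, true_implies, List.length_cons]
        constructor
        · exact fun hj => ⟨hj 0 (by omega), fun j hj' => hj (j + 1) (by omega)⟩
        · rintro ⟨h0, hj⟩ (_ | j) hj'
          · exact h0
          · exact hj j (by omega)
    · funext k
      cases k <;> simp
    · simp only [List.length_cons]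
      linarith

/-- Sort by the first field, if `split` holds, and rotate by this field. -/
def passField (split : Bool) : Prog (Reg V ι) (Sym V) :=
  .seq (fieldLoop split) (.seq (moveAll .wid' .wid) (pass (fun _ => true) fun _ => .field))

theorem passField_runs (split : Bool) {n R : ℕ} {gs : List (List I)}
    {b rest : I → List (Sym V)} (hbits : ∀ x, ∀ a ∈ b x, rotBits a = true)
    (hb : ∀ x, ∀ a ∈ b x ++ rest x, a.isBody = true)
    (hR : ∀ x ∈ gs.flatten, (b x ++ .field :: rest x).length ≤ R)
    (hn : gs.flatten.length ≤ n) (hn' : gs.length ≤ n + 1)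
    {s : St V ι} (hw : ∀ x ∈ gs.flatten, (b x).length ≤ (s .wid).length) (hw' : s .wid' = [])
    (h : s .src = encGs tag (fun x => b x ++ .field :: rest x) gs) (hbk : ∀ b, s (.bk b) = [])
    (hdst : s .dst = []) (htmp : s .tmp = []) :
    ∃ gs', Refined tag (fun x y => split = true → b x = b y) gs gs' ∧
      Runs (passField split) s
        (update s .src (encGs tag (fun x => rest x ++ b x ++ [.field]) gs'))
        (((s .wid).length + 1) * (passTime V n R + 8)) := by
  have hb₁ : ∀ x, ∀ a ∈ b x ++ .field :: rest x, a.isBody = true := by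
    intro x a ha
    have := hb x a
    simp only [List.mem_append, List.mem_cons] at ha this
    rcases ha with ha | rfl | ha
    · exact this (.inl ha)
    · rfl
    · exact this (.inr ha)
  obtain ⟨gs', hgs', h₁⟩ := fieldLoop_runs split (fun x => by simp) hb₁ hR hn hn' rfl h hbk hdst htmp
  have h₂ := moveAll_runs (k := Reg.wid') (k' := Reg.wid) (by simp)
    (update (update (update s .wid []) .wid' ((s .wid).reverse ++ s .wid'))
        .src (encGs tag (fun x => (rotWord rotBits)^[(s .wid).length] (b x ++ .field :: rest x)) gs'))
  have he : ∀ x ∈ gs'.flatten, (rotWord rotBits)^[(s .wid).length] (b x ++ .field :: rest x) =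
      .field :: (rest x ++ b x) := by
    intro x hx
    rw [iterate_rotWord (hbits x), List.drop_eq_nil_of_le (hw x (hgs'.flatten.mem_iff.1 hx)),
      List.take_of_length_le (hw x (hgs'.flatten.mem_iff.1 hx)), List.nil_append]
  have hcongr : ∀ {e₁ e₂ : I → List (Sym V)}, (∀ x ∈ gs'.flatten, e₁ x = e₂ x) →
      encGs tag e₁ gs' = encGs tag e₂ gs' := by
    intro e₁ e₂ he
    unfold encGs
    refine List.flatMap_congr fun g hg => ?_
    congr 1
    unfold encW
    refine List.flatMap_congr fun x hx => ?_
    rw [he x (List.mem_flatten.2 ⟨g, hg, hx⟩)]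
  have hlen := hgs'.length
  -- All words now start with the separator. The last pass has a constant key, so it separates
  -- nothing; it only rotates the separator, which then closes the field at the end of the word.
  have h₃ := pass_runs' (s := update s .src (encGs tag (fun x => .field :: (rest x ++ b x)) gs'))
    (tag := tag) (gs := gs') (n := n) (R := R) (e := fun x => .field :: (rest x ++ b x))
    (fun _ => true) (fun _ => .field) (fun x => by simp)
    (fun x a ha => hb₁ x a (by simp only [List.mem_append, List.mem_cons] at ha ⊢; tauto))
    (fun x hx => by
      have := hR x (hgs'.flatten.mem_iff.1 hx)
      simp only [List.length_append, List.length_cons] at this ⊢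
      omega)
    (hgs'.flatten.length_eq.trans_le hn) (by omega)
    (by simp) (by simp [hbk]) (by simp [hdst]) (by simp [htmp])
  have hr := refined_refine (tag := tag) (nodup_allSyms (V := V)) mem_allSyms
    (keyOf (fun _ => .field) fun x => .field :: (rest x ++ b x)) gs'
  have h₂' := h₂.congr (s₂ := update s .src (encGs tag (fun x => .field :: (rest x ++ b x)) gs'))
    (t₂ := 4 * (s .wid).length + 1) (by
      funext k
      cases k <;> simp [hw', hcongr he]) (by simp [hw'])
  refine ⟨_, Refined.trans (hgs'.congr (R := fun x y => split = true → b x = b y) ?_)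
    hr (by simp [keyOf]), ((h₁.seq (h₂'.seq h₃)).congr ?_ ?_)⟩
  · intro x hx y hy
    refine imp_congr_right fun _ => ⟨fun hxy j hj => ?_, fun hxy => ?_⟩
    · simp only [iterate_rotWord (hbits _), hxy, headD_append_cons]
    · refine eq_of_heads (hbits x) (hbits y) (hw x hx) (hw y hy) fun j hj => ?_
      have := hxy j hj
      rwa [iterate_rotWord (hbits _), iterate_rotWord (hbits _), headD_append_cons _ _ _ _ rfl,
        headD_append_cons _ _ _ _ rfl] at this
  · funext k
    cases k <;> simp [rotWord]
  · linarith

end ColoredSubgraph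

end

noncomputable section

open Function (update)
open scoped Classical

namespace ColoredSubgraph

open StackProg

variable {V ι : Type}

/-! ### Records -/

/-- The binary digits of a number. -/
def bitsOf (n : ℕ) : List (Sym V) := (Nat.bits n).map fun b => .inp (some (.inr b))

theorem rotBits_bitsOf (n : ℕ) : ∀ a ∈ bitsOf (V := V) n, rotBits a = true := by
  rw [bitsOf, List.forall_mem_map]
  exact fun _ _ => rfl

theorem isBody_bitsOf (n : ℕ) : ∀ a ∈ bitsOf (V := V) n, a.isBody = true := by
  rw [bitsOf, List.forall_mem_map]
  exact fun _ _ => rfl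

theorem bits_injective : Function.Injective Nat.bits := by
  intro m n h
  have key : ∀ m : ℕ, (m.bits.foldr (fun b k => Nat.bit b k) 0) = m := by
    intro m
    induction m using Nat.binaryRec' with
    | zero => simp
    | bit b n hb ih => rw [Nat.bits_append_bit n b hb, List.foldr_cons, ih]
  rw [← key m, ← key n, h]

theorem bitsOf_injective : Function.Injective (bitsOf (V := V)) := by
  intro m n h
  refine bits_injective (List.map_injective_iff.2 ?_ h)
  intro a b hab
  simpa using hab

/-- The word of a record, where the fields are listed in the order `l`. -/
def word (l : List V) (r : V → ℕ) : List (Sym V) := l.flatMap fun v => bitsOf (r v) ++ [.field]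

@[simp] theorem word_nil (r : V → ℕ) : word [] r = [] := rfl
@[simp] theorem word_cons (v : V) (l : List V) (r : V → ℕ) :
    word (v :: l) r = bitsOf (r v) ++ .field :: word l r := by simp [word]
@[simp] theorem word_append (l l' : List V) (r : V → ℕ) :
    word (l ++ l') r = word l r ++ word l' r := by simp [word]

theorem isBody_word (l : List V) (r : V → ℕ) : ∀ a ∈ word l r, a.isBody = true := by
  intro a ha
  simp only [word, List.mem_flatMap, List.mem_append, List.mem_singleton] at ha
  obtain ⟨v, _, ha | rfl⟩ := ha
  · exact isBody_bitsOf _ a ha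
  · rfl

theorem length_word_le {l : List V} {r : V → ℕ} {W : ℕ} (h : ∀ v, (Nat.bits (r v)).length ≤ W) :
    (word l r).length ≤ l.length * (W + 1) := by
  induction l with
  | nil => simp
  | cons v l ih =>
    have := h v
    simp only [word_cons, List.length_append, List.length_cons, bitsOf, List.length_map]
    linarith

/-! ### Merging the records of a group -/

/-- Copy a field. -/
def copyThrough (k k' k'' : Reg V ι) : Prog (Reg V ι) (Sym V) :=
  .seq (copyWhile rotBits id k k' k'') (.seq (moveOne k k') (.push k'' .field))

theorem copyThrough_runs {k k' k'' : Reg V ι} (h₁ : k ≠ k') (h₂ : k ≠ k'') (h₃ : k' ≠ k'')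
    {s : St V ι} {n : ℕ} {r : List (Sym V)} (h : s k = bitsOf n ++ .field :: r) :
    Runs (copyThrough k k' k'') s
      (update (update (update s k r) k' (.field :: ((bitsOf n).reverse ++ s k'))) k''
        (.field :: ((bitsOf n).reverse ++ s k''))) (5 * ((bitsOf (V := V) n).length + 1)) := by
  have e₁ := copyWhile_runs (f := id) h₁ h₂ h₃ h (rotBits_bitsOf n) (by simp [rotBits])
  refine (e₁.seq ((moveOne_runs h₁ (a := .field) (r := r) (by simp [h₁, h₂])).seq
    (Runs.push _ _ _))).congr ?_ (by omega)
  funext j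
  by_cases a : j = k <;> by_cases b : j = k' <;> by_cases c : j = k'' <;>
    simp_all [Function.update_apply]

/-- Move a field. -/
def moveThrough (k k' : Reg V ι) : Prog (Reg V ι) (Sym V) :=
  .seq (moveWhile rotBits k k') (moveOne k k')

theorem moveThrough_runs {k k' : Reg V ι} (h₁ : k ≠ k')
    {s : St V ι} {n : ℕ} {r : List (Sym V)} (h : s k = bitsOf n ++ .field :: r) :
    Runs (moveThrough k k') s
      (update (update s k r) k' (.field :: ((bitsOf n).reverse ++ s k')))
      (5 * ((bitsOf (V := V) n).length + 1)) := by
  have e₁ := moveWhile_runs h₁ h (rotBits_bitsOf n) (by simp [rotBits])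
  refine (e₁.seq (moveOne_runs h₁ (a := .field) (r := r) (by simp [h₁]))).congr ?_ (by omega)
  funext j
  by_cases a : j = k <;> by_cases b : j = k' <;> simp_all

/-- The record that has the fields in `first` from `r` and the others from `r'`. -/
def merge (first : V → Bool) (r r' : V → ℕ) (v : V) : ℕ := bif first v then r v else r' v

/-- Both records advance by one field and only the chosen one is copied to `out`, so the two stay in
step. -/
def mergeField (b : Bool) : Prog (Reg V ι) (Sym V) :=
  bif b then .seq (copyThrough .ca .ca' .out) (moveThrough .gb .gb')
  else .seq (moveThrough .ca .ca') (copyThrough .gb .gb' .out)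


theorem mergeField_runs (b : Bool) {s : St V ι} {n n' : ℕ} {r q : List (Sym V)}
    (hca : s .ca = bitsOf n ++ .field :: r) (hgb : s .gb = bitsOf n' ++ .field :: q) :
    Runs (mergeField b) s
      (update (update (update (update (update s .ca r) .ca'
        (.field :: ((bitsOf n).reverse ++ s .ca'))) .gb q) .gb'
        (.field :: ((bitsOf n').reverse ++ s .gb')))
        .out (.field :: ((bitsOf (bif b then n else n')).reverse ++ s .out)))
      (5 * ((bitsOf (V := V) n).length + 1) + 5 * ((bitsOf (V := V) n').length + 1)) := by
  cases b with
  | true =>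
    refine ((copyThrough_runs (k := Reg.ca) (k' := .ca') (k'' := .out) (by simp) (by simp)
      (by simp) hca).seq (moveThrough_runs (k := Reg.gb) (k' := .gb') (by simp) (r := q) (n := n')
      (by simp [hgb]))).congr ?_ le_rfl
    funext k
    cases k <;> simp
  | false =>
    refine ((moveThrough_runs (k := Reg.ca) (k' := .ca') (by simp) hca).seq
      (copyThrough_runs (k := Reg.gb) (k' := .gb') (k'' := .out) (by simp) (by simp)
        (by simp) (r := q) (n := n') (by simp [hgb]))).congr ?_ le_rfl
    funext k
    cases k <;> simp

theorem mergeFields_runs (first : V → Bool) (r r' : V → ℕ) (l : List V) {s : St V ι}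
    {q : List (Sym V)} (hca : s .ca = word l r) (hgb : s .gb = word l r' ++ q) :
    Runs (seqList (l.map fun v => mergeField (first v))) s
      (update (update (update (update (update s .ca []) .ca' ((word l r).reverse ++ s .ca'))
        .gb q) .gb' ((word l r').reverse ++ s .gb'))
        .out ((word l (merge first r r')).reverse ++ s .out))
      (5 * ((word l r).length + (word l r').length) + 1) := by
  induction l generalizing s with
  | nil =>
    refine (Runs.skip s).congr ?_ (by simp)
    funext k
    cases k <;> simp_all
  | cons v l ih =>
    refine ((mergeField_runs (first v) (n := r v) (n' := r' v) (r := word l r)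
      (q := word l r' ++ q) (by simp [hca]) (by simp [hgb])).seq (ih (by simp) (by simp))).congr ?_ ?_
    · funext k
      cases k <;> simp [merge]
    · simp only [word_cons, List.length_append, List.length_cons]
      linarith

/-- Merge the record on `ca'`, which is kept, with the first record on `gb`, which is moved to
`gb'`. -/
def mergeOne (l : List V) (first : V → Bool) : Prog (Reg V ι) (Sym V) :=
  -- The record rests on `ca'` in reverse. While its fields are merged they return there, which
  -- makes it ready for the next partner.
  .seq (moveAll .ca' .ca) <| .seq (seqList (l.map fun v => mergeField (first v))) <|
    .seq (moveOne .gb .gb') (.push .out (.mark false))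

theorem mergeOne_runs (first : V → Bool) (r r' : V → ℕ) (l : List V) {s : St V ι}
    {q : List (Sym V)} {t : Bool} (hca : s .ca = []) (hca' : s .ca' = (word l r).reverse)
    (hgb : s .gb = word l r' ++ .mark t :: q) :
    Runs (mergeOne l first) s
      (update (update (update s .gb q) .gb' (.mark t :: ((word l r').reverse ++ s .gb')))
        .out (.mark false :: ((word l (merge first r r')).reverse ++ s .out)))
      (9 * (word l r).length + 5 * (word l r').length + 6) := by
  refine ((moveAll_runs (by simp) s).seq ((mergeFields_runs first r r' l (q := .mark t :: q)
    ?_ ?_).seq ((moveOne_runs (a := .mark t) (r := q) ?_ ?_).seq (Runs.push _ _ _)))).congr ?_ ?_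
  · simp [hca, hca']
  · simp [hgb]
  · simp
  · simp
  · funext k
    cases k <;> simp [hca, hca']
  · simp [hca']; omega

/-- Merge the record on `ca'` with all records on `gb`. -/
def mergeLoop (l : List V) (first : V → Bool) : Prog (Reg V ι) (Sym V) :=
  .loop .gb Option.isSome (mergeOne l first)

/-- The code of a list of records. -/
def encL (l : List V) (L : List (V → ℕ)) : List (Sym V) := encW (fun _ => false) (word l) L

theorem encL_append (l : List V) (L L' : List (V → ℕ)) :
    encL l (L ++ L') = encL l L ++ encL l L' := encW_append _ _ _ _

variable {I : Type} {tag : I → Bool} (rec : I → V → ℕ)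

theorem mergeLoop_runs (first : V → Bool) {r : V → ℕ} (l : List V) {R : ℕ} {B : List I}
    (hR : (word l r).length ≤ R) (hB : ∀ y ∈ B, (word l (rec y)).length ≤ R)
    {s : St V ι} (hca : s .ca = []) (hca' : s .ca' = (word l r).reverse)
    (hgb : s .gb = encW tag (fun y => word l (rec y)) B) :
    Runs (mergeLoop l first) s
      (update (update (update s .gb []) .gb' ((encW tag (fun y => word l (rec y)) B).reverse ++
        s .gb')) .out ((encL l (B.map fun y => merge first r (rec y))).reverse ++ s .out))
      (B.length * (14 * R + 7) + 1) := by
  induction B generalizing s with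
  | nil =>
    refine (Runs.loop_done (by simp [hgb])).congr ?_ (by simp)
    funext k
    cases k <;> simp_all [encL]
  | cons y B ih =>
    have hy := hB y (by simp)
    refine (Runs.loop_step ?_ (mergeOne_runs first r (rec y) l (t := tag y)
      (q := encW tag (fun y => word l (rec y)) B) hca hca' (by simp [hgb]))
      (ih (fun z hz => hB z (by simp [hz])) ?_ ?_ ?_)).congr ?_ ?_
    · rw [hgb, encW_cons]
      cases word l (rec y) <;> rfl
    · simp [hca]
    · simp [hca']
    · simp
    · funext k
      cases k <;> simp [encL]
    · simp only [List.length_cons]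
      nlinarith

/-- Merge all records on `ga` with all records on `gb`. -/
def mergeAll (l : List V) (first : V → Bool) : Prog (Reg V ι) (Sym V) :=
  .loop .ga Option.isSome <| .seq (moveWhile Sym.isBody .ga .ca') <| .seq (.pop .ga) <|
    .seq (mergeLoop l first) <| .seq (moveAll .gb' .gb) (dropAll .ca')

/-- The product term pays for the merged records, the term with `A.length` alone for fetching and
removing each record of `A`, which happens even if `B` is empty. -/
theorem mergeAll_runs (first : V → Bool) (l : List V) {R : ℕ} {A B : List I}
    (hA : ∀ y ∈ A, (word l (rec y)).length ≤ R) (hB : ∀ y ∈ B, (word l (rec y)).length ≤ R)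
    {s : St V ι} (hca : s .ca = []) (hca' : s .ca' = []) (hgb' : s .gb' = [])
    (hga : s .ga = encW tag (fun y => word l (rec y)) A)
    (hgb : s .gb = encW tag (fun y => word l (rec y)) B) :
    Runs (mergeAll l first) s
      (update (update s .ga [])
        .out ((encL l ((A ×ˢ B).map fun p => merge first (rec p.1) (rec p.2))).reverse ++ s .out))
      (A.length * B.length * (18 * (R + 1)) + A.length * (6 * (R + 1)) + 1) := by
  induction A generalizing s with
  | nil =>
    refine (Runs.loop_done (by simp [hga])).congr ?_ (by simp)
    funext k
    cases k <;> simp_all [encL]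
  | cons x A ih =>
    have hx := hA x (by simp)
    have hlen := length_encW_le (tag := tag) (e := fun y => word l (rec y)) hB
    refine (Runs.loop_step ?_ ((moveWhile_runs (l := word l (rec x))
      (r := .mark (tag x) :: encW tag (fun y => word l (rec y)) A) (by simp) (by simp [hga])
      (isBody_word _ _) rfl).seq ((Runs.pop _ _).seq ((mergeLoop_runs (tag := tag) (B := B) (R := R)
        rec first (r := rec x) l hx hB ?_ ?_ ?_).seq ((moveAll_runs (by simp) _).seq
          (dropAll_runs _ _)))))
      (ih (fun z hz => hA z (by simp [hz])) ?_ ?_ ?_ ?_ ?_)).congr ?_ ?_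
    · rw [hga, encW_cons]
      cases word l (rec x) <;> rfl
    · simp [hca]
    · simp [hca']
    · simp [hgb]
    · simp [hca]
    · simp
    · simp
    · simp
    · simp [hgb']
    · funext k
      cases k <;> simp [hgb, hgb', hca', List.product_cons, encL_append, Function.comp_def]
    · simp [hgb', hca']
      nlinarith

/-- Distribute the words of a group to `ga` and `gb`. -/
def distribute : Prog (Reg V ι) (Sym V) :=
  .loop .src (fun x => x.any fun a => !a.isGroup) <| .seq (moveWhile Sym.isBody .src .tmp) <|
    .case .src fun x => match x with
      -- The tag becomes visible only behind the word, which therefore waits on `tmp`. The mark is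
      -- moved first, so that it ends the word again on its new stack.
      | some (.mark true) => .seq (moveOne .src .gb) (moveAll .tmp .gb)
      | _ => .seq (moveOne .src .ga) (moveAll .tmp .ga)

theorem distribute_runs {e : I → List (Sym V)} {g : List I}
    (hb : ∀ x ∈ g, ∀ a ∈ e x, a.isBody = true)
    {s : St V ι} {r : List (Sym V)} (h : s .src = encW tag e g ++ .group :: r)
    (htmp : s .tmp = []) :
    Runs distribute s
      (update (update (update s .src (.group :: r))
        .ga (encW tag e (g.filter fun x => tag x = false).reverse ++ s .ga))
        .gb (encW tag e (g.filter fun x => tag x = true).reverse ++ s .gb))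
      (8 * (encW tag e g).length + 1) := by
  induction g generalizing s with
  | nil =>
    refine (Runs.loop_done (by simp [h, Sym.isGroup])).congr ?_ (by simp)
    funext k
    cases k <;> simp_all
  | cons x g ih =>
    have h₁ := moveWhile_runs (k := Reg.src) (k' := Reg.tmp) (l := e x)
      (r := .mark (tag x) :: (encW tag e g ++ .group :: r)) (by simp) (s := s)
      (by simp [h]) (hb x (by simp)) rfl
    have hne : Option.any (fun a => !a.isGroup) (s .src).head? = true := by
      rw [h, encW_cons]
      rcases he : e x with _ | ⟨a, l⟩
      · rfl
      · have := hb x (by simp) a (by simp [he])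
        cases a <;> simp_all [Sym.isBody, Sym.isGroup]
    cases ht : tag x with
    | true =>
      rw [ht] at h₁
      refine (Runs.loop_step hne (h₁.seq (Runs.case (x := some (.mark true)) (by simp)
        ((moveOne_runs (a := .mark true) (r := encW tag e g ++ .group :: r) (by simp) (by simp)).seq
        (moveAll_runs (by simp) _)))) (ih (fun y hy => hb y (by simp [hy])) ?_ ?_)).congr ?_ ?_
      · simp
      · simp
      · funext k
        cases k <;> simp [htmp, ht]
      · simp [htmp]
        linarith
    | false =>
      rw [ht] at h₁
      refine (Runs.loop_step hne (h₁.seq (Runs.case (x := some (.mark false)) (by simp)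
        ((moveOne_runs (a := .mark false) (r := encW tag e g ++ .group :: r) (by simp) (by simp)).seq
        (moveAll_runs (by simp) _)))) (ih (fun y hy => hb y (by simp [hy])) ?_ ?_)).congr ?_ ?_
      · simp
      · simp
      · funext k
        cases k <;> simp [htmp, ht]
      · simp [htmp]
        linarith

/-- Merge the pairs of records in all groups. -/
def mergeGroups (l : List V) (first : V → Bool) : Prog (Reg V ι) (Sym V) :=
  .loop .src Option.isSome <| .seq distribute <| .seq (.pop .src) <| .seq (mergeAll l first)
    (dropAll .gb)

/-- A group with `a` items tagged `false` and `b` tagged `true` yields `a * b` records, so the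
product terms of `mergeAll_runs` add up to the length of the output. Distributing a group reverses
the order of its items, hence the result is known up to permutation. -/
theorem mergeGroups_runs (first : V → Bool) (l : List V) {R : ℕ} {gs : List (List I)}
    (hR : ∀ y ∈ gs.flatten, (word l (rec y)).length ≤ R)
    {s : St V ι} (hca : s .ca = []) (hca' : s .ca' = []) (hgb' : s .gb' = [])
    (hga : s .ga = []) (hgb : s .gb = []) (htmp : s .tmp = [])
    (hsrc : s .src = encGs tag (fun y => word l (rec y)) gs) :
    ∃ L, L.Perm ((pairs tag gs).map fun p => merge first (rec p.1) (rec p.2)) ∧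
    Runs (mergeGroups l first) s
      (update (update s .src []) .out ((encL l L).reverse ++ s .out))
      (L.length * (18 * (R + 1)) + gs.flatten.length * (14 * (R + 1)) + 5 * gs.length + 1) := by
  induction gs generalizing s with
  | nil =>
    refine ⟨[], by simp [pairs], (Runs.loop_done (by simp [hsrc])).congr ?_ (by simp)⟩
    funext k
    cases k <;> simp_all [encL]
  | cons g gs ih =>
    have hg : ∀ x ∈ g, (word l (rec x)).length ≤ R := fun x hx => hR x (by simp [hx])
    obtain ⟨L, hL, h⟩ := ih (fun y hy => hR y (by
        rw [List.flatten_cons]; exact List.mem_append_right _ hy))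
      (s := update (update s .src (encGs tag (fun y => word l (rec y)) gs)) .out
        ((encL l (((g.filter fun x => tag x = false).reverse ×ˢ
          (g.filter fun x => tag x = true).reverse).map fun p =>
            merge first (rec p.1) (rec p.2))).reverse ++ s .out))
      (by simp [hca]) (by simp [hca']) (by simp [hgb']) (by simp [hga]) (by simp [hgb])
      (by simp [htmp]) (by simp)
    have hlen := length_encW_le (tag := tag) (e := fun y => word l (rec y)) hg
    have hlen' := length_encW_le (tag := tag) (e := fun y => word l (rec y))
      (g := (g.filter fun x => tag x = true).reverse) (R := R)
      (fun x hx => hg x (List.mem_of_mem_filter (List.mem_reverse.1 hx)))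
    have hsum : (g.filter fun x => tag x = false).length + (g.filter fun x => tag x = true).length =
        g.length := by
      clear * -
      induction g with
      | nil => rfl
      | cons x g ih =>
        rw [List.filter_cons, List.filter_cons, List.length_cons, ← ih]
        cases hx : tag x <;> simp only [reduceCtorEq, decide_true, decide_false, if_true,
          Bool.false_eq_true, if_false, List.length_cons] <;> omega
    refine ⟨((g.filter fun x => tag x = false).reverse ×ˢ
        (g.filter fun x => tag x = true).reverse).map (fun p => merge first (rec p.1) (rec p.2)) ++ L,
      ?_, (Runs.loop_step ?_ ((distribute_runs (tag := tag) (e := fun y => word l (rec y)) (g := g)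
        (r := encGs tag (fun y => word l (rec y)) gs) (fun _ _ => isBody_word _ _)
        (by simp [hsrc]) htmp).seq ((Runs.pop _ _).seq
        ((mergeAll_runs (tag := tag) rec first l (R := R)
          (A := (g.filter fun x => tag x = false).reverse)
          (B := (g.filter fun x => tag x = true).reverse)
          (fun x hx => hg x (List.mem_of_mem_filter (List.mem_reverse.1 hx)))
          (fun x hx => hg x (List.mem_of_mem_filter (List.mem_reverse.1 hx)))
          ?_ ?_ ?_ ?_ ?_).seq ((dropAll_runs _ _).congr ?_ le_rfl)))) h).congr ?_ ?_⟩
    · rw [pairs, List.flatMap_cons, List.map_append]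
      exact List.Perm.append (List.Perm.map _ (List.Perm.product (List.reverse_perm _)
        (List.reverse_perm _))) hL
    · rw [hsrc, encGs_cons]
      cases encW tag (fun y => word l (rec y)) g <;> rfl
    · simp [hca]
    · simp [hca']
    · simp [hgb']
    · simp [hga]
    · simp [hgb]
    · funext k
      cases k <;> simp [hga, hgb]
    · funext k
      cases k <;> simp [encL_append]
    · simp [hgb, List.length_product] at *
      nlinarith

variable [Fintype V]

/-! ### Sorting by all fields -/

/-- The fields in `done` have been rotated to the end of the word. When all fields have had their
turn, the rotation is complete and the original order of the fields is restored. -/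
theorem passFields_runs {I : Type} {tag : I → Bool} (sh : V → Bool) (rec : I → V → ℕ) {n R : ℕ}
    (l done : List V) {gs : List (List I)}
    (hR : ∀ x ∈ gs.flatten, (word (l ++ done) (rec x)).length ≤ R)
    (hn : gs.flatten.length ≤ n) (hn' : gs.length ≤ n + 1)
    {s : St V ι} (hw : ∀ x ∈ gs.flatten, ∀ v, (bitsOf (V := V) (rec x v)).length ≤ (s .wid).length)
    (hw' : s .wid' = []) (h : s .src = encGs tag (fun x => word (l ++ done) (rec x)) gs)
    (hbk : ∀ b, s (.bk b) = []) (hdst : s .dst = []) (htmp : s .tmp = []) :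
    ∃ gs', Refined tag (fun x y => ∀ v ∈ l, sh v = true → rec x v = rec y v) gs gs' ∧
      Runs (seqList (l.map fun v => passField (sh v))) s
        (update s .src (encGs tag (fun x => word (done ++ l) (rec x)) gs'))
        (l.length * (((s .wid).length + 1) * (passTime V n R + 8)) + 1) := by
  induction l generalizing done gs s with
  | nil =>
    refine ⟨gs, Refined.refl (by simp) gs, (Runs.skip s).congr ?_ (by simp)⟩
    rw [List.append_nil, ← List.nil_append done, ← h, Function.update_eq_self]
  | cons v l ih =>
    obtain ⟨gs₁, hr₁, h₁⟩ := passField_runs (tag := tag) (sh v) (gs := gs) (n := n) (R := R)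
      (b := fun x => bitsOf (rec x v)) (rest := fun x => word (l ++ done) (rec x)) (s := s)
      (fun x => rotBits_bitsOf _)
      (fun x a ha => by
        rcases List.mem_append.1 ha with ha | ha
        · exact isBody_bitsOf _ a ha
        · exact isBody_word _ _ a ha)
      (fun x hx => by simpa using hR x hx) hn hn' (fun x hx => hw x hx v) hw' (by simpa using h)
      hbk hdst htmp
    have hl₁ := hr₁.length
    obtain ⟨gs₂, hr₂, h₂⟩ := ih (done ++ [v]) (gs := gs₁)
      (s := update s .src (encGs tag (fun x => word (l ++ done) (rec x) ++ bitsOf (rec x v) ++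
        [.field]) gs₁))
      (fun x hx => by
        have := hR x (hr₁.flatten.mem_iff.1 hx)
        simp at this ⊢; omega)
      (hr₁.flatten.length_eq.trans_le hn) (by omega)
      (fun x hx v => by simpa using hw x (hr₁.flatten.mem_iff.1 hx) v)
      (by simp [hw']) (by simp) (by simp [hbk]) (by simp [hdst]) (by simp [htmp])
    refine ⟨gs₂, hr₁.trans hr₂ ?_, (h₁.seq h₂).congr ?_ ?_⟩
    · intro x y
      simp [bitsOf_injective.eq_iff]
    · simp
    · simp only [List.length_cons]
      rw [Function.update_of_ne (by simp)]
      linarith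


end ColoredSubgraph

end

noncomputable section

open Function (update)
open scoped Classical

namespace ColoredSubgraph

open StackProg

variable {V ι : Type}

/-- The work tapes between two steps of the program: `w` on `wid`, the rest of the input `x`, and
the lists `L`. -/
def base (l : List V) (w x : List (Sym V)) (L : ι → List (V → ℕ)) : St V ι
  | .wid => w
  | .inp => x
  | .lst i => encL l (L i)
  | _ => []

/-! ### The join of two lists -/

/-- Set the marks to `b`. -/
def setMark (b : Bool) : Sym V → Sym V
  | .mark _ => .mark b
  | a => a

theorem map_setMark (b : Bool) (l : List V) (L : List (V → ℕ)) :
    (encL l L).map (setMark b) = encW Prod.snd (fun x : (V → ℕ) × Bool => word l x.1)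
      (L.map fun r => (r, b)) := by
  have hw : ∀ r, (word l r).map (setMark b) = word l r := by
    intro r
    refine (List.map_congr_left fun a ha => ?_).trans (List.map_id _)
    have := isBody_word l r a ha
    cases a <;> simp_all [Sym.isBody, setMark]
  induction L with
  | nil => rfl
  | cons r L ih =>
    unfold encL at ih
    simp [encL, hw, ih, setMark]

/-- Two moves preserve the order of the list. It is also written back to `lst j`, because later
terms of the union sequence may use it again. -/
def load (j : ι) (b : Bool) : Prog (Reg V ι) (Sym V) :=
  .seq (moveAll (.lst j) .tmp) (copyWhile (fun _ => true) (setMark b) .tmp (.lst j) .src)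

theorem load_runs (j : ι) (b : Bool) {s : St V ι} (htmp : s .tmp = []) :
    Runs (load j b) s (update s .src ((s (.lst j)).map (setMark b) ++ s .src))
      (9 * (s (.lst j)).length + 2) := by
  refine ((moveAll_runs (by simp) s).seq (copyWhile_runs (k := Reg.tmp) (k₁ := .lst j)
    (k₂ := .src) (l := (s (.lst j)).reverse) (r := []) (by simp) (by simp) (by simp) (by simp [htmp])
    (by simp) (by simp))).congr ?_ ?_
  · funext k
    cases k <;> simp [htmp, Function.update_apply]
    split <;> simp_all
  · simp; omega

theorem length_encL_le {l : List V} {L : List (V → ℕ)} {R : ℕ}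
    (h : ∀ r ∈ L, (word l r).length ≤ R) : (encL l L).length ≤ L.length * (R + 1) :=
  length_encW_le h

variable [Fintype V]

/-- Join the lists `j` and `k`, on the fields for which `sh` holds, and store the result as the list
`i`. The fields for which `first` holds are taken from the list `j`. -/
def join (l : List V) (sh first : V → Bool) (j k i : ι) : Prog (Reg V ι) (Sym V) :=
  .seq (.seq (.push .src .group) (.seq (load k true) (load j false))) <|
    .seq (seqList (l.map fun v => passField (sh v))) <| .seq (mergeGroups l first)
      (moveAll .out (.lst i))

/-- A constant for the time of a join. -/
def joinConst (l : List V) : ℕ := (l.length + 2) ^ 2 * (4 * (allSyms V).length + 100)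

/-- Arithmetic for `join_runs`: `n` is the number of records joined, `m` the number of results, `U`
one more than the length of the counter, `R` the length of a record. With `A = 29 + 4 * (allSyms
V).length` the factor `A + 71` is that of `joinConst`. -/
theorem joinTime_le {l A n m U D R : ℕ} (hl : l ≤ D) (hR : R + 2 ≤ D * U) (hU : 1 ≤ U)
    (hD : 1 ≤ D) :
    1 + (18 * (n * (R + 1)) + 4) + (l * (U * (A * ((n + 1) * (R + 2)) + 3 + 8)) + 1) +
      (m * (18 * (R + 1)) + n * (14 * (R + 1)) + 5 * 1 + 5 * n + 1) + (4 * (m * (R + 1)) + 1) ≤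
    D ^ 2 * (A + 71) * U ^ 2 * (n + m + 1) := by
  have hDU : 1 ≤ D * U := Nat.one_le_iff_ne_zero.2 (by positivity)
  have h₁ : l * (U * (A * ((n + 1) * (R + 2)) + 3 + 8)) ≤
      D * (U * (A * ((n + 1) * (D * U)) + 11)) := by
    rw [add_assoc]
    gcongr
  have hX : D * U ≤ (D * U) ^ 2 := Nat.le_self_pow two_ne_zero _
  have h₂ : n * (R + 1) ≤ n * (D * U) ^ 2 := Nat.mul_le_mul_left _ (by omega)
  have h₃ : m * (R + 1) ≤ m * (D * U) ^ 2 := Nat.mul_le_mul_left _ (by omega)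
  have h₄ : D * (U * (A * ((n + 1) * (D * U)) + 11)) =
    A * (n + 1) * (D * U) ^ 2 + 11 * (D * U) := by ring
  have h₅ : n * 1 ≤ n * (D * U) ^ 2 := Nat.mul_le_mul_left _ (by omega)
  have h₆ : D ^ 2 * (A + 71) * U ^ 2 * (n + m + 1) = A * (n + 1) * (D * U) ^ 2 +
    A * m * (D * U) ^ 2 + 71 * (n * (D * U) ^ 2) + 71 * (m * (D * U) ^ 2) +
      71 * (D * U) ^ 2 := by ring
  rw [h₆]
  rw [h₄] at h₁
  have h₈ : m * (18 * (R + 1)) = 18 * (m * (R + 1)) := by ring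
  have h₉ : n * (14 * (R + 1)) = 14 * (n * (R + 1)) := by ring
  rw [h₈, h₉]
  clear h₄ h₆ h₈ h₉
  -- The facts collected so far are linear in these products, which are now treated as unknowns.
  generalize l * (U * (A * ((n + 1) * (R + 2)) + 3 + 8)) = a₁ at *
  generalize A * (n + 1) * (D * U) ^ 2 = a₂ at *
  generalize A * m * (D * U) ^ 2 = a₃ at *
  generalize n * (D * U) ^ 2 = a₄ at *
  generalize m * (D * U) ^ 2 = a₅ at *
  generalize (D * U) ^ 2 = a₆ at *
  generalize n * (R + 1) = a₇ at *
  generalize m * (R + 1) = a₈ at *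
  omega

theorem product_map_map {A B C D : Type} (f : A → C) (g : B → D) (l₁ : List A) (l₂ : List B) :
    l₁.map f ×ˢ l₂.map g = (l₁ ×ˢ l₂).map fun p => (f p.1, g p.2) := by
  induction l₁ with
  | nil => rfl
  | cons a l ih => simp [List.product_cons, ih, Function.comp_def]

/-- All records of both lists form a single group, marked by their origin. Sorting by the shared
fields leaves together exactly the pairs that agree there, and merging them is paid for by the
output. The target list has to be empty since the result is pushed onto it. -/
theorem join_runs {l : List V} (hl : ∀ v, v ∈ l) (sh first : V → Bool) {j k i : ι}
    {w x : List (Sym V)} {L : ι → List (V → ℕ)} (hi : L i = [])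
    (hj : ∀ r ∈ L j, ∀ v, (Nat.bits (r v)).length ≤ w.length)
    (hk : ∀ r ∈ L k, ∀ v, (Nat.bits (r v)).length ≤ w.length) :
    ∃ L', L'.Perm (((L j ×ˢ L k).filter fun p => ∀ v, sh v = true → p.1 v = p.2 v).map
        fun p => merge first p.1 p.2) ∧
      Runs (join l sh first j k i) (base l w x L) (base l w x (update L i L'))
        (joinConst l * (w.length + 1) ^ 2 * ((L j).length + (L k).length + L'.length + 1)) := by
  set g : List ((V → ℕ) × Bool) :=
    (L j).map (fun r => (r, false)) ++ (L k).map (fun r => (r, true)) with hg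
  set R := l.length * (w.length + 1) with hRdef
  have hgb : ∀ y ∈ g, ∀ v, (Nat.bits (y.1 v)).length ≤ w.length := by
    intro y hy
    rw [hg, List.mem_append, List.mem_map, List.mem_map] at hy
    rcases hy with ⟨r, hr, rfl⟩ | ⟨r, hr, rfl⟩
    · exact hj r hr
    · exact hk r hr
  have hgl : g.length = (L j).length + (L k).length := by simp [hg]
  have hjl := length_encL_le (l := l) (L := L j) fun r hr => length_word_le (hj r hr)
  have hkl := length_encL_le (l := l) (L := L k) fun r hr => length_word_le (hk r hr)
  have h₁ := Runs.push .src .group (base l w x L)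
  have h₂ := load_runs k true (s := update (base l w x L) .src (.group :: base l w x L .src))
    (by simp [base])
  have h₃ := load_runs j false (s := update (update (base l w x L) .src (.group :: base l w x L .src))
    .src (((update (base l w x L) .src (.group :: base l w x L .src)) (.lst k)).map (setMark true) ++
      (update (base l w x L) .src (.group :: base l w x L .src)) .src)) (by simp [base])
  have h₃' := ((h₁.seq (h₂.seq h₃))).congr (s₂ := update (base l w x L) .src
    (encGs Prod.snd (fun x : (V → ℕ) × Bool => word (l ++ []) x.1) [g])) (by
      funext k'
      cases k' <;> simp [base, map_setMark, hg]) le_rfl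
  obtain ⟨gs, hgs, h₄⟩ := passFields_runs (tag := Prod.snd) sh (fun y : (V → ℕ) × Bool => y.1) l []
    (n := g.length) (R := R) (gs := [g]) (s := update (base l w x L) .src
    (encGs Prod.snd (fun x : (V → ℕ) × Bool => word (l ++ []) x.1) [g]))
    (by
      intro y hy
      rw [List.append_nil]
      exact length_word_le (hgb y (by simpa using hy)))
    (by simp) (by simp) (by
      intro y hy v
      simpa [base, bitsOf] using hgb y (by simpa using hy) v)
    (by simp [base]) (by simp) (by simp [base]) (by simp [base]) (by simp [base])
  have hgs' := hgs.length
  obtain ⟨L', hL', h₅⟩ := mergeGroups_runs (tag := Prod.snd) (fun y : (V → ℕ) × Bool => y.1) first l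
    (R := R) (gs := gs) (s := update (update (base l w x L) .src
    (encGs Prod.snd (fun x : (V → ℕ) × Bool => word (l ++ []) x.1) [g])) .src
    (encGs Prod.snd (fun x : (V → ℕ) × Bool => word ([] ++ l) x.1) gs))
    (by
      intro y hy
      exact length_word_le (hgb y (by simpa using hgs.flatten.mem_iff.1 hy)))
    (by simp [base]) (by simp [base]) (by simp [base]) (by simp [base]) (by simp [base])
    (by simp [base]) (by simp)
  have hL'R : ∀ r ∈ L', (word l r).length ≤ R := by
    intro r hr
    refine length_word_le fun v => ?_
    have := hL'.mem_iff.1 hr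
    rw [List.mem_map] at this
    obtain ⟨p, hp, rfl⟩ := this
    have hp' := (List.mem_filter.1 (hgs.pairs.mem_iff.1 hp)).1
    simp only [pairs, groupPairs, List.flatMap_cons, List.flatMap_nil, List.append_nil] at hp'
    rw [← p.eta, List.mem_product, List.mem_filter, List.mem_filter] at hp'
    unfold merge
    cases first v
    · exact hgb _ hp'.2.1 v
    · exact hgb _ hp'.1.1 v
  have hL'l := length_encL_le hL'R
  refine ⟨L', ?_, (h₃'.seq (h₄.seq (h₅.seq (moveAll_runs (by simp) _)))).congr ?_ ?_⟩
  · refine hL'.trans ((hgs.pairs.map _).trans (List.Perm.of_eq ?_))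
    have : pairs Prod.snd [g] = ((L j) ×ˢ (L k)).map fun p => ((p.1, false), (p.2, true)) := by
      simp only [pairs, groupPairs, List.flatMap_cons, List.flatMap_nil, List.append_nil, hg,
        List.filter_append, List.filter_map]
      simp [Function.comp_def, product_map_map]
    rw [this, List.filter_map, List.map_map]
    simp [hl, Function.comp_def]
  · funext k'
    cases k' <;> simp [base, Function.update_apply]
    rename_i i'
    by_cases h : i' = i
    · subst h; simp [hi, encL]
    · simp [h]
  · have hgf : gs.flatten.length = (L j).length + (L k).length := by
      rw [hgs.flatten.length_eq]; simpa using hgl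
    have hgs₁ : gs.length ≤ 1 + ((L j).length + (L k).length) := by
      simp only [List.length_singleton, List.flatten_cons, List.flatten_nil, List.append_nil,
        hgl] at hgs'
      omega
    rw [← hRdef] at hjl hkl
    have hj' : (base l w x L (.lst j)).length ≤ (L j).length * (R + 1) := hjl
    have hk' : (base l w x L (.lst k)).length ≤ (L k).length * (R + 1) := hkl
    have := joinTime_le (l := l.length) (A := 29 + 4 * (allSyms V).length)
      (n := (L j).length + (L k).length) (m := L'.length) (U := w.length + 1) (D := l.length + 2)
      (R := R) (by omega) (by rw [hRdef]; nlinarith) (by omega) (by omega)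
    refine le_trans ?_ (this.trans (le_of_eq ?_))
    · have hw : (base l w x L .wid).length = w.length := rfl
      have ho : base l w x L .out = [] := rfl
      simp [passTime, hgl, hgf, hw, ho]
      nlinarith
    · rw [joinConst]; ring

end ColoredSubgraph

end

noncomputable section

open Function (update)
open scoped Classical

namespace ColoredSubgraph

open StackProg

variable {V ι : Type}

/-! ### Extracting the edges between two colors -/

/-- An edge of the input: two vertices, given by their colors and numbers. -/
abbrev Edge (V : Type) : Type := (V × ℕ) × (V × ℕ)

/-- The code of a vertex. -/
def vertexSyms (p : V × ℕ) : List (Sym V) := .inp (some (.inl p.1)) :: bitsOf p.2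

/-- The code of a list of edges. -/
def edgeSyms (es : List (Edge V)) : List (Sym V) :=
  es.flatMap fun e => vertexSyms e.1 ++ vertexSyms e.2

/-- The record with the value `a` at `u` and the value `b` at `v`. -/
def edgeRecord (u : V) (a : ℕ) (v : V) (b : ℕ) (x : V) : ℕ :=
  if x = u then a else if x = v then b else 0

/-- The record of an edge, if it has the colors `u` and `v`. -/
def edgeToRecord (u v : V) (e : Edge V) : Option (V → ℕ) :=
  if e.1.1 = u ∧ e.2.1 = v then some (edgeRecord u e.1.2 v e.2.2)
  else if e.1.1 = v ∧ e.2.1 = u then some (edgeRecord v e.1.2 u e.2.2)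
  else none

def Sym.isBit : Sym V → Bool
  | .inp (some (.inr _)) => true
  | _ => false

theorem isBit_bitsOf (n : ℕ) : ∀ a ∈ bitsOf (V := V) n, a.isBit = true := by
  rw [bitsOf, List.forall_mem_map]
  exact fun _ _ => rfl

/-- Write fields to the list `i`, with the contents of `f1` for `u` and of `f2` for `v`. -/
def emitFields (u v : V) (i : ι) : List V → Prog (Reg V ι) (Sym V)
  | [] => .skip
  | x :: l => .seq (emitFields u v i l) <| .seq (.push (.lst i) .field) <|
      if x = u then moveAll .f1 (.lst i) else if x = v then moveAll .f2 (.lst i) else .skip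

/-- Fields are pushed from the last to the first, and the digits, stored in reverse, are put right
by the move. Fields other than `u` and `v` get the value `0`, whose digit word is empty. Using `f1`
or `f2` empties it, so its contents matter only while its color is still in `l`. -/
theorem emitFields_runs {u v : V} (huv : u ≠ v) (i : ι) {l : List V} (hl : l.Nodup) {s : St V ι}
    {a b : ℕ} (h₁ : u ∈ l → s .f1 = (bitsOf a).reverse) (h₂ : v ∈ l → s .f2 = (bitsOf b).reverse) :
    Runs (emitFields u v i l) s
      (update (update (update s .f1 (if u ∈ l then [] else s .f1))
        .f2 (if v ∈ l then [] else s .f2))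
        (.lst i) (word l (edgeRecord u a v b) ++ s (.lst i)))
      (3 * l.length + 1 + 4 * (if u ∈ l then (s .f1).length else 0) +
        4 * (if v ∈ l then (s .f2).length else 0)) := by
  induction l generalizing s with
  | nil =>
    refine (Runs.skip s).congr ?_ (by simp)
    funext k
    cases k <;> simp [Function.update_apply]
    rintro rfl
    rfl
  | cons x l ih =>
    rw [List.nodup_cons] at hl
    have h := ih hl.2 (s := s) (fun hu => h₁ (by simp [hu])) (fun hv => h₂ (by simp [hv]))
    by_cases hu : x = u
    · subst hu
      refine (h.seq ((Runs.push _ _ _).seq (.congr (t₂ := 4 * (s .f1).length + 1)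
        (by rw [if_pos rfl]; exact moveAll_runs (by simp) _) rfl (by simp [hl.1])))).congr ?_ ?_
      · funext k
        cases k <;> simp [hl.1, huv.symm, Function.update_apply]
        split <;> simp [h₁, edgeRecord]
      · simp [hl.1, huv.symm]; split <;> omega
    · by_cases hv : x = v
      · subst hv
        refine (h.seq ((Runs.push _ _ _).seq (.congr (t₂ := 4 * (s .f2).length + 1)
          (by rw [if_neg hu, if_pos rfl]; exact moveAll_runs (by simp) _) rfl
            (by simp [hl.1])))).congr ?_ ?_
        · funext k
          cases k <;> simp [hl.1, huv, Function.update_apply]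
          split <;> simp [h₂, edgeRecord, huv.symm]
        · simp [hl.1, huv]; split <;> omega
      · refine (h.seq ((Runs.push _ _ _).seq (t₂ := 1)
          (by rw [if_neg hu, if_neg hv]; exact Runs.skip _))).congr ?_ ?_
        · funext k
          cases k <;> simp [Ne.symm hu, Ne.symm hv, Function.update_apply]
          split <;> simp [edgeRecord, hu, hv, bitsOf]
        · simp [Ne.symm hu, Ne.symm hv]; omega

def emit (l : List V) (u v : V) (i : ι) : Prog (Reg V ι) (Sym V) :=
  .seq (.push (.lst i) (.mark false)) (emitFields u v i l)

theorem emit_runs {l : List V} (hl : l.Nodup) (hm : ∀ x, x ∈ l) {u v : V} (huv : u ≠ v) (i : ι)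
    {s : St V ι} {a b : ℕ} (h₁ : s .f1 = (bitsOf a).reverse) (h₂ : s .f2 = (bitsOf b).reverse) :
    Runs (emit l u v i) s
      (update (update (update s .f1 []) .f2 [])
        (.lst i) (encL l [edgeRecord u a v b] ++ s (.lst i)))
      (3 * l.length + 2 + 4 * ((bitsOf (V := V) a).length + (bitsOf (V := V) b).length)) := by
  refine ((Runs.push _ _ s).seq (emitFields_runs huv i hl (a := a) (b := b) ?_ ?_)).congr ?_ ?_
  · simp [h₁]
  · simp [h₂]
  · funext k
    cases k <;> simp [hm, encL, Function.update_apply]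
    split <;> simp
  · simp [h₁, h₂, hm]; omega

/-- Read a vertex, and write the digits of its number to `k`. -/
def readVertex (k : Reg V ι) : Prog (Reg V ι) (Sym V) :=
  .seq (moveOne .inp .trail) (copyWhile Sym.isBit id .inp .trail k)

theorem readVertex_runs {k : Reg V ι} (h₁ : k ≠ .inp) (h₂ : k ≠ .trail) {s : St V ι} {p : V × ℕ}
    {r : List (Sym V)} (h : s .inp = vertexSyms p ++ r) (hr : r.head?.any Sym.isBit = false) :
    Runs (readVertex k) s (update (update (update s .inp r)
      .trail ((vertexSyms p).reverse ++ s .trail)) k ((bitsOf p.2).reverse ++ s k))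
      (5 * (bitsOf (V := V) p.2).length + 4) := by
  refine ((moveOne_runs (k := Reg.inp) (k' := .trail) (by simp) h).seq
    (copyWhile_runs (l := bitsOf p.2) (r := r) (by simp) h₁.symm h₂.symm (by simp)
      (isBit_bitsOf p.2) hr)).congr ?_ (by omega)
  funext j
  by_cases a : j = k
  · subst a; simp [h₁, h₂]
  · cases j <;> simp_all [vertexSyms]

/-- Read an edge, and write it to the list `i` if it has the colors `u` and `v`. -/
def scanEdge (l : List V) (u v : V) (i : ι) : Prog (Reg V ι) (Sym V) :=
  .case .inp fun x => match x with
    | some (.inp (some (.inl x))) => .seq (readVertex .f1) <| .case .inp fun y => match y with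
        | some (.inp (some (.inl y))) => .seq (readVertex .f2) <|
          .seq (if x = u ∧ y = v then emit l u v i else if x = v ∧ y = u then emit l v u i
            else .skip) (.seq (dropAll .f1) (dropAll .f2))
        | _ => .skip
    | _ => .skip

theorem head_edgeSyms (es : List (Edge V)) : (edgeSyms es).head?.any Sym.isBit = false := by
  cases es <;> simp [edgeSyms, vertexSyms, Sym.isBit]

theorem scanEdge_runs {l : List V} (hl : l.Nodup) (hm : ∀ x, x ∈ l) {u v : V} (huv : u ≠ v) (i : ι)
    {s : St V ι} {e : Edge V} {es : List (Edge V)} (h : s .inp = edgeSyms (e :: es))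
    (h₁ : s .f1 = []) (h₂ : s .f2 = []) :
    Runs (scanEdge l u v i) s
      (update (update (update s .inp (edgeSyms es))
        .trail ((vertexSyms e.1 ++ vertexSyms e.2).reverse ++ s .trail))
        (.lst i) (encL l (edgeToRecord u v e).toList ++ s (.lst i)))
      (3 * l.length + 20 +
        11 * ((bitsOf (V := V) e.1.2).length + (bitsOf (V := V) e.2.2).length)) := by
  obtain ⟨⟨x, a⟩, y, b⟩ := e
  have h' : s .inp = vertexSyms (x, a) ++ (vertexSyms (y, b) ++ edgeSyms es) := by
    simp [h, edgeSyms]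
  have e₁ := readVertex_runs (k := Reg.f1) (by simp) (by simp) h' (by simp [vertexSyms, Sym.isBit])
  have e₂ := readVertex_runs (k := Reg.f2) (p := (y, b)) (r := edgeSyms es) (by simp) (by simp)
    (s := update (update (update s .inp (vertexSyms (y, b) ++ edgeSyms es))
      .trail ((vertexSyms (x, a)).reverse ++ s .trail)) .f1 ((bitsOf a).reverse ++ s .f1))
    (by simp) (head_edgeSyms es)
  set s₁ : St V ι := update (update (update (update s .inp (edgeSyms es))
        .trail ((vertexSyms (x, a) ++ vertexSyms (y, b)).reverse ++ s .trail))
        .f1 (bitsOf a).reverse) .f2 (bitsOf b).reverse with hs₁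
  have e₂' := e₂.congr (s₂ := s₁) (by
    funext k; cases k <;> simp [hs₁, h₁, h₂]) le_rfl
  have e₅ : Runs (if x = u ∧ y = v then emit l u v i else if x = v ∧ y = u then emit l v u i
      else .skip) s₁ (update (if (edgeToRecord u v ((x, a), (y, b))).isSome = true then
        update (update s₁ .f1 []) .f2 [] else s₁)
        (.lst i) (encL l (edgeToRecord u v ((x, a), (y, b))).toList ++ s (.lst i)))
      (3 * l.length + 2 + 4 * ((bitsOf (V := V) a).length + (bitsOf (V := V) b).length)) := by
    by_cases c₁ : x = u ∧ y = v
    · rw [if_pos c₁]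
      refine (emit_runs hl hm huv i (a := a) (b := b) (by simp [hs₁]) (by simp [hs₁])).congr ?_ le_rfl
      simp [edgeToRecord, c₁, hs₁]
    · by_cases c₂ : x = v ∧ y = u
      · rw [if_neg c₁, if_pos c₂]
        refine (emit_runs hl hm huv.symm i (a := a) (b := b) (by simp [hs₁])
          (by simp [hs₁])).congr ?_ le_rfl
        simp [edgeToRecord, c₂, hs₁, huv, huv.symm]
      · rw [if_neg c₁, if_neg c₂]
        refine (Runs.skip _).congr ?_ (by omega)
        simp only [edgeToRecord, c₁, c₂, if_false]
        simp [encL, hs₁]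
  have e₆ : ∀ s₂ : St V ι, Runs (.seq (dropAll .f1) (dropAll .f2)) s₂
      (update (update s₂ .f1 []) .f2 []) (2 * (s₂ .f1).length + 2 * (s₂ .f2).length + 2) := by
    intro s₂
    refine ((dropAll_runs _ _).seq (dropAll_runs _ _)).congr rfl ?_
    simp; omega
  refine (Runs.case (x := some (.inp (some (.inl x)))) (by simp [h', vertexSyms]) (e₁.seq
    (Runs.case (x := some (.inp (some (.inl y)))) (by simp [vertexSyms])
      (e₂'.seq (e₅.seq (e₆ _)))))).congr ?_ ?_
  · funext k
    cases k <;> simp [hs₁, Function.update_apply, h₁, h₂]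
    all_goals split <;> first | rfl | (split <;> simp) | simp
  · have hf : ((if (edgeToRecord u v ((x, a), (y, b))).isSome = true then
        update (update s₁ .f1 []) .f2 [] else s₁) .f1).length ≤ (bitsOf (V := V) a).length := by
      split <;> simp [hs₁]
    have hf' : ((if (edgeToRecord u v ((x, a), (y, b))).isSome = true then
        update (update s₁ .f1 []) .f2 [] else s₁) .f2).length ≤ (bitsOf (V := V) b).length := by
      split <;> simp [hs₁]
    rw [Function.update_of_ne (by simp), Function.update_of_ne (by simp)]
    simp only
    omega

theorem scanEdges_runs {l : List V} (hl : l.Nodup) (hm : ∀ x, x ∈ l) {u v : V} (huv : u ≠ v) (i : ι)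
    {W : ℕ} {s : St V ι} {es : List (Edge V)} (h : s .inp = edgeSyms es)
    (hW : ∀ e ∈ es, (Nat.bits e.1.2).length ≤ W ∧ (Nat.bits e.2.2).length ≤ W)
    (h₁ : s .f1 = []) (h₂ : s .f2 = []) :
    Runs (.loop .inp Option.isSome (scanEdge l u v i)) s
      (update (update (update s .inp []) .trail ((edgeSyms es).reverse ++ s .trail))
        (.lst i) (encL l (es.filterMap (edgeToRecord u v)).reverse ++ s (.lst i)))
      (es.length * ((3 * l.length + 22) * (W + 1)) + 1) := by
  induction es generalizing s with
  | nil =>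
    refine (Runs.loop_done (by simp [h, edgeSyms])).congr ?_ (by simp)
    funext k
    cases k <;> simp_all [edgeSyms, encL, Function.update_apply]
  | cons e es ih =>
    have he := hW e (by simp)
    refine (Runs.loop_step (by simp [h, edgeSyms, vertexSyms]) (scanEdge_runs hl hm huv i h h₁ h₂)
      (ih ?_ (fun e he => hW e (by simp [he])) ?_ ?_)).congr ?_ ?_
    · simp
    · simp [h₁]
    · simp [h₂]
    · funext k
      cases k <;> simp [edgeSyms, Function.update_apply]
      split
      · cases hr : edgeToRecord u v e <;> simp [hr, encL]
      · rfl
    · simp only [List.length_cons, bitsOf, List.length_map]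
      nlinarith

/-- Write all edges of the colors `u` and `v` to the list `i`. -/
def scan (l : List V) (u v : V) (i : ι) : Prog (Reg V ι) (Sym V) :=
  .seq (.loop .inp Option.isSome (scanEdge l u v i)) (moveAll .trail .inp)

theorem length_edgeSyms_le {W : ℕ} {es : List (Edge V)}
    (hW : ∀ e ∈ es, (Nat.bits e.1.2).length ≤ W ∧ (Nat.bits e.2.2).length ≤ W) :
    (edgeSyms es).length ≤ es.length * (2 * (W + 1)) := by
  induction es with
  | nil => simp [edgeSyms]
  | cons e es ih =>
    have h₁ := hW e (by simp)
    have h₂ := ih fun e he => hW e (by simp [he])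
    simp only [edgeSyms, vertexSyms, bitsOf] at h₂
    simp only [edgeSyms, vertexSyms, bitsOf, List.flatMap_cons, List.length_append,
      List.length_cons, List.length_map] at h₂ ⊢
    linarith

/-- The symbols that were read pile up on `trail`, from which the input is restored for later scans.
-/
theorem scan_runs {l : List V} (hl : l.Nodup) (hm : ∀ x, x ∈ l) {u v : V} (huv : u ≠ v) {i : ι}
    {w : List (Sym V)} {L : ι → List (V → ℕ)} {es : List (Edge V)} (hi : L i = [])
    (hW : ∀ e ∈ es, (Nat.bits e.1.2).length ≤ w.length ∧ (Nat.bits e.2.2).length ≤ w.length) :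
    Runs (scan l u v i) (base l w (edgeSyms es) L)
      (base l w (edgeSyms es) (update L i (es.filterMap (edgeToRecord u v)).reverse))
      ((3 * l.length + 30) * (w.length + 1) * (es.length + 1)) := by
  refine ((scanEdges_runs hl hm huv i rfl hW rfl rfl).seq
    (moveAll_runs (by simp) _)).congr ?_ ?_
  · funext k
    cases k <;> simp [base, Function.update_apply]
    rename_i i'
    by_cases h : i' = i
    · subst h; simp [hi, encL]
    · simp [h]
  · have := length_edgeSyms_le hW
    simp [base]
    nlinarith

end ColoredSubgraph

end

noncomputable section

open Function (update)
open scoped Classical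

namespace ColoredSubgraph

open StackProg

variable {V : Type} {G : SimpleGraph V}

/-! ### Copies of a subgraph in the input -/

/-- `r` is a copy of `H` in the graph with edges `es`, where `r u` is the number of the vertex of
color `u`. -/
structure IsCopy (H : G.Subgraph) (es : List (Edge V)) (W : ℕ) (r : V → ℕ) : Prop where
  eq_zero : ∀ v, v ∉ H.verts → r v = 0
  edge : ∀ u v, H.Adj u v → s((u, r u), (v, r v)) ∈ es.map fun e => s(e.1, e.2)
  bits : ∀ v, (Nat.bits (r v)).length ≤ W

/-- Since `u ≠ v`, the colors tell the endpoints apart, so the record does not depend on the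
orientation in which the input lists the edge. -/
theorem edgeToRecord_eq_some {u v : V} (huv : u ≠ v) {e : Edge V} {r : V → ℕ} :
    edgeToRecord u v e = some r ↔
      (∀ x, x ≠ u → x ≠ v → r x = 0) ∧ s(e.1, e.2) = s((u, r u), (v, r v)) := by
  obtain ⟨⟨x, a⟩, y, b⟩ := e
  unfold edgeToRecord
  constructor
  · split
    · next h =>
      rintro ⟨⟩
      simp only at h
      obtain ⟨rfl, rfl⟩ := h
      simp +contextual [edgeRecord, huv.symm]
    · split
      · next h =>
        rintro ⟨⟩
        simp only at h
        obtain ⟨rfl, rfl⟩ := h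
        simp +contextual [edgeRecord, huv]
      · simp
  · rintro ⟨h, he⟩
    rw [Sym2.eq_iff] at he
    rcases he with he | he
    · simp only [Prod.mk.injEq] at he
      obtain ⟨⟨rfl, rfl⟩, rfl, rfl⟩ := he
      simp only [and_self, if_true, Option.some.injEq]
      funext z
      unfold edgeRecord
      split
      · next hz => rw [hz]
      · split
        · next hz => rw [hz]
        · rw [h] <;> assumption
    · simp only [Prod.mk.injEq] at he
      obtain ⟨⟨rfl, rfl⟩, rfl, rfl⟩ := he
      simp only [and_self, if_true, huv, huv.symm, if_false, Option.some.injEq]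
      funext z
      unfold edgeRecord
      split
      · next hz => rw [hz]
      · split
        · next hz => rw [hz]
        · rw [h] <;> assumption

theorem isCopy_subgraphOfAdj {u v : V} (h : G.Adj u v) {es : List (Edge V)} {W : ℕ}
    (hW : ∀ e ∈ es, (Nat.bits e.1.2).length ≤ W ∧ (Nat.bits e.2.2).length ≤ W) {r : V → ℕ} :
    IsCopy (G.subgraphOfAdj h) es W r ↔ r ∈ es.filterMap (edgeToRecord u v) := by
  simp only [List.mem_filterMap, edgeToRecord_eq_some h.ne]
  constructor
  · intro hc
    have := hc.edge u v (by simp)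
    rw [List.mem_map] at this
    obtain ⟨e, he, hs⟩ := this
    refine ⟨e, he, fun x hu hv => hc.eq_zero x (by simp [hu, hv]), hs⟩
  · rintro ⟨e, he, h0, hs⟩
    have hmem : s((u, r u), (v, r v)) ∈ es.map fun e => s(e.1, e.2) :=
      List.mem_map.2 ⟨e, he, hs⟩
    refine ⟨fun x hx => h0 x (fun hu => hx (by simp [hu])) (fun hv => hx (by simp [hv])), ?_, ?_⟩
    · intro a b hab
      rw [SimpleGraph.subgraphOfAdj_adj, Sym2.eq_iff] at hab
      rcases hab with ⟨rfl, rfl⟩ | ⟨rfl, rfl⟩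
      · exact hmem
      · rw [Sym2.eq_swap]; exact hmem
    · have h₁ := hW e he
      rw [Sym2.eq_iff] at hs
      have h₂ : (Nat.bits (r u)).length ≤ W ∧ (Nat.bits (r v)).length ≤ W := by
        rcases hs with ⟨hs, hs'⟩ | ⟨hs, hs'⟩
        · rw [hs, hs'] at h₁; exact h₁
        · rw [hs, hs'] at h₁; exact h₁.symm
      intro x
      by_cases hu : x = u
      · rw [hu]; exact h₂.1
      · by_cases hv : x = v
        · rw [hv]; exact h₂.2
        · rw [h0 x hu hv]; simp

/-- A record determines the unordered edge it comes from, so distinct edges give distinct records.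
-/
theorem nodup_filterMap_edgeToRecord {u v : V} (huv : u ≠ v) {es : List (Edge V)}
    (hes : (es.map fun e => s(e.1, e.2)).Nodup) : (es.filterMap (edgeToRecord u v)).Nodup := by
  rw [List.Nodup, List.pairwise_map] at hes
  rw [List.Nodup, List.pairwise_filterMap]
  refine hes.imp ?_
  rintro e e' hne r hr r' hr' rfl
  rw [edgeToRecord_eq_some huv] at hr hr'
  exact hne (hr.2.trans hr'.2.symm)

/-- A copy of a union restricts to copies of both parts that agree on the common vertices.
Conversely, agreeing copies glue, because every edge of the union lies in one of the parts. Records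
vanish outside their subgraph, so the merged record determines the pair, and no repetition arises.
-/
theorem perm_join {H₁ H₂ : G.Subgraph} {es : List (Edge V)} {W : ℕ} {L₁ L₂ L : List (V → ℕ)}
    (h₁ : L₁.Nodup) (h₂ : L₂.Nodup) (m₁ : ∀ r, r ∈ L₁ ↔ IsCopy H₁ es W r)
    (m₂ : ∀ r, r ∈ L₂ ↔ IsCopy H₂ es W r)
    (hL : L.Perm (((L₁ ×ˢ L₂).filter fun p =>
      ∀ v, decide (v ∈ H₁.verts ∧ v ∈ H₂.verts) = true → p.1 v = p.2 v).map
        fun p => merge (fun v => decide (v ∈ H₁.verts)) p.1 p.2)) :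
    L.Nodup ∧ ∀ r, r ∈ L ↔ IsCopy (H₁ ⊔ H₂) es W r := by
  have hm : ∀ p : (V → ℕ) × (V → ℕ), p ∈ ((L₁ ×ˢ L₂).filter fun p =>
      ∀ v, decide (v ∈ H₁.verts ∧ v ∈ H₂.verts) = true → p.1 v = p.2 v) ↔
      IsCopy H₁ es W p.1 ∧ IsCopy H₂ es W p.2 ∧
        ∀ v, v ∈ H₁.verts → v ∈ H₂.verts → p.1 v = p.2 v := by
    rintro ⟨r₁, r₂⟩
    rw [List.mem_filter, List.mem_product, m₁, m₂]
    simp [and_assoc]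
  have hv₁ : ∀ p : (V → ℕ) × (V → ℕ), IsCopy H₁ es W p.1 → ∀ v,
      p.1 v = if v ∈ H₁.verts then merge (fun v => decide (v ∈ H₁.verts)) p.1 p.2 v else 0 := by
    intro p hp v
    split
    · next h => simp [merge, h]
    · next h => exact hp.eq_zero v h
  have hv₂ : ∀ p : (V → ℕ) × (V → ℕ), IsCopy H₂ es W p.2 →
      (∀ v, v ∈ H₁.verts → v ∈ H₂.verts → p.1 v = p.2 v) → ∀ v,
      p.2 v = if v ∈ H₂.verts then merge (fun v => decide (v ∈ H₁.verts)) p.1 p.2 v else 0 := by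
    intro p hp hag v
    split
    · next h =>
      by_cases h' : v ∈ H₁.verts
      · simp [merge, h', hag v h' h]
      · simp [merge, h']
    · next h => exact hp.eq_zero v h
  constructor
  · rw [hL.nodup_iff]
    refine List.Nodup.map_on ?_ ((h₁.product h₂).filter _)
    intro p hp q hq hpq
    rw [hm] at hp hq
    refine Prod.ext (funext fun v => ?_) (funext fun v => ?_)
    · rw [hv₁ p hp.1, hv₁ q hq.1, hpq]
    · rw [hv₂ p hp.2.1 hp.2.2, hv₂ q hq.2.1 hq.2.2, hpq]
  · intro r
    rw [hL.mem_iff, List.mem_map]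
    constructor
    · rintro ⟨p, hp, rfl⟩
      rw [hm] at hp
      obtain ⟨c₁, c₂, hag⟩ := hp
      set r := merge (fun v => decide (v ∈ H₁.verts)) p.1 p.2
      have e₁ : ∀ v ∈ H₁.verts, r v = p.1 v := fun v hv => by rw [hv₁ p c₁, if_pos hv]
      have e₂ : ∀ v ∈ H₂.verts, r v = p.2 v := fun v hv => by rw [hv₂ p c₂ hag, if_pos hv]
      refine ⟨?_, ?_, ?_⟩
      · intro v hv
        rw [SimpleGraph.Subgraph.verts_sup, Set.mem_union, not_or] at hv
        have : r v = p.2 v := by simp [r, merge, hv.1]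
        rw [this, c₂.eq_zero v hv.2]
      · intro u v huv
        rw [SimpleGraph.Subgraph.sup_adj] at huv
        rcases huv with huv | huv
        · rw [e₁ u huv.fst_mem, e₁ v huv.snd_mem]
          exact c₁.edge u v huv
        · rw [e₂ u huv.fst_mem, e₂ v huv.snd_mem]
          exact c₂.edge u v huv
      · intro v
        by_cases h : v ∈ H₁.verts
        · rw [e₁ v h]; exact c₁.bits v
        · have : r v = p.2 v := by simp [r, merge, h]
          rw [this]; exact c₂.bits v
    · intro c
      -- The preimage of `r` consists of its restrictions to the two vertex sets, extended by zero.
      refine ⟨(fun v => if v ∈ H₁.verts then r v else 0, fun v => if v ∈ H₂.verts then r v else 0),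
        (hm _).2 ⟨⟨?_, ?_, ?_⟩, ⟨?_, ?_, ?_⟩, ?_⟩, ?_⟩
      · intro v hv; simp [hv]
      · intro u v huv
        simp only [huv.fst_mem, huv.snd_mem, if_true]
        exact c.edge u v (.inl huv)
      · intro v
        simp only
        split
        · exact c.bits v
        · simp
      · intro v hv; simp [hv]
      · intro u v huv
        simp only [huv.fst_mem, huv.snd_mem, if_true]
        exact c.edge u v (.inr huv)
      · intro v
        simp only
        split
        · exact c.bits v
        · simp
      · intro v h h'; simp [h, h']
      · funext v
        by_cases h : v ∈ H₁.verts
        · simp [merge, h]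
        · by_cases h' : v ∈ H₂.verts
          · simp [merge, h, h']
          · simp [merge, h, h', c.eq_zero v (by simp [h, h'])]

/-! ### The program of a union sequence -/

/-- `S` continues the union sequence `prev` (in which the last term comes first). -/
def Continues : List G.Subgraph → List G.Subgraph → Prop
  | _, [] => True
  | prev, H :: S => H ∉ prev ∧ ((∃ (u v : V) (h : G.Adj u v), H = G.subgraphOfAdj h) ∨
      ∃ H₁ ∈ prev, ∃ H₂ ∈ prev, H = H₁ ⊔ H₂) ∧ Continues (H :: prev) S

theorem IsUnionSequence.continues {S : List G.Subgraph} (hS : IsUnionSequence G S) :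
    Continues [] S := by
  have key : ∀ post pre : List G.Subgraph, S = pre ++ post → Continues pre.reverse post := by
    intro post
    induction post with
    | nil => intro pre _; trivial
    | cons H post ih =>
      intro pre hpre
      have hn := hS.1
      rw [hpre, List.nodup_append] at hn
      refine ⟨fun hH => hn.2.2 H (List.mem_reverse.1 hH) H (by simp) rfl, ?_, ?_⟩
      · have hlt : pre.length < S.length := by simp [hpre]
        have hget : S[pre.length] = H := by simp [hpre]
        rcases hS.2.2 pre.length hlt with ⟨u, v, h, hH⟩ | ⟨j, k, hj, hk, hH⟩
        · exact .inl ⟨u, v, h, hget ▸ hH⟩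
        · refine .inr ⟨S[j], ?_, S[k], ?_, hget ▸ hH⟩
          · simp only [hpre, List.getElem_append_left hj, List.mem_reverse, List.getElem_mem]
          · simp only [hpre, List.getElem_append_left hk, List.mem_reverse, List.getElem_mem]
      · have := ih (pre ++ [H]) (by simp [hpre])
        simpa using this
  exact key S [] rfl

/-- The lists `L` of the terms of `prev` are correct and the others are empty. -/
structure Correct (es : List (Edge V)) (W : ℕ) (prev : List G.Subgraph)
    (L : G.Subgraph → List (V → ℕ)) : Prop where
  nodup : ∀ H ∈ prev, (L H).Nodup
  mem : ∀ H ∈ prev, ∀ r, r ∈ L H ↔ IsCopy H es W r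
  eq_nil : ∀ H, H ∉ prev → L H = []

theorem Correct.cons {es : List (Edge V)} {W : ℕ} {prev : List G.Subgraph}
    {L : G.Subgraph → List (V → ℕ)} (hL : Correct es W prev L) {H : G.Subgraph}
    {L' : List (V → ℕ)} (hn : L'.Nodup) (hm : ∀ r, r ∈ L' ↔ IsCopy H es W r) :
    Correct es W (H :: prev) (update L H L') where
  nodup K hK := by
    by_cases h : K = H
    · subst h; simpa using hn
    · rw [Function.update_of_ne h]; exact hL.nodup K (by simpa [h] using hK)
  mem K hK := by
    by_cases h : K = H
    · subst h; simpa using hm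
    · rw [Function.update_of_ne h]; exact hL.mem K (by simpa [h] using hK)
  eq_nil K hK := by
    rw [List.mem_cons, not_or] at hK
    rw [Function.update_of_ne hK.1]; exact hL.eq_nil K hK.2

/-- Empty the tapes in `ks`. -/
def clear {ι : Type} (ks : List (Reg V ι)) : Prog (Reg V ι) (Sym V) := seqList (ks.map dropAll)

theorem clear_runs {ι : Type} {ks : List (Reg V ι)} {M : ℕ} {s : St V ι}
    (hM : ∀ k, (s k).length ≤ M) :
    Runs (clear ks) s (fun k => if k ∈ ks then [] else s k) (ks.length * (2 * M + 1) + 1) := by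
  induction ks generalizing s with
  | nil => exact (Runs.skip s).congr (by simp) (by simp)
  | cons k ks ih =>
    refine ((dropAll_runs k s).seq (ih (s := update s k []) ?_)).congr ?_ ?_
    · intro j
      by_cases h : j = k
      · subst h; simp
      · rw [Function.update_of_ne h]; exact hM j
    · funext j
      by_cases h : j = k <;> simp [h]
    · have := hM k
      rw [List.length_cons]
      linarith

variable [Fintype V]

/-- The program that computes the list of the copies of `H`. -/
def stepProg (l : List V) (prev : List G.Subgraph) (H : G.Subgraph) :
    Prog (Reg V G.Subgraph) (Sym V) :=
  if h : ∃ (u v : V) (h : G.Adj u v), H = G.subgraphOfAdj h then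
    scan l h.choose h.choose_spec.choose H
  else if h : ∃ p : G.Subgraph × G.Subgraph, p.1 ∈ prev ∧ p.2 ∈ prev ∧ H = p.1 ⊔ p.2 then
    join l (fun v => decide (v ∈ h.choose.1.verts ∧ v ∈ h.choose.2.verts))
      (fun v => decide (v ∈ h.choose.1.verts)) h.choose.1 h.choose.2 H
  else .skip

/-- The program that computes the lists of the copies of the terms of a union sequence. -/
def seqProg (l : List V) : List G.Subgraph → List G.Subgraph → Prog (Reg V G.Subgraph) (Sym V)
  | _, [] => .skip
  | prev, H :: S => .seq (stepProg l prev H) (seqProg l (H :: prev) S)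

/-- A constant for the time of a step. -/
def stepConst (l : List V) : ℕ := joinConst l + 3 * l.length + 30

/-- No subgraph of the list `S` has more than `N` copies. -/
def CopiesLE (S : List G.Subgraph) (es : List (Edge V)) (W N : ℕ) : Prop :=
  ∀ H ∈ S, ∀ L : List (V → ℕ), L.Nodup → (∀ r ∈ L, IsCopy H es W r) → L.length ≤ N

theorem stepProg_runs {l : List V} (hl : l.Nodup) (hm : ∀ x, x ∈ l) {w : List (Sym V)}
    {es : List (Edge V)} (hes : (es.map fun e => s(e.1, e.2)).Nodup)
    (hW : ∀ e ∈ es, (Nat.bits e.1.2).length ≤ w.length ∧ (Nat.bits e.2.2).length ≤ w.length)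
    {N : ℕ} (hN : es.length ≤ N) {prev : List G.Subgraph} {H : G.Subgraph}
    (hc : CopiesLE (H :: prev) es w.length N)
    (hH : (∃ (u v : V) (h : G.Adj u v), H = G.subgraphOfAdj h) ∨
      ∃ H₁ ∈ prev, ∃ H₂ ∈ prev, H = H₁ ⊔ H₂) (hH' : H ∉ prev)
    {L : G.Subgraph → List (V → ℕ)} (hL : Correct es w.length prev L) :
    ∃ L', Correct es w.length (H :: prev) L' ∧
      Runs (stepProg l prev H) (base l w (edgeSyms es) L) (base l w (edgeSyms es) L')
        (stepConst l * (w.length + 1) ^ 2 * (3 * N + 1)) := by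
  by_cases h : ∃ (u v : V) (h : G.Adj u v), H = G.subgraphOfAdj h
  · have e : stepProg l prev H = scan l h.choose h.choose_spec.choose H := by
      rw [stepProg, dif_pos h]
    obtain ⟨hadj, hHe⟩ := h.choose_spec.choose_spec
    have hne := hadj.ne
    rw [e]
    refine ⟨_, hL.cons (L' := (es.filterMap (edgeToRecord h.choose
      h.choose_spec.choose)).reverse) ?_ ?_,
      (scan_runs hl hm hne (hL.eq_nil H hH') hW).congr rfl ?_⟩
    · exact List.nodup_reverse.2 (nodup_filterMap_edgeToRecord hne hes)
    · intro r
      rw [List.mem_reverse, ← isCopy_subgraphOfAdj hadj hW, ← hHe]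
    · unfold stepConst
      have h₁ : w.length + 1 ≤ (w.length + 1) ^ 2 := Nat.le_self_pow two_ne_zero _
      gcongr ?_ * ?_ * ?_ <;> omega
  · have h' : ∃ p : G.Subgraph × G.Subgraph, p.1 ∈ prev ∧ p.2 ∈ prev ∧ H = p.1 ⊔ p.2 := by
      obtain ⟨H₁, m₁, H₂, m₂, he⟩ := hH.resolve_left h
      exact ⟨(H₁, H₂), m₁, m₂, he⟩
    have e : stepProg l prev H = join l
      (fun v => decide (v ∈ h'.choose.1.verts ∧ v ∈ h'.choose.2.verts))
      (fun v => decide (v ∈ h'.choose.1.verts)) h'.choose.1 h'.choose.2 H := by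
      rw [stepProg, dif_neg h, dif_pos h']
    obtain ⟨m₁, m₂, he⟩ := h'.choose_spec
    rw [e]
    obtain ⟨L', hL', hr⟩ := join_runs (L := L) (w := w) (x := edgeSyms es) hm
      (fun v => decide (v ∈ h'.choose.1.verts ∧ v ∈ h'.choose.2.verts))
      (fun v => decide (v ∈ h'.choose.1.verts)) (j := h'.choose.1) (k := h'.choose.2)
      (hL.eq_nil H hH') (fun r hr => ((hL.mem _ m₁ r).1 hr).bits)
      (fun r hr => ((hL.mem _ m₂ r).1 hr).bits)
    obtain ⟨hn, hmem⟩ := perm_join (hL.nodup _ m₁) (hL.nodup _ m₂) (hL.mem _ m₁) (hL.mem _ m₂)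
      (L := L') (by convert hL')
    rw [← he] at hmem
    refine ⟨_, hL.cons hn hmem, hr.congr rfl ?_⟩
    have c₁ := hc _ (List.mem_cons_of_mem _ m₁) _ (hL.nodup _ m₁) fun r hr => (hL.mem _ m₁ r).1 hr
    have c₂ := hc _ (List.mem_cons_of_mem _ m₂) _ (hL.nodup _ m₂) fun r hr => (hL.mem _ m₂ r).1 hr
    have c₃ := hc H (by simp) L' hn fun r hr => (hmem r).1 hr
    unfold stepConst
    gcongr ?_ * _ * ?_ <;> omega

theorem seqProg_runs {l : List V} (hl : l.Nodup) (hm : ∀ x, x ∈ l) {w : List (Sym V)}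
    {es : List (Edge V)} (hes : (es.map fun e => s(e.1, e.2)).Nodup)
    (hW : ∀ e ∈ es, (Nat.bits e.1.2).length ≤ w.length ∧ (Nat.bits e.2.2).length ≤ w.length)
    {N : ℕ} (hN : es.length ≤ N) {prev S : List G.Subgraph}
    (hc : CopiesLE (S ++ prev) es w.length N) (hS : Continues prev S)
    {L : G.Subgraph → List (V → ℕ)} (hL : Correct es w.length prev L) :
    ∃ L', Correct es w.length (S.reverse ++ prev) L' ∧
      Runs (seqProg l prev S) (base l w (edgeSyms es) L) (base l w (edgeSyms es) L')
        (S.length * (stepConst l * (w.length + 1) ^ 2 * (3 * N + 1)) + 1) := by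
  induction S generalizing prev L with
  | nil => exact ⟨L, by simpa using hL, (Runs.skip _).congr rfl (by simp)⟩
  | cons H S ih =>
    obtain ⟨hH', hH, hS⟩ := hS
    obtain ⟨L₁, hL₁, h₁⟩ := stepProg_runs hl hm hes hW hN
      (fun K hK => hc K (by simp only [List.mem_append, List.mem_cons] at hK ⊢; tauto)) hH hH' hL
    obtain ⟨L₂, hL₂, h₂⟩ := ih
      (fun K hK => hc K (by simp only [List.mem_append, List.mem_cons] at hK ⊢; tauto)) hS hL₁
    refine ⟨L₂, by simpa using hL₂, (h₁.seq h₂).congr rfl ?_⟩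
    rw [List.length_cons]
    linarith

/-! ### The complete program -/

/-- Is the symbol not the separator between the sizes and the edges? -/
def Sym.notBar : Sym V → Bool
  | .inp none => false
  | _ => true

/-- All tapes but `ans`. -/
def otherRegs (V ι : Type) [Fintype V] [Fintype ι] : List (Reg V ι) :=
  (Finset.univ : Finset (Reg V ι)).toList.filter (· ≠ .ans)

instance : Fintype G.Subgraph := Fintype.ofFinite _

/-- The program that decides whether there is a colored copy of `G`. -/
def solve (l : List V) (S : List G.Subgraph) : Prog (Reg V G.Subgraph) (Sym V) :=
  .seq (moveAll .trail .inp) <| .seq (moveWhile Sym.notBar .inp .wid) <| .seq (.pop .inp) <|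
    .seq (seqProg l [] S) <| .seq (.case (.lst ⊤) fun x => match x with
      | none => .skip
      | some _ => .push .ans .group) (clear (otherRegs V G.Subgraph))

/-- A constant for the time of `solve`. -/
def solveConst (l : List V) (S : List G.Subgraph) : ℕ :=
  4 * S.length * stepConst l + (otherRegs V G.Subgraph).length * (2 * (l.length + 3) + 1) + 30

/-- The written sizes of the color classes become the counter `wid`: their length bounds the number
of digits of every vertex number in the input. -/
theorem solve_runs {l : List V} (hl : l.Nodup) (hm : ∀ x, x ∈ l) {S : List G.Subgraph}
    (hS : IsUnionSequence G S) {sizes : List (Sym V)} (hs : ∀ a ∈ sizes, a.notBar = true)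
    {es : List (Edge V)} (hes : (es.map fun e => s(e.1, e.2)).Nodup)
    (hW : ∀ e ∈ es, (Nat.bits e.1.2).length ≤ sizes.length ∧ (Nat.bits e.2.2).length ≤ sizes.length)
    {N : ℕ} (hN : es.length ≤ N) (hc : CopiesLE S es sizes.length N) :
    Runs (solve l S)
      (update (fun _ => []) .trail (sizes ++ .inp none :: edgeSyms es).reverse)
      (update (fun _ => []) .ans
        (bif decide (∃ r, IsCopy (⊤ : G.Subgraph) es sizes.length r) then [.group] else []))
      (solveConst l S * (sizes.length + 1) ^ 2 * (N + 1)) := by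
  have hE := length_edgeSyms_le hW
  have h₁ := moveAll_runs (k := Reg.trail) (k' := .inp) (by simp)
    (update (fun _ => []) .trail (sizes ++ .inp none :: edgeSyms es).reverse :
      St V G.Subgraph)
  have h₂ := moveWhile_runs (P := Sym.notBar) (k := Reg.inp) (k' := .wid) (l := sizes)
    (r := .inp none :: edgeSyms es) (by simp)
    (s := (update (fun _ => []) .inp (sizes ++ .inp none :: edgeSyms es) : St V G.Subgraph))
    (by simp) hs rfl
  have h₃ := Runs.pop .inp (update (update (fun _ => []) .inp (.inp none :: edgeSyms es))
    .wid sizes.reverse : St V G.Subgraph)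
  obtain ⟨L, hL, h₄⟩ := seqProg_runs (w := sizes.reverse) (prev := []) (S := S)
    (L := fun _ => []) hl hm hes (by simpa using hW) hN (by simpa using hc) hS.continues
    ⟨by simp, by simp, by simp⟩
  rw [List.append_nil] at hL
  have htop : (⊤ : G.Subgraph) ∈ S.reverse :=
    List.mem_reverse.2 (List.mem_of_getLast? hS.2.1)
  have hans : decide (∃ r, IsCopy (⊤ : G.Subgraph) es sizes.length r) = !(L ⊤).isEmpty := by
    have := hL.mem ⊤ htop
    simp only [List.length_reverse] at this
    simp only [← this]
    cases L ⊤ <;> simp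
  have h₅ : Runs (.case (.lst ⊤) fun x => match x with
      | none => .skip
      | some _ => .push .ans .group) (base l sizes.reverse (edgeSyms es) L)
      (update (base l sizes.reverse (edgeSyms es) L) .ans
        (bif decide (∃ r, IsCopy (⊤ : G.Subgraph) es sizes.length r) then [.group] else [])) 2 := by
    rw [hans]
    rcases hT : L ⊤ with _ | ⟨r, L'⟩
    · refine (Runs.case (x := none) (by simp [base, hT, encL]) (Runs.skip _)).congr ?_ le_rfl
      funext k
      cases k <;> simp [base]
    · obtain ⟨a, q, ha⟩ : ∃ a q, encL l (L ⊤) = a :: q := by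
        refine List.exists_cons_of_ne_nil ?_
        rw [encL, Ne, encW_eq_nil, hT]
        simp
      refine (Runs.case (x := some a) (by simp [base, ha]) (Runs.push _ _ _)).congr ?_ le_rfl
      simp [base]
  -- `M` bounds every tape at the end of the computation, and hence the cost of clearing it: a list
  -- has at most `N` records, and a record and its mark fit into the second factor.
  set M := (N + 1) * ((l.length + 3) * (sizes.length + 1)) with hMdef
  have hM1 : 1 ≤ M := Nat.one_le_iff_ne_zero.2 (by positivity)
  have hWM : sizes.length ≤ M :=
    calc sizes.length ≤ 1 * (1 * (sizes.length + 1)) := by omega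
      _ ≤ M := Nat.mul_le_mul (by omega) (Nat.mul_le_mul_right _ (by omega))
  have hM : ∀ k, ((update (base l sizes.reverse (edgeSyms es) L) .ans
        (bif decide (∃ r, IsCopy (⊤ : G.Subgraph) es sizes.length r) then [Sym.group] else []))
          k).length ≤ M := by
    intro k
    cases k
    case ans => cases decide (∃ r, IsCopy (⊤ : G.Subgraph) es sizes.length r) <;> simp [hM1]
    case wid =>
      simp only [base, ne_eq, reduceCtorEq, not_false_eq_true, Function.update_of_ne,
        List.length_reverse]
      exact hWM
    case inp =>
      simp only [base, ne_eq, reduceCtorEq, not_false_eq_true, Function.update_of_ne]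
      exact hE.trans (Nat.mul_le_mul (by omega) (Nat.mul_le_mul_right _ (by omega)))
    case lst H =>
      simp [base]
      by_cases hH : H ∈ S.reverse
      · have h₁ := length_encL_le (l := l) (L := L H) fun r hr =>
          length_word_le ((hL.mem H hH r).1 hr).bits
        have h₂ := hc H (List.mem_reverse.1 hH) (L H) (hL.nodup H hH)
          (fun r hr => by simpa using (hL.mem H hH r).1 hr)
        rw [List.length_reverse] at h₁
        refine h₁.trans (Nat.mul_le_mul (by omega) ?_)
        nlinarith
      · rw [hL.eq_nil H hH]
        simp [encL]
    all_goals simp [base]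
  refine ((h₁.congr ?_ le_rfl).seq
    ((h₂.congr ?_ le_rfl).seq ((h₃.congr ?_ le_rfl).seq
    (h₄.seq (h₅.seq (clear_runs hM)))))).congr ?_ ?_
  · funext k
    cases k <;> simp
  · rw [Function.update_idem]
    simp
  · funext k
    cases k <;> simp [base, encL]
  · funext k
    cases k <;> simp [otherRegs]
  · have hQ : M ≤ (l.length + 3) * ((sizes.length + 1) ^ 2 * (N + 1)) :=
      calc M = (l.length + 3) * ((sizes.length + 1) * (N + 1)) := by rw [hMdef]; ring
        _ ≤ _ := by gcongr; exact Nat.le_self_pow two_ne_zero _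
    have hW1 : sizes.length + 1 ≤ (sizes.length + 1) ^ 2 * (N + 1) :=
      (Nat.le_self_pow two_ne_zero _).trans (Nat.le_mul_of_pos_right _ (by omega))
    have hE1 : (edgeSyms es).length ≤ 2 * ((sizes.length + 1) ^ 2 * (N + 1)) :=
      calc _ ≤ (N + 1) * (2 * (sizes.length + 1) ^ 2) := hE.trans (Nat.mul_le_mul (by omega)
              (Nat.mul_le_mul_left _ (Nat.le_self_pow two_ne_zero _)))
        _ = _ := by ring
    have hS1 : S.length * (stepConst l * (sizes.length + 1) ^ 2 * (3 * N + 1)) ≤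
        4 * S.length * stepConst l * ((sizes.length + 1) ^ 2 * (N + 1)) :=
      calc _ ≤ S.length * (stepConst l * (sizes.length + 1) ^ 2 * (4 * (N + 1))) := by
            gcongr; omega
        _ = _ := by ring
    have hK : (otherRegs V G.Subgraph).length * (2 * M + 1) ≤ (otherRegs V G.Subgraph).length *
        (2 * (l.length + 3) + 1) * ((sizes.length + 1) ^ 2 * (N + 1)) := by
      rw [mul_assoc]
      gcongr
      rw [add_mul, mul_assoc 2]
      omega
    simp only [Function.update_self, List.length_reverse, List.length_append, List.length_cons]
    have hT : solveConst l S * (sizes.length + 1) ^ 2 * (N + 1) =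
        4 * S.length * stepConst l * ((sizes.length + 1) ^ 2 * (N + 1)) +
        (otherRegs V G.Subgraph).length * (2 * (l.length + 3) + 1) *
          ((sizes.length + 1) ^ 2 * (N + 1)) + 30 * ((sizes.length + 1) ^ 2 * (N + 1)) := by
      rw [solveConst]; ring
    omega

end ColoredSubgraph

end

noncomputable section

open Function (update)
open scoped Classical

namespace ColoredSubgraph

open StackProg

variable {V : Type} {G : SimpleGraph V} {m : V → ℕ}

/-! ### Colored copies in a graph and in its encodings -/

/-- The colored copies of `H` in the colored graph `X`. -/
def copies [Fintype V] (H : G.Subgraph) (X : SimpleGraph (Vtx m)) :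
    Finset ((u : H.verts) → Fin (m u)) :=
  Finset.univ.filter fun f => ∀ (u v : V) (h : H.Adj u v),
    X.Adj ⟨u, f ⟨u, h.fst_mem⟩⟩ ⟨v, f ⟨v, h.snd_mem⟩⟩

/-- The isomorphism is forced to be the coloring, so a solution selects exactly one vertex of each
color. -/
theorem subCol_iff (X : SimpleGraph (Vtx m)) :
    SubCol G X Sigma.fst ↔ ∃ f : (u : V) → Fin (m u), ∀ u v, G.Adj u v → X.Adj ⟨u, f u⟩ ⟨v, f v⟩ := by
  constructor
  · rintro ⟨G', φ, hφ⟩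
    have : ∀ u, ∃ i : Fin (m u), (⟨u, i⟩ : Vtx m) = (φ.symm u).1 := by
      intro u
      have h := hφ (φ.symm u)
      rw [RelIso.apply_symm_apply] at h
      obtain ⟨⟨⟨x, i⟩, hx⟩, hφu⟩ : ∃ y, y = φ.symm u := ⟨_, rfl⟩
      rw [← hφu] at h ⊢
      subst h
      exact ⟨i, rfl⟩
    choose f hf using this
    refine ⟨f, fun u v huv => ?_⟩
    rw [hf, hf]
    exact G'.adj_sub (φ.symm.map_adj_iff.2 huv)
  · rintro ⟨f, hf⟩
    -- The subgraph need not be induced: it keeps exactly the edges over those of `G`.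
    refine ⟨{ verts := Set.range fun u => ⟨u, f u⟩
              Adj := fun x y => G.Adj x.1 y.1 ∧ x.2 = f x.1 ∧ y.2 = f y.1
              adj_sub := ?_
              edge_vert := ?_
              symm := ⟨fun x y h => ⟨h.1.symm, h.2.2, h.2.1⟩⟩ },
            { toFun := fun x => x.1.1
              invFun := fun u => ⟨⟨u, f u⟩, u, rfl⟩
              left_inv := ?_
              right_inv := fun u => rfl
              map_rel_iff' := ?_ }, fun x => rfl⟩
    · rintro ⟨u, i⟩ ⟨v, j⟩ ⟨h, hi, hj⟩
      simp only at hi hj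
      subst hi hj
      exact hf u v h
    · rintro ⟨u, i⟩ ⟨v, j⟩ ⟨h, hi, hj⟩
      simp only at hi
      exact ⟨u, by rw [hi]⟩
    · rintro ⟨_, u, rfl⟩
      rfl
    · rintro ⟨_, u, rfl⟩ ⟨_, v, rfl⟩
      simp

/-- The color and the number of a vertex. -/
def vtxIndex (p : Vtx m) : V × ℕ := (p.1, p.2)

theorem vtxIndex_injective : Function.Injective (vtxIndex (m := m)) := by
  rintro ⟨u, i⟩ ⟨v, j⟩ h
  simp only [vtxIndex, Prod.mk.injEq] at h
  obtain ⟨rfl, h⟩ := h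
  rw [Fin.ext h]

/-- The edges of the input, as pairs of colors and numbers. -/
def indexEdges (es : List (Vtx m × Vtx m)) : List (Edge V) :=
  es.map fun p => (vtxIndex p.1, vtxIndex p.2)

theorem map_indexEdges (es : List (Vtx m × Vtx m)) :
    (indexEdges es).map (fun e => s(e.1, e.2)) =
      (es.map fun p => s(p.1, p.2)).map (Sym2.map vtxIndex) := by
  simp [indexEdges]

theorem mk_mem_indexEdges {X : SimpleGraph (Vtx m)} {es : List (Vtx m × Vtx m)}
    (hX : ∀ e : Sym2 (Vtx m), e ∈ (es.map fun p => s(p.1, p.2)) ↔ e ∈ X.edgeSet)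
    {u v : V} (i : Fin (m u)) (j : Fin (m v)) :
    s((u, (i : ℕ)), (v, (j : ℕ))) ∈ (indexEdges es).map (fun e => s(e.1, e.2)) ↔
      X.Adj ⟨u, i⟩ ⟨v, j⟩ := by
  rw [map_indexEdges, ← SimpleGraph.mem_edgeSet, ← hX]
  exact List.mem_map_of_injective (a := s(⟨u, i⟩, ⟨v, j⟩))
    (Sym2.map.injective (vtxIndex_injective (m := m)))

theorem lt_of_mem_indexEdges {es : List (Vtx m × Vtx m)} {u : V} {i : ℕ} {q : V × ℕ}
    (h : s((u, i), q) ∈ (indexEdges es).map (fun e => s(e.1, e.2))) : i < m u := by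
  simp only [indexEdges, List.map_map, List.mem_map, Function.comp_apply] at h
  obtain ⟨⟨⟨x, a⟩, y, b⟩, -, h⟩ := h
  rw [Sym2.eq_iff] at h
  simp only [vtxIndex, Prod.mk.injEq] at h
  rcases h with ⟨⟨rfl, rfl⟩, -⟩ | ⟨-, rfl, rfl⟩
  · exact a.2
  · exact b.2

theorem length_bits_le {i k W : ℕ} (h : i < k) (hk : Nat.size k ≤ W) :
    (Nat.bits i).length ≤ W := by
  rw [Nat.size_eq_bits_len]
  exact (Nat.size_le_size h.le).trans hk

/-- Every vertex of `G` lies on an edge, so each entry of a copy occurs in an input edge. It is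
therefore below the size of its color class and names a vertex of `X`. -/
theorem subCol_iff_isCopy (hG : ∀ u, ∃ v, G.Adj u v) {X : SimpleGraph (Vtx m)}
    {es : List (Vtx m × Vtx m)}
    (hX : ∀ e : Sym2 (Vtx m), e ∈ (es.map fun p => s(p.1, p.2)) ↔ e ∈ X.edgeSet)
    {W : ℕ} (hW : ∀ u, Nat.size (m u) ≤ W) :
    SubCol G X Sigma.fst ↔ ∃ r, IsCopy (⊤ : G.Subgraph) (indexEdges es) W r := by
  rw [subCol_iff]
  constructor
  · rintro ⟨f, hf⟩
    refine ⟨fun u => f u, fun v hv => absurd (Set.mem_univ v) hv, fun u v huv => ?_, fun v =>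
      length_bits_le (f v).2 (hW v)⟩
    rw [mk_mem_indexEdges hX]
    exact hf u v huv
  · rintro ⟨r, hr⟩
    have hlt : ∀ u, r u < m u := by
      intro u
      obtain ⟨v, huv⟩ := hG u
      exact lt_of_mem_indexEdges (hr.edge u v huv)
    refine ⟨fun u => ⟨r u, hlt u⟩, fun u v huv => ?_⟩
    rw [← mk_mem_indexEdges hX]
    exact hr.edge u v huv

/-- As `H` has no isolated vertices, the entries of a record on `H` name vertices of `X`; outside
`H` they are zero. So records are the images of colored copies. -/
theorem IsCopy.length_le [Fintype V] {H : G.Subgraph} (hH : ∀ u ∈ H.verts, ∃ v, H.Adj u v)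
    {X : SimpleGraph (Vtx m)} {es : List (Vtx m × Vtx m)}
    (hX : ∀ e : Sym2 (Vtx m), e ∈ (es.map fun p => s(p.1, p.2)) ↔ e ∈ X.edgeSet) {W : ℕ}
    {L : List (V → ℕ)} (hn : L.Nodup) (hL : ∀ r ∈ L, IsCopy H (indexEdges es) W r) :
    L.length ≤ (copies H X).card := by
  rw [← List.toFinset_card_of_nodup hn]
  refine (Finset.card_le_card (t := (copies H X).image fun f u =>
    if h : u ∈ H.verts then (f ⟨u, h⟩ : ℕ) else 0) fun r hr => ?_).trans Finset.card_image_le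
  replace hr := hL r (List.mem_toFinset.1 hr)
  have hlt : ∀ u ∈ H.verts, r u < m u := by
    intro u hu
    obtain ⟨v, huv⟩ := hH u hu
    exact lt_of_mem_indexEdges (hr.edge u v huv)
  refine Finset.mem_image.2 ⟨fun u => ⟨r u, hlt u u.2⟩, ?_, ?_⟩
  · refine Finset.mem_filter.2 ⟨Finset.mem_univ _, fun u v huv => ?_⟩
    rw [← mk_mem_indexEdges hX]
    exact hr.edge u v huv
  · funext u
    by_cases hu : u ∈ H.verts
    · simp [hu]
    · simp [hu, hr.eq_zero u hu]

/-- Both properties hold for single edges and pass to unions. Applied to the last term `⊤`, the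
second one says that every edge of `G` is a term of the sequence. -/
theorem IsUnionSequence.exists_adj {S : List G.Subgraph} (hS : IsUnionSequence G S)
    {H : G.Subgraph} (hH : H ∈ S) :
    (∀ u ∈ H.verts, ∃ v, H.Adj u v) ∧ ∀ (u v : V) (h : H.Adj u v), G.subgraphOfAdj h.adj_sub ∈ S := by
  obtain ⟨i, hi, rfl⟩ := List.mem_iff_getElem.1 hH
  clear hH
  induction i using Nat.strong_induction_on with
  | _ i ih =>
    rcases hS.2.2 i hi with ⟨u, v, h, hH⟩ | ⟨j, k, hj, hk, hH⟩
    · constructor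
      · rw [hH]
        intro x hx
        simp only [SimpleGraph.subgraphOfAdj_verts, Set.mem_insert_iff,
          Set.mem_singleton_iff] at hx
        rcases hx with rfl | rfl
        · exact ⟨v, by simp⟩
        · exact ⟨u, by simp⟩
      · intro x y hxy
        have hxy' := hxy
        rw [hH, SimpleGraph.subgraphOfAdj_adj, Sym2.eq_iff] at hxy'
        have : G.subgraphOfAdj hxy.adj_sub = G.subgraphOfAdj h := by
          rcases hxy' with ⟨rfl, rfl⟩ | ⟨rfl, rfl⟩
          · rfl
          · exact SimpleGraph.subgraphOfAdj_symm _
        rw [this, ← hH]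
        exact List.getElem_mem hi
    · have h₁ := ih j hj (hj.trans hi)
      have h₂ := ih k hk (hk.trans hi)
      constructor
      · rw [hH]
        rintro u (hu | hu)
        · obtain ⟨v, hv⟩ := h₁.1 u hu
          exact ⟨v, .inl hv⟩
        · obtain ⟨v, hv⟩ := h₂.1 u hu
          exact ⟨v, .inr hv⟩
      · intro u v h
        have h' := h
        rw [hH, SimpleGraph.Subgraph.sup_adj] at h'
        rcases h' with h' | h'
        · exact h₁.2 u v h'
        · exact h₂.2 u v h'

/-! ### The machine of a union sequence -/

theorem map_inp_flatMap_edgeToken (es : List (Vtx m × Vtx m)) :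
    (es.flatMap edgeToken).map Sym.inp = edgeSyms (indexEdges es) := by
  simp [edgeSyms, indexEdges, List.map_flatMap, List.flatMap_map, edgeToken, token, vertexSyms,
    bitsOf, vtxIndex, Function.comp_def]

theorem notBar_of_mem {cs : List V} {a : Sym V}
    (h : a ∈ (cs.flatMap fun u => token u (m u)).map Sym.inp) : a.notBar = true := by
  simp only [List.mem_map, List.mem_flatMap, token, List.mem_cons] at h
  obtain ⟨x, ⟨u, -, rfl | ⟨b, -, rfl⟩⟩, rfl⟩ := h <;> rfl

variable [Fintype V]

/-- The machine that computes the copies of the terms of the union sequence `S`. -/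
def decider (S : List G.Subgraph) : Turing.TM2ComputableAux (Symbol V) Bool :=
  machine (solve Finset.univ.toList S) Sym.inp .trail .ans .group

/-- The number of symbols with which the sizes of the color classes are written. -/
def sizesLength (m : V → ℕ) : ℕ := ∑ u, (Nat.size (m u) + 1)

theorem length_sizes {cs : List V} (hn : cs.Nodup) (hcs : ∀ u, u ∈ cs) :
    (cs.flatMap fun u => token u (m u)).length = sizesLength m := by
  have h : cs.toFinset = Finset.univ := by ext u; simp [hcs]
  rw [sizesLength, ← h, List.sum_toFinset _ hn, List.length_flatMap]
  simp [token, Nat.size_eq_bits_len]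

/-- A constant for the time of `decider`. -/
def deciderConst (S : List G.Subgraph) : ℕ := solveConst Finset.univ.toList S + 5

theorem decider_answers (hG : ∀ u, ∃ v, G.Adj u v) {S : List G.Subgraph}
    (hS : IsUnionSequence G S) {X : SimpleGraph (Vtx m)} {w : List (Symbol V)}
    (hw : Encodes w X) {N : ℕ} (hN : X.edgeSet.ncard ≤ N)
    (hc : ∀ H ∈ S, (copies H X).card ≤ N) :
    AnswersWithin G (decider S) X w (deciderConst S * (sizesLength m + 1) ^ 2 * (N + 1)) := by
  obtain ⟨cs, es, hcn, hcs, hen, hX, rfl⟩ := hw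
  have hlen : ((cs.flatMap fun u => token u (m u)).map (Sym.inp (V := V))).length =
      sizesLength m := by
    rw [List.length_map, length_sizes hcn hcs]
  have hW : ∀ u, Nat.size (m u) ≤ sizesLength m := fun u =>
    (Nat.le_succ _).trans (Finset.single_le_sum (f := fun u => Nat.size (m u) + 1)
      (fun _ _ => Nat.zero_le _) (Finset.mem_univ u))
  have hes : es.length ≤ N := by
    rw [← List.length_map (fun p : Vtx m × Vtx m => s(p.1, p.2)),
      ← List.toFinset_card_of_nodup hen, ← Set.ncard_coe_finset]
    convert hN
    ext e
    simp only [List.coe_toFinset, Set.mem_ofPred_eq, hX]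
  have hbits : ∀ e ∈ indexEdges es, (Nat.bits e.1.2).length ≤ sizesLength m ∧
      (Nat.bits e.2.2).length ≤ sizesLength m := by
    intro e he
    obtain ⟨p, -, rfl⟩ := List.mem_map.1 he
    exact ⟨length_bits_le p.1.2.2 (hW _), length_bits_le p.2.2.2 (hW _)⟩
  obtain ⟨t, ht, hrun⟩ := solve_runs (l := Finset.univ.toList) (es := indexEdges es) (N := N)
    (Finset.nodup_toList _) (by simp) hS (fun a ha => notBar_of_mem ha)
    (by rw [map_indexEdges]; exact hen.map (Sym2.map.injective vtxIndex_injective))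
    (by rw [hlen]; exact hbits) (by simpa [indexEdges] using hes)
    (fun H hH L hn hL => (IsCopy.length_le (hS.exists_adj hH).1 hX hn hL).trans (hc H hH))
  rw [hlen] at ht
  unfold AnswersWithin
  have hinp : ((cs.flatMap fun u => token u (m u)) ++ none :: es.flatMap edgeToken).map
      (Sym.inp (V := V)) = (cs.flatMap fun u => token u (m u)).map Sym.inp ++
        .inp none :: edgeSyms (indexEdges es) := by
    rw [List.map_append, List.map_cons, map_inp_flatMap_edgeToken]
  rw [← hinp] at hrun
  refine machine_outputs _ _ _ _ _ _ _ t _ _ hrun ?_ ?_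
  · rw [hlen, decide_eq_decide.2 (subCol_iff_isCopy hG hX hW)]
  · have h₁ := length_edgeSyms_le hbits
    rw [← map_inp_flatMap_edgeToken, List.length_map, indexEdges, List.length_map] at h₁
    rw [List.length_map] at hlen
    rw [List.length_append, List.length_cons, hlen]
    have h₂ : sizesLength m + 1 ≤ (sizesLength m + 1) ^ 2 * (N + 1) :=
      (Nat.le_self_pow two_ne_zero _).trans (Nat.le_mul_of_pos_right _ (by omega))
    have h₃ : (es.flatMap edgeToken).length ≤ 2 * ((sizesLength m + 1) ^ 2 * (N + 1)) :=
      calc _ ≤ (N + 1) * (2 * (sizesLength m + 1) ^ 2) := h₁.trans (Nat.mul_le_mul (by omega)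
              (Nat.mul_le_mul_left _ (Nat.le_self_pow two_ne_zero _)))
        _ = _ := by ring
    rw [deciderConst, mul_assoc, add_mul]
    rw [mul_assoc] at ht
    omega

/-- The answer is correct whatever the lengths of the lists, and for each single input these are
bounded by some `N`. -/
theorem decider_decides (hG : ∀ u, ∃ v, G.Adj u v) {S : List G.Subgraph}
    (hS : IsUnionSequence G S) : Decides G (decider S) := by
  intro m X w hw
  refine ⟨_, decider_answers hG hS hw
    (N := X.edgeSet.ncard + ∑ H ∈ S.toFinset, (copies H X).card) (by omega) fun H hH => ?_⟩
  have := Finset.single_le_sum (f := fun H => (copies H X).card) (fun _ _ => Nat.zero_le _)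
    (List.mem_toFinset.2 hH)
  omega

/-- Every edge of `X` is a copy of the edge of `G` between its colors, and there are at most $|V|^2$
ordered pairs of colors. -/
theorem ncard_edgeSet_le {X : SimpleGraph (Vtx m)} (hX : ∀ p q, X.Adj p q → G.Adj p.1 q.1)
    {N : ℕ} (hN : ∀ (u v : V) (h : G.Adj u v), (copies (G.subgraphOfAdj h) X).card ≤ N) :
    X.edgeSet.ncard ≤ Fintype.card V ^ 2 * N := by
  have hsub : X.edgeSet.toFinset ⊆ (Finset.univ : Finset {p : V × V // G.Adj p.1 p.2}).biUnion
      fun d => (copies (G.subgraphOfAdj d.2) X).image fun f =>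
        s(⟨d.1.1, f ⟨d.1.1, by simp⟩⟩, ⟨d.1.2, f ⟨d.1.2, by simp⟩⟩) := by
    intro e he
    rw [Set.mem_toFinset] at he
    induction e with
    | _ p q =>
      rw [Finset.mem_biUnion]
      have h := hX p q he
      obtain ⟨u, i⟩ := p
      obtain ⟨v, j⟩ := q
      refine ⟨⟨(u, v), h⟩, Finset.mem_univ _, Finset.mem_image.2 ⟨fun x =>
        if hx : x.1 = u then ⟨i, by rw [hx]; exact i.2⟩
        else ⟨j, by rw [x.2.resolve_left hx]; exact j.2⟩, ?_, ?_⟩⟩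
      · refine Finset.mem_filter.2 ⟨Finset.mem_univ _, fun x y hxy => ?_⟩
        have hvu : v ≠ u := h.ne'
        rw [SimpleGraph.subgraphOfAdj_adj, Sym2.eq_iff] at hxy
        rcases hxy with ⟨rfl, rfl⟩ | ⟨rfl, rfl⟩
        · simpa [hvu] using he
        · simpa [hvu] using X.adj_symm he
      · have hvu : v ≠ u := h.ne'
        simp [hvu]
  rw [Set.ncard_eq_toFinset_card']
  refine (Finset.card_le_card hsub).trans ((Finset.card_biUnion_le_card_mul _ _ N fun d _ =>
    Finset.card_image_le.trans (hN _ _ d.2)).trans (Nat.mul_le_mul_right _ ?_))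
  rw [Finset.card_univ, sq, ← Fintype.card_prod]
  exact Fintype.card_subtype_le _

end ColoredSubgraph

end

noncomputable section

open Function (update)
open scoped Classical

namespace ColoredSubgraph

variable {V : Type} {G : SimpleGraph V}

/-! ### Optimal union sequences -/

/-- The distinct terms of `S` are edges or unions of two previous terms. -/
def IsUnionPrefix (G : SimpleGraph V) (S : List G.Subgraph) : Prop :=
  S.Nodup ∧ ∀ (i : ℕ) (hi : i < S.length),
    (∃ (u v : V) (h : G.Adj u v), S[i] = G.subgraphOfAdj h) ∨
    (∃ (j k : ℕ) (hj : j < i) (hk : k < i), S[i] = S[j] ⊔ S[k])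

theorem IsUnionPrefix.of_append {S T : List G.Subgraph} (h : IsUnionPrefix G (S ++ T)) :
    IsUnionPrefix G S := by
  refine ⟨(List.nodup_append.1 h.1).1, fun i hi => ?_⟩
  rcases h.2 i (by rw [List.length_append]; omega) with ⟨u, v, h, e⟩ | ⟨j, k, hj, hk, e⟩
  · rw [List.getElem_append_left hi] at e
    exact .inl ⟨u, v, h, e⟩
  · rw [List.getElem_append_left hi, List.getElem_append_left (hj.trans hi),
      List.getElem_append_left (hk.trans hi)] at e
    exact .inr ⟨j, k, hj, hk, e⟩

theorem IsUnionPrefix.concat {S : List G.Subgraph} (h : IsUnionPrefix G S) {H : G.Subgraph}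
    (hn : H ∉ S) (hH : (∃ (u v : V) (h : G.Adj u v), H = G.subgraphOfAdj h) ∨
      ∃ H₁ ∈ S, ∃ H₂ ∈ S, H = H₁ ⊔ H₂) : IsUnionPrefix G (S ++ [H]) := by
  refine ⟨List.nodup_append.2 ⟨h.1, by simp, fun a ha b hb => ?_⟩, fun i hi => ?_⟩
  · rw [List.mem_singleton] at hb
    rintro rfl
    exact hn (hb ▸ ha)
  · rw [List.length_append, List.length_singleton] at hi
    by_cases hi' : i < S.length
    · rcases h.2 i hi' with ⟨u, v, h, e⟩ | ⟨j, k, hj, hk, e⟩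
      · exact .inl ⟨u, v, h, by rw [List.getElem_append_left hi', e]⟩
      · refine .inr ⟨j, k, hj, hk, ?_⟩
        rw [List.getElem_append_left hi', List.getElem_append_left (hj.trans hi'),
          List.getElem_append_left (hk.trans hi'), e]
    · obtain rfl : i = S.length := by omega
      rcases hH with ⟨u, v, h, e⟩ | ⟨H₁, h₁, H₂, h₂, e⟩
      · exact .inl ⟨u, v, h, by simp [e]⟩
      · obtain ⟨j, hj, rfl⟩ := List.mem_iff_getElem.1 h₁
        obtain ⟨k, hk, rfl⟩ := List.mem_iff_getElem.1 h₂
        exact .inr ⟨j, k, hj, hk, by simp [e, hj, hk]⟩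

/-- A longest sequence of distinct terms contains all edges and is closed under unions. The union of
its terms is `⊤`, as no vertex of `G` is isolated. -/
theorem exists_isUnionSequence [Fintype V] [Nonempty V] (hG : ∀ u, ∃ v, G.Adj u v) :
    ∃ S, IsUnionSequence G S := by
  obtain ⟨⟨S, hn⟩, hS, hmax⟩ := Set.exists_max_image
    {S : {S : List G.Subgraph // S.Nodup} | IsUnionPrefix G S.1} (fun S => S.1.length)
    (Set.toFinite _) ⟨⟨[], by simp⟩, by simp [IsUnionPrefix]⟩
  have hmem : ∀ H : G.Subgraph, ((∃ (u v : V) (h : G.Adj u v), H = G.subgraphOfAdj h) ∨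
      ∃ H₁ ∈ S, ∃ H₂ ∈ S, H = H₁ ⊔ H₂) → H ∈ S := by
    intro H hH
    by_contra hn
    have := IsUnionPrefix.concat hS hn hH
    have := hmax ⟨_, this.1⟩ this
    simp at this
  have hedge : ∀ u v (h : G.Adj u v), G.subgraphOfAdj h ∈ S := fun u v h =>
    hmem _ (.inl ⟨u, v, h, rfl⟩)
  have hne : S.toFinset.Nonempty := by
    obtain ⟨v, hv⟩ := hG (Classical.arbitrary V)
    exact ⟨_, List.mem_toFinset.2 (hedge _ v hv)⟩
  have hsup : SupClosed {H | H ∈ S} := fun H₁ h₁ H₂ h₂ => hmem _ (.inr ⟨H₁, h₁, H₂, h₂, rfl⟩)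
  have htop : (⊤ : G.Subgraph) ∈ S := by
    have hK := hsup.finsetSup'_mem hne (f := id) fun H hH => List.mem_toFinset.1 hH
    have hle : ∀ u v (h : G.Adj u v), G.subgraphOfAdj h ≤ S.toFinset.sup' hne id := fun u v h =>
      Finset.le_sup' (f := id) (List.mem_toFinset.2 (hedge u v h))
    have : S.toFinset.sup' hne id = ⊤ := by
      refine top_le_iff.1 ⟨fun u _ => ?_, fun u v huv => ?_⟩
      · obtain ⟨v, huv⟩ := hG u
        exact (hle u v huv).1 (by simp)
      · exact (hle u v huv).2 (by simp)
    rwa [this] at hK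
  -- A union sequence must end with `⊤`, so the longest sequence is cut behind it.
  obtain ⟨S₁, S₂, rfl⟩ := List.append_of_mem htop
  have := IsUnionPrefix.of_append (S := S₁ ++ [⊤]) (T := S₂) (by simpa using hS)
  exact ⟨S₁ ++ [⊤], this.1, by simp, this.2⟩

variable [Fintype V]

/-- The infimum is attained, since the set of values is nonempty and, as there are finitely many
subgraphs, finite. -/
theorem exists_isUnionSequence_weight_le [Nonempty V] (hG : ∀ u, ∃ v, G.Adj u v)
    (Δ : ThresholdWeighting G) :
    ∃ S, IsUnionSequence G S ∧ (∀ H ∈ S, Δ.weight H ≤ kappaOf G Δ) ∧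
      ∃ H ∈ S, kappaOf G Δ = Δ.weight H := by
  have hfin : {x : ℝ | ∃ S : List G.Subgraph, IsUnionSequence G S ∧
      IsGreatest {y : ℝ | ∃ H ∈ S, y = Δ.weight H} x}.Finite := by
    refine (Set.finite_range Δ.weight).subset ?_
    rintro x ⟨S, -, ⟨H, -, rfl⟩, -⟩
    exact ⟨H, rfl⟩
  obtain ⟨S, hS⟩ := exists_isUnionSequence hG
  obtain ⟨H, hH, hmax⟩ := Set.exists_max_image {H | H ∈ S} Δ.weight (Set.toFinite _)
    ⟨⊤, List.mem_of_getLast? hS.2.1⟩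
  have hne : {x : ℝ | ∃ S : List G.Subgraph, IsUnionSequence G S ∧
      IsGreatest {y : ℝ | ∃ H ∈ S, y = Δ.weight H} x}.Nonempty :=
    ⟨_, S, hS, ⟨H, hH, rfl⟩, by rintro _ ⟨K, hK, rfl⟩; exact hmax K hK⟩
  obtain ⟨S, hS, ⟨K, hK, e⟩, hle⟩ := hne.csInf_mem hfin
  exact ⟨S, hS, fun H hH => hle ⟨H, hH, rfl⟩, K, hK, e⟩

theorem kappaOf_nonneg [Nonempty V] (hG : ∀ u, ∃ v, G.Adj u v) (Δ : ThresholdWeighting G) :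
    0 ≤ kappaOf G Δ := by
  obtain ⟨S, -, -, H, -, e⟩ := exists_isUnionSequence_weight_le hG Δ
  exact e ▸ Δ.excess_nonneg H

/-- What has to be checked is that the supremum is over a bounded set: $\alpha\le 1$ and $\beta\ge
0$ give $\Delta(H)\le|V|$. -/
theorem kappaOf_le_kappa [Nonempty V] (hG : ∀ u, ∃ v, G.Adj u v) (Δ : ThresholdWeighting G) :
    kappaOf G Δ ≤ kappa G := by
  refine le_csSup ⟨Fintype.card V, ?_⟩ ⟨Δ, rfl⟩
  rintro _ ⟨Δ, rfl⟩
  obtain ⟨S, -, -, H, -, e⟩ := exists_isUnionSequence_weight_le hG Δ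
  simp only [e, ThresholdWeighting.weight, excess]
  have h₁ : 0 ≤ ∑ e with e ∈ H.edgeSet, Δ.β e := Finset.sum_nonneg fun e _ => Δ.β_nonneg e
  have h₂ : ∑ u with u ∈ H.verts, Δ.α u ≤ Fintype.card V :=
    calc ∑ u with u ∈ H.verts, Δ.α u ≤ ∑ u, Δ.α u :=
          Finset.sum_le_sum_of_subset_of_nonneg (Finset.filter_subset _ _)
            fun u _ _ => Δ.α_nonneg u
      _ ≤ ∑ u : V, 1 := Finset.sum_le_sum fun u _ => Δ.α_le_one u
      _ = Fintype.card V := by simp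
  linarith

end ColoredSubgraph

end

noncomputable section

open Function (update)
open scoped Classical

namespace ColoredSubgraph

variable {V : Type} {G : SimpleGraph V} {m : V → ℕ}

/-! ### The expected number of copies -/

theorem sampleGraph_adj {ω : Sample G m} {p q : Vtx m} :
    (sampleGraph G m ω).Adj p q ↔ ∃ h : s(p, q) ∈ (blowup G m).edgeSet, ω ⟨s(p, q), h⟩ = true := by
  rw [sampleGraph, SimpleGraph.fromEdgeSet_adj]
  refine ⟨fun h => h.1, fun h => ⟨h, ?_⟩⟩
  obtain ⟨h, -⟩ := h
  exact (show (blowup G m).Adj p q from h).ne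

theorem adj_of_sampleGraph_adj {ω : Sample G m} {p q : Vtx m} (h : (sampleGraph G m ω).Adj p q) :
    G.Adj p.1 q.1 := (sampleGraph_adj.1 h).1

variable [Fintype V]

instance (Δ : ThresholdWeighting G) (n : ℕ) (m : V → ℕ) : IsProbabilityMeasure (law Δ n m) := by
  unfold law; infer_instance

/-- The edges of the copy `f` of `H`. -/
def copyEdges (H : G.Subgraph) (f : (u : H.verts) → Fin (m u)) :
    Finset (blowup G m).edgeSet :=
  Finset.univ.filter fun e => ∃ (u v : V) (h : H.Adj u v),
    (e : Sym2 (Vtx m)) = s(⟨u, f ⟨u, h.fst_mem⟩⟩, ⟨v, f ⟨v, h.snd_mem⟩⟩)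

theorem mem_copies_sampleGraph {H : G.Subgraph} {ω : Sample G m}
    {f : (u : H.verts) → Fin (m u)} :
    f ∈ copies H (sampleGraph G m ω) ↔ ∀ e ∈ copyEdges H f, ω e = true := by
  simp only [copies, copyEdges, Finset.mem_filter, Finset.mem_univ, true_and, sampleGraph_adj]
  constructor
  · rintro h ⟨e, he⟩ ⟨u, v, huv, rfl⟩
    exact (h u v huv).2
  · intro h u v huv
    exact ⟨huv.adj_sub, h ⟨_, _⟩ ⟨u, v, huv, rfl⟩⟩

/-- A copy has one vertex of each color in `H`, so taking colors maps its edges bijectively to those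
of `H`. -/
theorem prod_copyEdges (H : G.Subgraph) (f : (u : H.verts) → Fin (m u)) {M : Type*}
    [CommMonoid M] (φ : Sym2 V → M) :
    ∏ e ∈ copyEdges H f, φ ((e : Sym2 (Vtx m)).map Sigma.fst) = ∏ e with e ∈ H.edgeSet, φ e := by
  refine Finset.prod_bij (fun e _ => (e : Sym2 (Vtx m)).map Sigma.fst) ?_ ?_ ?_ fun _ _ => rfl
  · intro e he
    obtain ⟨-, u, v, h, he⟩ := Finset.mem_filter.1 he
    rw [he]
    simpa using h
  · intro e he e' he' heq
    obtain ⟨-, u, v, h, he⟩ := Finset.mem_filter.1 he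
    obtain ⟨-, u', v', h', he'⟩ := Finset.mem_filter.1 he'
    refine Subtype.ext ?_
    rw [he, he'] at heq ⊢
    simp only [Sym2.map_mk, Sym2.eq_iff] at heq
    rcases heq with ⟨rfl, rfl⟩ | ⟨rfl, rfl⟩
    · rfl
    · exact Sym2.eq_swap
  · intro e he
    induction e with
    | _ u v =>
      have h : H.Adj u v := by simpa using he
      exact ⟨⟨s(⟨u, f ⟨u, h.fst_mem⟩⟩, ⟨v, f ⟨v, h.snd_mem⟩⟩), h.adj_sub⟩,
        Finset.mem_filter.2 ⟨Finset.mem_univ _, u, v, h, rfl⟩, rfl⟩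

/-- The event fixes the coordinates of the edges of one copy, so its probability is a product by
independence. -/
theorem law_mem_copies (Δ : ThresholdWeighting G) (n : ℕ) (H : G.Subgraph)
    (f : (u : H.verts) → Fin (m u)) :
    law Δ n m {ω | f ∈ copies H (sampleGraph G m ω)} =
      ∏ e with e ∈ H.edgeSet, ENNReal.ofReal ((n : ℝ) ^ (-Δ.β e)) := by
  have h : {ω | f ∈ copies H (sampleGraph G m ω)} =
      (copyEdges H f : Set (blowup G m).edgeSet).pi fun _ => {true} := by
    ext ω
    simp [mem_copies_sampleGraph, Set.mem_pi]
  rw [h, law, Measure.pi_pi_finset,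
    ← prod_copyEdges H f fun e => ENNReal.ofReal ((n : ℝ) ^ (-Δ.β e))]
  refine Finset.prod_congr rfl fun e _ => ?_
  rw [bernoulliMeasure_apply_of_mem_of_notMem _ (by simp) (by simp) (by simp)]
  refine (ENNReal.ofReal_coe_nnreal).symm.trans ?_
  rfl

/-- Linearity of expectation: all placements of `H` are equally likely to be copies, and there are
as many as the product of the class sizes. -/
theorem lintegral_card_copies (Δ : ThresholdWeighting G) (n : ℕ) (m : V → ℕ) (H : G.Subgraph) :
    ∫⁻ ω, ((copies H (sampleGraph G m ω)).card : ENNReal) ∂law Δ n m =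
      (∏ u with u ∈ H.verts, (m u : ENNReal)) *
        ∏ e with e ∈ H.edgeSet, ENNReal.ofReal ((n : ℝ) ^ (-Δ.β e)) := by
  have h : ∀ ω : Sample G m, ((copies H (sampleGraph G m ω)).card : ENNReal) =
      ∑ f : (u : H.verts) → Fin (m u),
        {ω | f ∈ copies H (sampleGraph G m ω)}.indicator (fun _ => (1 : ENNReal)) ω := by
    intro ω
    simp [Set.indicator_apply]
  simp only [h]
  rw [lintegral_finsetSum _ fun _ _ => Measurable.of_discrete]
  simp only [lintegral_indicator_const (MeasurableSet.of_discrete), one_mul, law_mem_copies]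
  rw [Finset.sum_const, nsmul_eq_mul, Finset.card_univ, Fintype.card_pi]
  congr 1
  simp only [Fintype.card_fin, Nat.cast_prod]
  exact (Finset.prod_subtype (p := (· ∈ H.verts)) _ (by simp) fun u => (m u : ENNReal)).symm

/-- Since $n^{\alpha(u)}\ge 1$, rounding up at most doubles it. This is the source of the factor
$2^{|V|}$ in the expectation. -/
theorem IsRounding.le {Δ : ThresholdWeighting G} {size : ℕ → V → ℕ} (hs : IsRounding Δ size)
    {n : ℕ} (hn : 1 ≤ n) (u : V) : (size n u : ℝ) ≤ 2 * (n : ℝ) ^ Δ.α u := by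
  have h₁ : (1 : ℝ) ≤ (n : ℝ) ^ Δ.α u :=
    Real.one_le_rpow (by exact_mod_cast hn) (Δ.α_nonneg u)
  rcases hs n u with h | h
  · rw [h]
    have := Nat.floor_le (zero_le_one.trans h₁)
    linarith
  · rw [h]
    have := Nat.ceil_lt_add_one (zero_le_one.trans h₁)
    linarith

theorem lintegral_card_copies_le {Δ : ThresholdWeighting G} {size : ℕ → V → ℕ}
    (hs : IsRounding Δ size) {n : ℕ} (hn : 1 ≤ n) (H : G.Subgraph) :
    ∫⁻ ω, ((copies H (sampleGraph G (size n) ω)).card : ENNReal) ∂law Δ n (size n) ≤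
      ENNReal.ofReal (2 ^ Fintype.card V * (n : ℝ) ^ Δ.weight H) := by
  have hn0 : (0 : ℝ) < n := by exact_mod_cast hn
  rw [lintegral_card_copies, ← ENNReal.ofReal_prod_of_nonneg fun e _ => by positivity]
  have h₁ : (∏ u with u ∈ H.verts, (size n u : ENNReal)) =
      ENNReal.ofReal (∏ u with u ∈ H.verts, (size n u : ℝ)) := by
    rw [ENNReal.ofReal_prod_of_nonneg fun e _ => by positivity]
    simp
  rw [h₁, ← ENNReal.ofReal_mul (by positivity)]
  refine ENNReal.ofReal_le_ofReal ?_
  calc (∏ u with u ∈ H.verts, (size n u : ℝ)) * ∏ e with e ∈ H.edgeSet, (n : ℝ) ^ (-Δ.β e)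
      ≤ (∏ u with u ∈ H.verts, 2 * (n : ℝ) ^ Δ.α u) *
          ∏ e with e ∈ H.edgeSet, (n : ℝ) ^ (-Δ.β e) := by
        gcongr with u _
        exact hs.le hn u
    _ = 2 ^ (Finset.univ.filter fun u => u ∈ H.verts).card * (n : ℝ) ^ Δ.weight H := by
        rw [Finset.prod_mul_distrib, Finset.prod_const, ← Real.rpow_sum_of_pos hn0,
          ← Real.rpow_sum_of_pos hn0, mul_assoc, ← Real.rpow_add hn0]
        simp [ThresholdWeighting.weight, excess, sub_eq_add_neg]
    _ ≤ 2 ^ Fintype.card V * (n : ℝ) ^ Δ.weight H := by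
        gcongr
        · norm_num
        · exact Finset.card_le_univ _

/-- Markov's inequality. The slack $\log n$ makes the failure probability tend to zero and costs one
logarithm in the running time. -/
theorem law_lt_card_copies_le {Δ : ThresholdWeighting G} {size : ℕ → V → ℕ}
    (hs : IsRounding Δ size) {n : ℕ} (hn : 1 < n) {H : G.Subgraph} {κ : ℝ}
    (hκ : Δ.weight H ≤ κ) :
    law Δ n (size n) {ω | ⌊(n : ℝ) ^ κ * Real.log n⌋₊ < (copies H (sampleGraph G (size n) ω)).card} ≤
      ENNReal.ofReal (2 ^ Fintype.card V / Real.log n) := by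
  have hn1 : (1 : ℝ) < n := by exact_mod_cast hn
  have hlog := Real.log_pos hn1
  have hpow : 0 < (n : ℝ) ^ κ := by positivity
  have ht : 0 < (n : ℝ) ^ κ * Real.log n := by positivity
  calc _ ≤ law Δ n (size n) {ω | ENNReal.ofReal ((n : ℝ) ^ κ * Real.log n) ≤
          ((copies H (sampleGraph G (size n) ω)).card : ENNReal)} := by
        refine measure_mono fun ω hω => ?_
        have := (Nat.floor_lt ht.le).1 hω
        exact (ENNReal.ofReal_le_ofReal this.le).trans_eq (ENNReal.ofReal_natCast _)
    _ ≤ (∫⁻ ω, ((copies H (sampleGraph G (size n) ω)).card : ENNReal) ∂law Δ n (size n)) /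
          ENNReal.ofReal ((n : ℝ) ^ κ * Real.log n) :=
        meas_ge_le_lintegral_div Measurable.of_discrete.aemeasurable
          (by simpa using ht) ENNReal.ofReal_ne_top
    _ ≤ ENNReal.ofReal (2 ^ Fintype.card V * (n : ℝ) ^ κ) /
          ENNReal.ofReal ((n : ℝ) ^ κ * Real.log n) := by
        gcongr
        refine (lintegral_card_copies_le hs hn.le H).trans (ENNReal.ofReal_le_ofReal ?_)
        gcongr
        exact hn1.le
    _ = ENNReal.ofReal (2 ^ Fintype.card V / Real.log n) := by
        rw [← ENNReal.ofReal_div_of_pos ht]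
        congr 1
        field_simp

/-- Union bound over the terms of `S`, whose number does not depend on `n`. -/
theorem tendsto_law_card_copies_le {Δ : ThresholdWeighting G} {size : ℕ → V → ℕ}
    (hs : IsRounding Δ size) {S : List G.Subgraph} {κ : ℝ} (hκ : ∀ H ∈ S, Δ.weight H ≤ κ) :
    Tendsto (fun n : ℕ => law Δ n (size n) {ω | ∀ H ∈ S,
      (copies H (sampleGraph G (size n) ω)).card ≤ ⌊(n : ℝ) ^ κ * Real.log n⌋₊}) atTop (𝓝 1) := by
  have hlim : Tendsto (fun n : ℕ => 1 - ∑ H ∈ S.toFinset,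
      ENNReal.ofReal (2 ^ Fintype.card V / Real.log n)) atTop (𝓝 1) := by
    have h₁ : Tendsto (fun n : ℕ => 2 ^ Fintype.card V / Real.log n) atTop (𝓝 0) :=
      (Real.tendsto_log_atTop.comp tendsto_natCast_atTop_atTop).const_div_atTop _
    have h₂ := tendsto_finsetSum S.toFinset fun _ _ => ENNReal.tendsto_ofReal h₁
    simpa using ENNReal.Tendsto.sub tendsto_const_nhds h₂ (.inl ENNReal.one_ne_top)
  refine tendsto_of_tendsto_of_tendsto_of_le_of_le' hlim tendsto_const_nhds ?_
    (.of_forall fun n => prob_le_one)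
  filter_upwards [eventually_gt_atTop 1] with n hn
  have hc : {ω | ∀ H ∈ S, (copies H (sampleGraph G (size n) ω)).card ≤
      ⌊(n : ℝ) ^ κ * Real.log n⌋₊}ᶜ = ⋃ H ∈ S.toFinset,
        {ω | ⌊(n : ℝ) ^ κ * Real.log n⌋₊ < (copies H (sampleGraph G (size n) ω)).card} := by
    ext ω
    simp
  rw [tsub_le_iff_right, ← prob_add_prob_compl (μ := law Δ n (size n)) (s := {ω | ∀ H ∈ S,
    (copies H (sampleGraph G (size n) ω)).card ≤ ⌊(n : ℝ) ^ κ * Real.log n⌋₊})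
    MeasurableSet.of_discrete, hc]
  gcongr
  refine (measure_biUnion_finset_le _ _).trans (Finset.sum_le_sum fun H hH => ?_)
  exact law_lt_card_copies_le hs hn (hκ H (List.mem_toFinset.1 hH))

end ColoredSubgraph

end

noncomputable section

open Function (update)
open scoped Classical

namespace ColoredSubgraph

variable {V : Type} [Fintype V] {G : SimpleGraph V}

/-! ### The running time on threshold random graphs -/

theorem one_le_log {n : ℕ} (hn : 3 ≤ n) : 1 ≤ Real.log n := by
  have hn' : (3 : ℝ) ≤ n := by exact_mod_cast hn
  rw [Real.le_log_iff_exp_le (by linarith)]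
  linarith [Real.exp_one_lt_three]

theorem size_le_log {k n : ℕ} (hn : 3 ≤ n) (hk : (k : ℝ) ≤ 2 * n) :
    (Nat.size k : ℝ) ≤ 5 * Real.log n := by
  have hn' : (3 : ℝ) ≤ n := by exact_mod_cast hn
  have hlog := one_le_log hn
  rcases Nat.eq_zero_or_pos (Nat.size k) with h | h
  · rw [h]; push_cast; linarith
  · have h₁ : 2 ^ (Nat.size k - 1) ≤ k := Nat.lt_size.1 (by omega)
    -- Here $k\le 2n\le n^2$, so $(\mathrm{size}(k)-1)\log 2\le 2\log n$; with $\log 2>0.69$ and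
    -- $\log n\ge 1$ the constant $5$ is ample.
    have h₂ : ((2 : ℝ) ^ (Nat.size k - 1)) ≤ (n : ℝ) ^ 2 := by
      have : ((2 ^ (Nat.size k - 1) : ℕ) : ℝ) ≤ k := by exact_mod_cast h₁
      push_cast at this
      nlinarith
    have h₃ := Real.log_le_log (by positivity) h₂
    rw [Real.log_pow, Real.log_pow, Nat.cast_sub h] at h₃
    have h₄ := Real.log_two_gt_d9
    have h₅ : (1 : ℝ) ≤ Nat.size k := by exact_mod_cast h
    push_cast at h₃
    nlinarith

theorem sizesLength_le {m : V → ℕ} {n : ℕ} (hn : 3 ≤ n) (hm : ∀ u, (m u : ℝ) ≤ 2 * n) :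
    (sizesLength m : ℝ) + 1 ≤ (6 * Fintype.card V + 1) * Real.log n := by
  have hlog := one_le_log hn
  have h : (sizesLength m : ℝ) ≤ ∑ _u : V, 6 * Real.log n := by
    rw [sizesLength]
    push_cast
    refine Finset.sum_le_sum fun u _ => ?_
    linarith [size_le_log hn (hm u)]
  rw [Finset.sum_const, nsmul_eq_mul, Finset.card_univ] at h
  linarith

/-- A constant that bounds `deciderConst` for all union sequences. -/
def unionConst (G : SimpleGraph V) : ℕ :=
  4 * Fintype.card G.Subgraph * stepConst (Finset.univ : Finset V).toList +
    (otherRegs V G.Subgraph).length * (2 * ((Finset.univ : Finset V).toList.length + 3) + 1) + 35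

/-- The terms of `S` are distinct, so there are at most as many as subgraphs of `G`. This frees the
constant from `S`, and thereby from `Δ`. -/
theorem deciderConst_le {S : List G.Subgraph} (hS : S.Nodup) : deciderConst S ≤ unionConst G := by
  have h : S.length ≤ Fintype.card G.Subgraph := hS.length_le_card
  have h' : 4 * S.length * stepConst (Finset.univ : Finset V).toList ≤
      4 * Fintype.card G.Subgraph * stepConst (Finset.univ : Finset V).toList := by gcongr
  unfold deciderConst unionConst solveConst
  omega

/-- The constant of the main theorem. -/
def mainConst (G : SimpleGraph V) : ℕ :=
  unionConst G * (6 * Fintype.card V + 1) ^ 2 * (Fintype.card V ^ 2 + 2) + 3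

theorem time_le {S : List G.Subgraph} (hS : S.Nodup) {m : V → ℕ} {n : ℕ} (hn : 3 ≤ n)
    (hm : ∀ u, (m u : ℝ) ≤ 2 * n) {κ : ℝ} (hκ : 0 ≤ κ) :
    ((deciderConst S * (sizesLength m + 1) ^ 2 *
      ((Fintype.card V ^ 2 + 1) * ⌊(n : ℝ) ^ κ * Real.log n⌋₊ + 1) : ℕ) : ℝ) ≤
        mainConst G * (n : ℝ) ^ κ * Real.log n ^ mainConst G := by
  have hlog := one_le_log hn
  have hP : (1 : ℝ) ≤ (n : ℝ) ^ κ :=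
    Real.one_le_rpow (by exact_mod_cast (by omega : 1 ≤ n)) hκ
  have h₁ : (deciderConst S : ℝ) ≤ unionConst G := by exact_mod_cast deciderConst_le hS
  have h₂ := sizesLength_le hn hm
  have h₃ := Nat.floor_le (zero_le_one.trans (one_le_mul_of_one_le_of_one_le hP hlog))
  have h₄ : ((Fintype.card V : ℝ) ^ 2 + 1) * ⌊(n : ℝ) ^ κ * Real.log n⌋₊ + 1 ≤
      ((Fintype.card V : ℝ) ^ 2 + 2) * ((n : ℝ) ^ κ * Real.log n) := by
    have := mul_le_mul_of_nonneg_left h₃ (by positivity : 0 ≤ (Fintype.card V : ℝ) ^ 2 + 1)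
    linarith [one_le_mul_of_one_le_of_one_le hP hlog]
  push_cast
  calc _ ≤ (unionConst G : ℝ) * ((6 * Fintype.card V + 1) * Real.log n) ^ 2 *
        (((Fintype.card V : ℝ) ^ 2 + 2) * ((n : ℝ) ^ κ * Real.log n)) := by gcongr
    _ = (unionConst G * (6 * Fintype.card V + 1) ^ 2 * (Fintype.card V ^ 2 + 2) : ℕ) *
        (n : ℝ) ^ κ * Real.log n ^ 3 := by push_cast; ring
    -- `mainConst G` is also used as the exponent, which is why it was made at least `3`: two
    -- logarithms come from the lengths of the words, one from the slack in Markov's inequality.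
    _ ≤ mainConst G * (n : ℝ) ^ κ * Real.log n ^ mainConst G := by
        gcongr
        · exact Nat.le_add_right _ _
        · exact Nat.le_add_left _ _

theorem decider_answersAASWithin (hG : ∀ u, ∃ v, G.Adj u v) {Δ : ThresholdWeighting G}
    {S : List G.Subgraph} (hS : IsUnionSequence G S) {κ : ℝ} (hκ : 0 ≤ κ)
    (hle : ∀ H ∈ S, Δ.weight H ≤ κ) {size : ℕ → V → ℕ} (hs : IsRounding Δ size) :
    AnswersAASWithin Δ size (decider S)
      fun n => mainConst G * (n : ℝ) ^ κ * Real.log n ^ mainConst G := by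
  refine tendsto_of_tendsto_of_tendsto_of_le_of_le' (tendsto_law_card_copies_le hs hle)
    tendsto_const_nhds ?_ (.of_forall fun n => prob_le_one)
  filter_upwards [eventually_ge_atTop 3] with n hn
  refine measure_mono fun ω hω w hw => ?_
  have hn' : (1 : ℝ) ≤ n := by exact_mod_cast (by omega : 1 ≤ n)
  refine ⟨_, time_le hS.1 hn (fun u => (hs.le (by omega) u).trans ?_) hκ,
    decider_answers hG hS hw ?_ fun H hH => (hω H hH).trans (Nat.le_mul_of_pos_left _ (by omega))⟩
  · have := Real.rpow_le_rpow_of_exponent_le hn' (Δ.α_le_one u)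
    rw [Real.rpow_one] at this
    linarith
  -- The factor $|V|^2+1$ in the choice of `N` leaves room for both the input edges and the lists of
  -- copies.
  · refine (ncard_edgeSet_le (fun p q => adj_of_sampleGraph_adj) fun u v h => hω _ ?_).trans
      (Nat.mul_le_mul_right _ (Nat.le_succ _))
    have := (hS.exists_adj (List.mem_of_getLast? hS.2.1)).2 u v (SimpleGraph.Subgraph.top_adj.2 h)
    exact this

end ColoredSubgraph

end

/-! ### The main theorem -/

theorem mainTheorem4 {V : Type} [Fintype V] [Nonempty V] (G : SimpleGraph V)
    (hG : ∀ u : V, ∃ v : V, G.Adj u v) :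
    ∃ c : ℕ, ∀ Δ : ColoredSubgraph.ThresholdWeighting G,
      ColoredSubgraph.kappaOf G Δ ≤ ColoredSubgraph.kappa G ∧
      ∃ M : Turing.TM2ComputableAux (ColoredSubgraph.Symbol V) Bool,
        ColoredSubgraph.Decides G M ∧
        ∀ size : ℕ → V → ℕ, ColoredSubgraph.IsRounding Δ size →
          ColoredSubgraph.AnswersAASWithin Δ size M
            (fun n => c * (n : ℝ) ^ ColoredSubgraph.kappaOf G Δ * Real.log n ^ c) ∧
          ColoredSubgraph.AnswersAASWithin Δ size M
            (fun n => c * (n : ℝ) ^ ColoredSubgraph.kappa G * Real.log n ^ c) := by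
  refine ⟨ColoredSubgraph.mainConst G, fun Δ => ?_⟩
  have hle := ColoredSubgraph.kappaOf_le_kappa hG Δ
  have h0 := ColoredSubgraph.kappaOf_nonneg hG Δ
  obtain ⟨S, hS, hκ, -⟩ := ColoredSubgraph.exists_isUnionSequence_weight_le hG Δ
  exact ⟨hle, ColoredSubgraph.decider S, ColoredSubgraph.decider_decides hG hS, fun size hs =>
    ⟨ColoredSubgraph.decider_answersAASWithin hG hS h0 hκ hs,
      -- The same machine is analyzed again with the larger threshold $\kappa(G)$, which also bounds
      -- the weights of the terms of `S`.
      ColoredSubgraph.decider_answersAASWithin hG hS (h0.trans hle)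
        (fun H hH => (hκ H hH).trans hle) hs⟩⟩
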